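/- **Setting.** Let $\Omega\subset\mathbb R^2$ be a bounded polygonal domain (open, connected, Lipschitz boundary) with outward unit normal $\mathbf n=(n_1,n_2)$; points are written $(x,y)$. Put $\partial_0\Omega=\{n_1\neq0\}\subset\partial\Omega$ and $\partial_-\Omega=\{z\in\partial\Omega\setminus\partial_0\Omega:\ xn_2<0\}$. Assume that $\partial_-\Omega$ has positive one-dimensional Hausdorff measure and that $xn_2\ge0$ on $\partial_0\Omega$. Let $Lu=-u_{xx}+xu_y$. Write $(\cdot,\cdot)_S$, $\|\cdot\|_S$ for the inner product and norm of $L_2(S)$, with $S=\Omega$ if omitted. **Meshes.** Fix $\sigma>0$. Let $\mathcal T$ be a finite set of disjoint open triangles $T\subset\Omega$ whose closures cover $\overline\Omega$ exactly, with inradius $\rho_T\ge\sigma h_T$, where $h_T=\operatorname{diam}T<1$, and put $h_{\min}=\min_T h_T$. For $p\ge1$ let $V_h=V_h^p$ be the space of functions continuous on $\overline\Omega$ that are polynomials of total degree at most $p$ on each $T\in\mathcal T$ and vanish on $\partial_-\Omega$. **Parameters.** Let $C_{inv},C_{INV}>0$ be constants with $$\|v\|_{\partial T}^2\le C_{inv}\,p^2h_T^{-1}\|v\|_T^2,\qquad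 \|\nabla v\|_T\le C_{INV}\,p^2h_T^{-1}\|v\|_T\qquad(v\in\mathbb P_p(T),\ T\in\mathcal T).$$ On $T$ put $$\delta_T=\frac{C_{inv}^2}{6}\Big(3\|xn_2\|_{L_\infty(\partial_-T)}+2\|n_1\|_{L_\infty(\partial T)}^2\Big)\frac{p^4}{h_T^2},\qquad \tau_T=\frac{h_T^2}{4C_{INV}^2p^4},$$ with $\mathbf n$ the outward normal of $T$ and $\partial_-T=\{z\in\partial T: xn_2<0\}$, and $A|_T=\begin{pmatrix}\alpha&\beta\\\beta&\gamma\end{pmatrix}$ with $\alpha=(8\delta_T)^{-1}$, $\beta=(24\delta_T^2)^{-1}$, $\gamma=(64\delta_T^3)^{-1}$. Put $(v,w)_A=(v,w)+(\nabla v,A\nabla w)$, $\|v\|_A=(v,v)_A^{1/2}$ and, for time-dependent $U,V$, $$a_h(U,V)=(U_x,V_x)+(xU_y,V)+\sum_{T}(U_t+LU,\tau_T(V_t+xV_y))_T+\sum_{T}(\nabla LU,A\nabla V)_T .$$ **Fully discrete method ($f=0$).** Let $0=t_0<\dots<t_N=t_f$, $k_n=t_n-t_{n-1}$, $I_n=(t_{n-1},t_n]$,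 $q\ge0$, and let $V_{h,k}$ be the space of $V:(0,t_f]\to V_h$ that on each $I_n$ are polynomials in $t$ of degree at most $q$ with coefficients in $V_h$. Given $U(t_0^-)\in V_h$, $U\in V_{h,k}$ satisfies, for all $V\in V_{h,k}$, $$\sum_{n=1}^N\int_{I_n}\big((U_t,V)_A+a_h(U,V)\big)\,dt+\sum_{n=2}^{N}\big(U(t_{n-1}^+)-U(t_{n-1}^-),V(t_{n-1}^+)\big)_A+(U(t_0^+),V(t_0^+))_A=(U(t_0^-),V(t_0^+))_A .$$ **Semi-discrete method ($f=0$).** Let $\mathcal V$ be a linear space of functions $V:[0,t_f]\to V_h$, continuous on $[0,t_f]$ and differentiable on $(0,t_f)$ (for instance, all of them). $U\in\mathcal V$ satisfies $(U_t,V)_A+a_h(U,V)=0$ on $(0,t_f)$ for all $V\in\mathcal V$. **Theorem.** (0) There are $C_{inv},C_{INV}>0$ depending only on $\sigma$ such that the two inverse inequalities hold for every triangle $T$ with $\rho_T\ge\sigma h_T$ and every $p\ge1$. Moreover, for every $C_{inv}>0$ there is $c_{\rm hc}\in(0,1)$, depending only on $\Omega$, $\sigma$ and $C_{inv}$, such that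 for all $C_{INV}$, $\mathcal T$ and $p$ as above, all $t_f>0$, and $\kappa:=c_{\rm hc}h_{\min}^4p^{-8}$: (1) Every fully discrete solution satisfies $$\|U(t_f)\|_A^2\le\prod_{n=1}^N\Big(1+\frac{\kappa k_n}{2(q+1)^2}\Big)^{-1}\|U(t_0^-)\|_A^2 .$$ (2) If $k_n=k$ for all $n$, then $$\|U(t_f)\|_A\le\Big(1+\frac{\kappa k}{2(q+1)^2}\Big)^{-\frac{t_f}{2k}}\|U(t_0^-)\|_A,$$ and the right-hand side tends to $e^{-\frac{\kappa}{4(q+1)^2}t_f}\|U(t_0^-)\|_A$ as $k\to0^+$. (3) Every semi-discrete solution satisfies $\|U(t_f)\|_A\le e^{-\kappa t_f/4}\|U(0)\|_A$. -/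

import Mathlib

open MeasureTheory Filter Topology

noncomputable section

namespace Kolmogorov

/-- The plane, with the Euclidean norm; `z 0` is the coordinate `x` and `z 1` the coordinate `y`. -/
abbrev Plane := EuclideanSpace ℝ (Fin 2)

/-! ### Domains and their boundary -/

/-- `Ω` lies locally above the graph of a Lipschitz function, in suitable orthonormal coordinates,
near each of its boundary points. -/
def HasLipschitzBoundary (Ω : Set Plane) : Prop :=
  ∀ z ∈ frontier Ω, ∃ (e₁ e₂ : Plane) (K : NNReal) (φ : ℝ → ℝ) (r : ℝ),
    ‖e₁‖ = 1 ∧ ‖e₂‖ = 1 ∧ inner ℝ e₁ e₂ = 0 ∧ LipschitzWith K φ ∧ 0 < r ∧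
    ∀ z' ∈ Metric.ball z r, z' ∈ Ω ↔ φ (inner ℝ (z' - z) e₁) < inner ℝ (z' - z) e₂

/-- Bounded polygonal domains with Lipschitz boundary. -/
structure IsPolygonalDomain (Ω : Set Plane) : Prop where
  isOpen : IsOpen Ω
  isConnected : IsConnected Ω
  isBounded : Bornology.IsBounded Ω
  polygonal : ∃ S : Finset (Plane × Plane), frontier Ω ⊆ ⋃ s ∈ S, segment ℝ s.1 s.2
  lipschitz : HasLipschitzBoundary Ω

/-- `n` is the outward unit normal to `Ω` at `z`: near `z`, the polygonal set `Ω` coincides with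
the open half plane through `z` with outward unit normal `n`. For a polygonal domain (and for a
triangle) this holds at all boundary points but finitely many. -/
def IsOutwardNormal (Ω : Set Plane) (z n : Plane) : Prop :=
  ‖n‖ = 1 ∧ ∃ r > 0, ∀ z' ∈ Metric.ball z r, z' ∈ Ω ↔ inner ℝ (z' - z) n < 0

/-- The inflow boundary `∂₋Ω`: `n₁ = 0` and `x n₂ < 0`. -/
def inflowBoundary (Ω : Set Plane) : Set Plane :=
  {z | ∃ n, IsOutwardNormal Ω z n ∧ n 0 = 0 ∧ z 0 * n 1 < 0}

/-! ### Triangulations and finite element spaces -/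

/-- The open triangle with given vertices. -/
def tri (T : Affine.Triangle ℝ Plane) : Set Plane :=
  interior (convexHull ℝ (Set.range T.points))

/-- The diameter `h_T`. -/
def hT (T : Affine.Triangle ℝ Plane) : ℝ := Metric.diam (tri T)

/-- The inradius of `T` is at least `σ h_T`. -/
def ShapeRegular (σ : ℝ) (T : Affine.Triangle ℝ Plane) : Prop :=
  ∃ c, Metric.ball c (σ * hT T) ⊆ tri T

/-- Finitely many disjoint open triangles in `Ω` whose closures cover the closure of `Ω`
exactly. -/
structure IsTriangulation (Ω : Set Plane) (𝒯 : Finset (Affine.Triangle ℝ Plane)) : Prop where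
  subset : ∀ T ∈ 𝒯, tri T ⊆ Ω
  disjoint : (𝒯 : Set (Affine.Triangle ℝ Plane)).PairwiseDisjoint tri
  cover : ⋃ T ∈ 𝒯, closure (tri T) = closure Ω

/-- The minimal meshsize. -/
def hmin (𝒯 : Finset (Affine.Triangle ℝ Plane)) : ℝ := sInf (hT '' (𝒯 : Set _))

/-- The function on the plane given by a polynomial in `x, y`. -/
def polyFun (P : MvPolynomial (Fin 2) ℝ) (z : Plane) : ℝ := MvPolynomial.eval (fun i => z i) P

/-- The `H¹`-conforming finite element space `V_h^p`: functions, continuous on the closure of `Ω`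
(and extended by zero outside it), that are polynomials of total degree at most `p` on each
element and vanish on the inflow boundary. -/
def femSpace (Ω : Set Plane) (𝒯 : Finset (Affine.Triangle ℝ Plane)) (p : ℕ) :
    Submodule ℝ (Plane → ℝ) where
  carrier := {v | ContinuousOn v (closure Ω) ∧ (∀ z ∉ closure Ω, v z = 0) ∧
    (∀ T ∈ 𝒯, ∃ P : MvPolynomial (Fin 2) ℝ, P.totalDegree ≤ p ∧ Set.EqOn v (polyFun P) (tri T)) ∧
    ∀ z ∈ inflowBoundary Ω, v z = 0}
  zero_mem' := by
    refine ⟨continuousOn_const, fun _ _ => rfl, fun T _ => ⟨0, by simp, fun z _ => ?_⟩,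
      fun _ _ => rfl⟩
    simp [polyFun]
  add_mem' := by
    rintro v w ⟨hv1, hv2, hv3, hv4⟩ ⟨hw1, hw2, hw3, hw4⟩
    refine ⟨hv1.add hw1, fun z hz => by simp [hv2 z hz, hw2 z hz], fun T hT => ?_,
      fun z hz => by simp [hv4 z hz, hw4 z hz]⟩
    obtain ⟨P, hP, hPv⟩ := hv3 T hT
    obtain ⟨Q, hQ, hQw⟩ := hw3 T hT
    refine ⟨P + Q, (MvPolynomial.totalDegree_add P Q).trans (max_le hP hQ), fun z hz => ?_⟩
    simp [polyFun, hPv hz, hQw hz]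
  smul_mem' := by
    rintro c v ⟨hv1, hv2, hv3, hv4⟩
    refine ⟨hv1.const_smul c, fun z hz => by simp [hv2 z hz], fun T hT => ?_,
      fun z hz => by simp [hv4 z hz]⟩
    obtain ⟨P, hP, hPv⟩ := hv3 T hT
    refine ⟨c • P, (MvPolynomial.totalDegree_smul_le c P).trans hP, fun z hz => ?_⟩
    simp [polyFun, hPv hz]

/-! ### Differential operators and forms -/

/-- `∂w/∂x`. -/
def dx (w : Plane → ℝ) (z : Plane) : ℝ := fderiv ℝ w z (EuclideanSpace.single 0 1)

/-- `∂w/∂y`. -/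
def dy (w : Plane → ℝ) (z : Plane) : ℝ := fderiv ℝ w z (EuclideanSpace.single 1 1)

/-- `x w_y`. -/
def xdy (w : Plane → ℝ) (z : Plane) : ℝ := z 0 * dy w z

/-- `L w = - w_xx + x w_y`, taken pointwise (so elementwise, for piecewise polynomials). -/
def opL (w : Plane → ℝ) (z : Plane) : ℝ := - dx (dx w) z + xdy w z

/-- The `L₂(S)` inner product. -/
def ip (S : Set Plane) (v w : Plane → ℝ) : ℝ := ∫ z in S, v z * w z

/-- `‖v‖²` in `L₂(∂T)`: the sum over the three edges of the integral with respect to arc length. -/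
def bdryNormSq (T : Affine.Triangle ℝ Plane) (v : Plane → ℝ) : ℝ :=
  ∑ i : Fin 3, dist (T.points i) (T.points (i + 1)) *
    ∫ s in (0 : ℝ)..1, v (AffineMap.lineMap (T.points i) (T.points (i + 1)) s) ^ 2

/-- `C` is a constant in the trace-inverse inequality `‖v‖²_∂T ≤ C p² h_T⁻¹ ‖v‖²_T` for polynomials
`v` of degree at most `p` on `T`. -/
def TraceInverse (C : ℝ) (p : ℕ) (T : Affine.Triangle ℝ Plane) : Prop :=
  ∀ P : MvPolynomial (Fin 2) ℝ, P.totalDegree ≤ p →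
    bdryNormSq T (polyFun P) ≤ C * p ^ 2 / hT T * ip (tri T) (polyFun P) (polyFun P)

/-- `C` is a constant in the inverse inequality `‖∇v‖_T ≤ C p² h_T⁻¹ ‖v‖_T` for polynomials `v` of
degree at most `p` on `T`. -/
def GradInverse (C : ℝ) (p : ℕ) (T : Affine.Triangle ℝ Plane) : Prop :=
  ∀ P : MvPolynomial (Fin 2) ℝ, P.totalDegree ≤ p →
    √(ip (tri T) (dx (polyFun P)) (dx (polyFun P)) + ip (tri T) (dy (polyFun P)) (dy (polyFun P)))
      ≤ C * p ^ 2 / hT T * √(ip (tri T) (polyFun P) (polyFun P))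

/-- `‖x n₂‖_{L∞(∂₋T)}`, with `∂₋T` the part of `∂T` where `x n₂ < 0` (zero if that part is empty). -/
def supInflow (T : Affine.Triangle ℝ Plane) : ℝ :=
  sSup {a | ∃ z n, IsOutwardNormal (tri T) z n ∧ z 0 * n 1 < 0 ∧ a = |z 0 * n 1|}

/-- `‖n₁‖_{L∞(∂T)}`. -/
def supNormalX (T : Affine.Triangle ℝ Plane) : ℝ :=
  sSup {a | ∃ z n, IsOutwardNormal (tri T) z n ∧ a = |n 0|}

/-- `δ_T = (C_inv² / 6) (3 ‖x n₂‖_{L∞(∂₋T)} + 2 ‖n₁‖²_{L∞(∂T)}) p⁴ / h_T²`. -/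
def delta (Cinv : ℝ) (p : ℕ) (T : Affine.Triangle ℝ Plane) : ℝ :=
  Cinv ^ 2 / 6 * (3 * supInflow T + 2 * supNormalX T ^ 2) * p ^ 4 / hT T ^ 2

def alpha (Cinv : ℝ) (p : ℕ) (T : Affine.Triangle ℝ Plane) : ℝ := (8 * delta Cinv p T)⁻¹

def beta (Cinv : ℝ) (p : ℕ) (T : Affine.Triangle ℝ Plane) : ℝ := (24 * delta Cinv p T ^ 2)⁻¹

def gamma (Cinv : ℝ) (p : ℕ) (T : Affine.Triangle ℝ Plane) : ℝ := (64 * delta Cinv p T ^ 3)⁻¹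

/-- `τ_T = h_T² / (4 C_INV² p⁴)`. -/
def tau (CINV : ℝ) (p : ℕ) (T : Affine.Triangle ℝ Plane) : ℝ := hT T ^ 2 / (4 * CINV ^ 2 * p ^ 4)

/-- `(∇v, A ∇w)_T` for given gradients `∇v = (v₁, v₂)` and `∇w = (w₁, w₂)`, with
`A = [[α, β], [β, γ]]` on `T`. -/
def ipA (Cinv : ℝ) (p : ℕ) (T : Affine.Triangle ℝ Plane) (v₁ v₂ w₁ w₂ : Plane → ℝ) : ℝ :=
  ip (tri T) v₁ (fun z => alpha Cinv p T * w₁ z + beta Cinv p T * w₂ z) +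
    ip (tri T) v₂ (fun z => beta Cinv p T * w₁ z + gamma Cinv p T * w₂ z)

/-- The inner product `(v, w)_A = (v, w) + (∇v, A ∇w)`. -/
def innerA (Ω : Set Plane) (𝒯 : Finset (Affine.Triangle ℝ Plane)) (p : ℕ) (Cinv : ℝ)
    (v w : Plane → ℝ) : ℝ :=
  ip Ω v w + ∑ T ∈ 𝒯, ipA Cinv p T (dx v) (dy v) (dx w) (dy w)

/-- The norm `‖v‖_A`. -/
def normA (Ω : Set Plane) (𝒯 : Finset (Affine.Triangle ℝ Plane)) (p : ℕ) (Cinv : ℝ)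
    (v : Plane → ℝ) : ℝ :=
  √(innerA Ω 𝒯 p Cinv v v)

/-- The streamline-upwinded form
`(U_x, V_x) + (x U_y, V) + ∑_T (U_t + L U, τ (V_t + x V_y))_T`; the arguments `u, ut, v, vt` stand
for `U, U_t, V, V_t` at a fixed time. -/
def formSUPG (Ω : Set Plane) (𝒯 : Finset (Affine.Triangle ℝ Plane)) (p : ℕ) (CINV : ℝ)
    (u ut v vt : Plane → ℝ) : ℝ :=
  ip Ω (dx u) (dx v) + ip Ω (xdy u) v +
    ∑ T ∈ 𝒯, ip (tri T) (fun z => ut z + opL u z) (fun z => tau CINV p T * (vt z + xdy v z))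

/-- The form `a_h(U, V) = a_{h,SUPG}(U, V) + ∑_T (∇ L U, A ∇V)_T`. -/
def formA (Ω : Set Plane) (𝒯 : Finset (Affine.Triangle ℝ Plane)) (p : ℕ) (Cinv CINV : ℝ)
    (u ut v vt : Plane → ℝ) : ℝ :=
  formSUPG Ω 𝒯 p CINV u ut v vt +
    ∑ T ∈ 𝒯, ipA Cinv p T (dx (opL u)) (dy (opL u)) (dx v) (dy v)

/-! ### Time-dependent functions and the two methods -/

/-- The time derivative of a time-dependent function. -/
def dt (V : ℝ → Plane → ℝ) (s : ℝ) (z : Plane) : ℝ := deriv (fun r => V r z) s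

/-- `V(s⁺)`. -/
def rightTrace (V : ℝ → Plane → ℝ) (s : ℝ) : Plane → ℝ := limUnder (𝓝[>] s) V

/-- `V(s⁻)`. -/
def leftTrace (V : ℝ → Plane → ℝ) (s : ℝ) : Plane → ℝ := limUnder (𝓝[<] s) V

/-- `0 = t_0 < t_1 < ⋯ < t_N = t_f`. -/
def IsPartition (tf : ℝ) (N : ℕ) (t : ℕ → ℝ) : Prop :=
  t 0 = 0 ∧ t N = tf ∧ ∀ n < N, t n < t (n + 1)

/-- The space-time finite element space: on each `I_{n+1} = (t_n, t_{n+1}]`, `n < N`, a polynomial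
in time of degree at most `q` with coefficients in `V_h^p`. -/
def spaceTime (Ω : Set Plane) (𝒯 : Finset (Affine.Triangle ℝ Plane)) (p q N : ℕ) (t : ℕ → ℝ) :
    Set (ℝ → Plane → ℝ) :=
  {V | ∀ n < N, ∃ c : ℕ → Plane → ℝ, (∀ j, c j ∈ femSpace Ω 𝒯 p) ∧
    ∀ s ∈ Set.Ioc (t n) (t (n + 1)), V s = ∑ j ∈ Finset.range (q + 1), s ^ j • c j}

/-- The bilinear form `B(U, V)` of the space-time method. -/
def formB (Ω : Set Plane) (𝒯 : Finset (Affine.Triangle ℝ Plane)) (p : ℕ) (Cinv CINV : ℝ)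
    (N : ℕ) (t : ℕ → ℝ) (U V : ℝ → Plane → ℝ) : ℝ :=
  (∑ n ∈ Finset.range N, ∫ s in (t n)..(t (n + 1)),
      (innerA Ω 𝒯 p Cinv (dt U s) (V s) +
        formA Ω 𝒯 p Cinv CINV (U s) (dt U s) (V s) (dt V s))) +
    (∑ n ∈ Finset.Ico 1 N,
      innerA Ω 𝒯 p Cinv (rightTrace U (t n) - leftTrace U (t n)) (rightTrace V (t n))) +
    innerA Ω 𝒯 p Cinv (rightTrace U (t 0)) (rightTrace V (t 0))

/-- `U` solves the fully discrete method with `f = 0` and initial datum `U(t_0⁻) = U₀`. -/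
def IsDGSolution (Ω : Set Plane) (𝒯 : Finset (Affine.Triangle ℝ Plane)) (p q : ℕ)
    (Cinv CINV : ℝ) (N : ℕ) (t : ℕ → ℝ) (U₀ : Plane → ℝ) (U : ℝ → Plane → ℝ) : Prop :=
  U ∈ spaceTime Ω 𝒯 p q N t ∧ ∀ V ∈ spaceTime Ω 𝒯 p q N t,
    formB Ω 𝒯 p Cinv CINV N t U V = innerA Ω 𝒯 p Cinv U₀ (rightTrace V (t 0))

/-- `V_h^p`-valued functions of time, continuous on `[0, t_f]` and differentiable on `(0, t_f)`. -/
def IsCurve (Ω : Set Plane) (𝒯 : Finset (Affine.Triangle ℝ Plane)) (p : ℕ) (tf : ℝ)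
    (V : ℝ → Plane → ℝ) : Prop :=
  (∀ s ∈ Set.Icc 0 tf, V s ∈ femSpace Ω 𝒯 p) ∧ ContinuousOn V (Set.Icc 0 tf) ∧
    ∀ s ∈ Set.Ioo 0 tf, ∀ z, DifferentiableAt ℝ (fun r => V r z) s

/-- `U` solves the semi-discrete Galerkin method with `f = 0`, trial and test functions being taken
from the same linear space `𝒱` of time-dependent `V_h^p`-valued functions. -/
def IsSemidiscreteSolution (Ω : Set Plane) (𝒯 : Finset (Affine.Triangle ℝ Plane)) (p : ℕ)
    (Cinv CINV tf : ℝ) (𝒱 : Submodule ℝ (ℝ → Plane → ℝ)) (U : ℝ → Plane → ℝ) : Prop :=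
  (∀ V ∈ 𝒱, IsCurve Ω 𝒯 p tf V) ∧ U ∈ 𝒱 ∧
    ∀ V ∈ 𝒱, ∀ s ∈ Set.Ioo 0 tf,
      innerA Ω 𝒯 p Cinv (dt U s) (V s) +
        formA Ω 𝒯 p Cinv CINV (U s) (dt U s) (V s) (dt V s) = 0

end Kolmogorov

end

open MeasureTheory Filter Topology

noncomputable section

namespace Kolmogorov

section

/-! ### Polynomials of one variable on the unit interval -/

/-! The decay is an energy argument in `‖·‖_A`. Its core is the coercivity estimate
`exists_hypocoercivity_constant`: `κ/4 · ‖u‖_A²` is at most `a_h` with the pair `(u, u_t)` in both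
arguments, for arbitrary `u, u_t` in `V_h`.

Diffusion alone controls `u_x` only. Control of `u_y` comes from the commutator: `∂_x L u = L u_x +
u_y` and `∂_y L u = L u_y`. So `(∇Lu, A∇u)_T` contains `β ‖u_y‖²`, a mixed term `α (u_y, u_x)`, and
a quadratic expression in terms `(L g, g)_T`. The latter are not non-negative on a single element,
but integration by parts leaves only boundary terms as a loss, and the trace-inverse inequality
gives `(L g, g)_T ≥ -(3/2) δ_T ‖g‖²` (`triInt_opLp_ge`). The entries of `A` are such that the form
is diagonal in `u_x + u_y/(3δ)` and `u_y`, and the mixed terms cancel exactly; what remains is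
`-(3/16) ‖u_x‖² + 7/(384 δ²) ‖u_y‖²` (`ipA_opLp_ge`). The streamline term costs at most another
`1/16 ‖u_x‖²`, whatever `u_t` is (`ip_streamline_ge`), so `3/4 ‖u_x‖²` survives.

Two global facts complete coercivity. First, `(x u_y, u) ≥ 0` (`sum_advection_nonneg`): on almost
every vertical line `u²` can be integrated piece by piece, and an end of a piece where the boundary
value has the wrong sign lies on the inflow boundary, where `u = 0`. Second, a Friedrichs inequality
whose constant depends on the domain only (`exists_friedrichs_constant`): control of the `L₂` norm
by the Dirichlet energy spreads from the exterior, across the inflow boundary, through the connected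
domain and up to its boundary, by translations. As `δ_T` is bounded below uniformly and above by a
multiple of `p⁴/h_T²`, the weight of `‖u_y‖²` is of order at least `h_T⁴ p⁻⁸`, which is the size of
`κ`.

For the discontinuous Galerkin method, testing with the solution cut off to one time interval gives
an energy identity on that interval. Coercivity bounds the dissipation below by a time integral of
`‖U‖_A²`, and a polynomial of degree `q` in time satisfies `k/(q+1)² ‖U(t_n)‖_A² ≤ ∫ ‖U‖_A²`
(`form_endpoint_le`); this is the decay factor per step. Semi-discretely, `e^{κs/2} ‖U(s)‖_A²` is
antitone.

The inverse inequalities of part (0) reduce to one variable. Legendre polynomials give the endpoint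
bound `n² ∫ g²` for polynomials `g` of degree less than `n`, and the `L₂` Markov inequality. These
are applied along lines in the three parallelograms spanned at the vertices by half edges, which lie
in the closed triangle and cover the open one. The endpoint bound is also what yields `(q+1)²` in
time. -/

open Polynomial in
/-- The integral of a polynomial over the unit interval, as a linear form. -/
def unitIntegral : Polynomial ℝ →ₗ[ℝ] ℝ where
  toFun P := ∫ x in (0 : ℝ)..1, P.eval x
  map_add' P Q := by
    simp only [Polynomial.eval_add]
    exact intervalIntegral.integral_add (P.continuous.intervalIntegrable _ _)
      (Q.continuous.intervalIntegrable _ _)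
  map_smul' c P := by simp

open Polynomial

lemma unitIntegral_apply (P : ℝ[X]) : unitIntegral P = ∫ x in (0 : ℝ)..1, P.eval x := rfl

lemma unitIntegral_derivative (P : ℝ[X]) :
    unitIntegral (derivative P) = P.eval 1 - P.eval 0 := by
  rw [unitIntegral_apply]
  exact intervalIntegral.integral_eq_sub_of_hasDerivAt (fun x _ => P.hasDerivAt x)
    ((derivative P).continuous.intervalIntegrable _ _)

lemma unitIntegral_sq_nonneg (P : ℝ[X]) : 0 ≤ unitIntegral (P * P) := by
  rw [unitIntegral_apply]
  refine intervalIntegral.integral_nonneg zero_le_one fun x _ => ?_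
  rw [eval_mul]; exact mul_self_nonneg _

lemma unitIntegral_sq_pos {P : ℝ[X]} (hP : P ≠ 0) : 0 < unitIntegral (P * P) := by
  refine lt_of_le_of_ne (unitIntegral_sq_nonneg P) fun h => hP ?_
  have h0 : ∀ x ∈ Set.Icc (0 : ℝ) 1, (P * P).eval x = 0 := by
    by_contra! hc
    obtain ⟨x, hx, hne⟩ := hc
    have : 0 < ∫ x in (0 : ℝ)..1, (P * P).eval x := by
      refine intervalIntegral.integral_pos zero_lt_one (P * P).continuous.continuousOn
        (fun y _ => by rw [eval_mul]; exact mul_self_nonneg _) ⟨x, hx, ?_⟩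
      refine lt_of_le_of_ne ?_ hne.symm
      rw [eval_mul]; exact mul_self_nonneg _
    rw [unitIntegral_apply] at h
    exact absurd h this.ne
  refine Polynomial.eq_zero_of_infinite_isRoot P ?_
  refine (Set.Icc_infinite (zero_lt_one (α := ℝ))).mono fun x hx => ?_
  have := h0 x hx
  rw [eval_mul, mul_self_eq_zero] at this
  exact this

/-- The normalized Legendre polynomials on the unit interval. -/
lemma exists_orthonormal_polynomial (n : ℕ) : ∃ φ : ℝ[X], φ.natDegree = n ∧
    unitIntegral (φ * φ) = 1 ∧ ∀ r : ℝ[X], r.degree < n → unitIntegral (φ * r) = 0 := by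
  obtain ⟨f, hf, hf0⟩ : ∃ f : degreeLT ℝ (n + 1), f ≠ 0 ∧
      ∀ r : degreeLT ℝ n, unitIntegral ((f : ℝ[X]) * r) = 0 := by
    -- The pairing maps a space of dimension `n + 1` into the dual of one of dimension `n`, so it
    -- has a kernel.
    let T : degreeLT ℝ (n + 1) →ₗ[ℝ] (degreeLT ℝ n →ₗ[ℝ] ℝ) :=
      LinearMap.mk₂ ℝ (fun f r => unitIntegral ((f : ℝ[X]) * r))
        (by intros; simp [add_mul]) (by intros; simp) (by intros; simp [mul_add])
        (by intros; simp)
    have hfin : ∀ m, Module.finrank ℝ (degreeLT ℝ m) = m := fun m => by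
      rw [(degreeLTEquiv ℝ m).finrank_eq]; simp
    have : ∀ m, FiniteDimensional ℝ (degreeLT ℝ m) := fun m =>
      (degreeLTEquiv ℝ m).symm.finiteDimensional
    have hlt : Module.finrank ℝ (degreeLT ℝ n →ₗ[ℝ] ℝ) < Module.finrank ℝ (degreeLT ℝ (n + 1)) := by
      rw [Module.finrank_linearMap, hfin, hfin]; simp
    obtain ⟨f, hfk, hf⟩ := (Submodule.ne_bot_iff _).1 (LinearMap.ker_ne_bot_of_finrank_lt (f := T) hlt)
    refine ⟨f, hf, fun r => ?_⟩
    have := LinearMap.congr_fun (LinearMap.mem_ker.1 hfk) r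
    simpa [T] using this
  have hfne : (f : ℝ[X]) ≠ 0 := fun h => hf (Subtype.ext h)
  have hpos := unitIntegral_sq_pos hfne
  have hdeg : (f : ℝ[X]).natDegree = n := by
    refine le_antisymm ?_ ?_
    · have := mem_degreeLT.1 f.2
      exact Nat.lt_succ_iff.1 ((natDegree_lt_iff_degree_lt hfne).2 this)
    -- A kernel element of degree below `n` would be orthogonal to itself.
    · by_contra! h
      have h1 : (f : ℝ[X]).degree < n := (natDegree_lt_iff_degree_lt hfne).1 h
      exact hpos.ne' (hf0 ⟨f, mem_degreeLT.2 h1⟩)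
  set c := (√(unitIntegral ((f : ℝ[X]) * f)))⁻¹ with hc
  have hc0 : c ≠ 0 := inv_ne_zero (Real.sqrt_pos.2 hpos).ne'
  refine ⟨c • (f : ℝ[X]), by rw [natDegree_smul _ hc0, hdeg], ?_, fun r hr => ?_⟩
  · rw [smul_mul_smul_comm, map_smul, smul_eq_mul, hc, ← mul_inv, Real.mul_self_sqrt hpos.le,
      inv_mul_cancel₀ hpos.ne']
  · rw [smul_mul_assoc, map_smul, hf0 ⟨r, mem_degreeLT.2 hr⟩, smul_zero]

/-- The normalized Legendre polynomial of degree `n` on the unit interval. -/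
def legendre (n : ℕ) : ℝ[X] := (exists_orthonormal_polynomial n).choose

lemma natDegree_legendre (n : ℕ) : (legendre n).natDegree = n :=
  (exists_orthonormal_polynomial n).choose_spec.1

lemma unitIntegral_legendre_sq (n : ℕ) : unitIntegral (legendre n * legendre n) = 1 :=
  (exists_orthonormal_polynomial n).choose_spec.2.1

lemma unitIntegral_legendre_mul (n : ℕ) {r : ℝ[X]} (hr : r.degree < n) :
    unitIntegral (legendre n * r) = 0 :=
  (exists_orthonormal_polynomial n).choose_spec.2.2 r hr

lemma legendre_ne_zero (n : ℕ) : legendre n ≠ 0 := fun h => by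
  have := unitIntegral_legendre_sq n
  simp [h] at this

lemma degree_legendre (n : ℕ) : (legendre n).degree = n := by
  rw [degree_eq_natDegree (legendre_ne_zero n), natDegree_legendre]

lemma degree_X_mul_derivative_sub_lt (φ : ℝ[X]) :
    (X * derivative φ - (φ.natDegree : ℝ) • φ).degree < (φ.natDegree : WithBot ℕ) := by
  rw [degree_lt_iff_coeff_zero]
  intro m hm
  have hcoef : ∀ k, (X * derivative φ).coeff k = k * φ.coeff k := by
    intro k
    cases k with
    | zero => simp
    | succ k => rw [coeff_X_mul, coeff_derivative]; push_cast; ring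
  rw [coeff_sub, hcoef, coeff_smul, smul_eq_mul]
  rcases hm.eq_or_lt with h | h
  · subst h; ring
  · rw [coeff_eq_zero_of_natDegree_lt h]; ring

lemma degree_derivative_legendre_lt (n : ℕ) : (derivative (legendre n)).degree < n := by
  have := degree_derivative_lt (legendre_ne_zero n)
  rwa [degree_legendre] at this

/-- The leading terms of `X φ'` and `n φ` agree, so their difference has lower degree and is
orthogonal to `φ`. -/
lemma unitIntegral_X_mul_derivative_legendre (n : ℕ) :
    unitIntegral (legendre n * (X * derivative (legendre n))) = n := by
  have h1 := degree_X_mul_derivative_sub_lt (legendre n)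
  rw [natDegree_legendre] at h1
  have h2 := unitIntegral_legendre_mul n h1
  rw [mul_sub, map_sub, mul_smul_comm, map_smul, unitIntegral_legendre_sq] at h2
  simp at h2; linarith

/-- Integrate `(x φ²)' = φ² + 2 x φ φ'`. -/
lemma legendre_eval_one_sq (n : ℕ) : (legendre n).eval 1 ^ 2 = 2 * n + 1 := by
  have h := unitIntegral_derivative (X * (legendre n * legendre n))
  have e : derivative (X * (legendre n * legendre n)) = legendre n * legendre n
      + (2 : ℝ) • (legendre n * (X * derivative (legendre n))) := by
    simp only [derivative_mul, derivative_X, one_mul, smul_eq_C_mul]; 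
    rw [show (C (2 : ℝ) : ℝ[X]) = 2 from rfl]; ring
  rw [e, map_add, map_smul, unitIntegral_legendre_sq, unitIntegral_X_mul_derivative_legendre] at h
  simp at h; nlinarith

/-- The weight `x - 1` isolates the other endpoint; the additional term `φ φ'` integrates to zero
because `φ'` has lower degree. -/
lemma legendre_eval_zero_sq (n : ℕ) : (legendre n).eval 0 ^ 2 = 2 * n + 1 := by
  have h := unitIntegral_derivative ((X - 1) * (legendre n * legendre n))
  have e : derivative ((X - 1) * (legendre n * legendre n)) = legendre n * legendre n
      + (2 : ℝ) • (legendre n * (X * derivative (legendre n)))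
      - (2 : ℝ) • (legendre n * derivative (legendre n)) := by
    simp only [derivative_mul, derivative_X, derivative_sub, derivative_one, smul_eq_C_mul]
    rw [show (C (2 : ℝ) : ℝ[X]) = 2 from rfl]; ring
  rw [e, map_sub, map_add, map_smul, map_smul, unitIntegral_legendre_sq,
    unitIntegral_X_mul_derivative_legendre,
    unitIntegral_legendre_mul n (degree_derivative_legendre_lt n)] at h
  simp at h; nlinarith

/-- Splitting off the component along the Legendre polynomial of top degree. -/
lemma exists_legendre_decomposition (n : ℕ) {g : ℝ[X]} (hg : g.degree < (n + 1 : ℕ)) :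
    ∃ (c : ℝ) (r : ℝ[X]), g = c • legendre n + r ∧ r.degree < n ∧
      unitIntegral (g * g) = c ^ 2 + unitIntegral (r * r) := by
  have hl : (legendre n).coeff n ≠ 0 := by
    have := leadingCoeff_ne_zero.2 (legendre_ne_zero n)
    rwa [leadingCoeff, natDegree_legendre] at this
  set c := g.coeff n / (legendre n).coeff n with hc
  have hr : (g - c • legendre n).degree < n := by
    rw [degree_lt_iff_coeff_zero]
    intro m hm
    rw [coeff_sub, coeff_smul, smul_eq_mul]
    rcases hm.eq_or_lt with h | h
    · subst h; rw [hc]; field_simp; ring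
    · have hg' := (degree_lt_iff_coeff_zero g _).1 hg m (by exact_mod_cast h)
      rw [hg', coeff_eq_zero_of_natDegree_lt (by rwa [natDegree_legendre])]; ring
  refine ⟨c, g - c • legendre n, by ring, hr, ?_⟩
  set r := g - c • legendre n with hrdef
  have hgr : g = c • legendre n + r := by rw [hrdef]; ring
  have e : g * g = (c ^ 2) • (legendre n * legendre n) + (2 * c) • (legendre n * r) + r * r := by
    rw [hgr]; simp only [smul_eq_C_mul, C_mul, C_pow]
    rw [show (C (2 : ℝ) : ℝ[X]) = 2 from rfl]; ring
  rw [e, map_add, map_add, map_smul, map_smul, unitIntegral_legendre_sq,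
    unitIntegral_legendre_mul n hr]
  simp

/-- The reproducing kernel at an endpoint of the unit interval. -/
lemma exists_kernel_of_eval_sq {e : ℝ} (he : ∀ n, (legendre n).eval e ^ 2 = 2 * n + 1) (n : ℕ) :
    ∃ K : ℝ[X], K.degree < n ∧ unitIntegral (K * K) = (n : ℝ) ^ 2 ∧
      ∀ g : ℝ[X], g.degree < n → unitIntegral (g * K) = g.eval e := by
  induction n with
  | zero =>
    refine ⟨0, by simp, by simp, fun g hg => ?_⟩
    have : g = 0 := by
      have := (degree_lt_iff_coeff_zero g 0).1 (by exact_mod_cast hg)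
      ext m; simpa using this m (Nat.zero_le _)
    simp [this]
  | succ n ih =>
    obtain ⟨K, hK, hKK, hrep⟩ := ih
    have hlK := unitIntegral_legendre_mul n hK
    set a := (legendre n).eval e with ha
    -- The kernel is `∑_{k<n} φ_k(e) φ_k`; its squared norm is the sum of the first `n` odd numbers
    -- `2k + 1`.
    refine ⟨K + a • legendre n, ?_, ?_, fun g hg => ?_⟩
    · refine (degree_add_le _ _).trans_lt (max_lt (hK.trans (by exact_mod_cast n.lt_succ_self)) ?_)
      refine (degree_smul_le _ _).trans_lt ?_
      rw [degree_legendre]; exact_mod_cast n.lt_succ_self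
    · have e' : (K + a • legendre n) * (K + a • legendre n) = K * K + (2 * a) • (legendre n * K)
          + (a ^ 2) • (legendre n * legendre n) := by
        simp only [smul_eq_C_mul, C_mul, C_pow]
        rw [show (C (2 : ℝ) : ℝ[X]) = 2 from rfl]; ring
      rw [e', map_add, map_add, map_smul, map_smul, hKK, hlK, unitIntegral_legendre_sq, he]
      push_cast; simp; ring
    · obtain ⟨c, r, hgr, hr, -⟩ := exists_legendre_decomposition n hg
      have e' : g * (K + a • legendre n) = c • (legendre n * K)
          + (c * a) • (legendre n * legendre n) + r * K + a • (legendre n * r) := by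
        rw [hgr]; simp only [smul_eq_C_mul, C_mul]; ring
      rw [e', map_add, map_add, map_add, map_smul, map_smul, map_smul, hlK,
        unitIntegral_legendre_sq, hrep r hr, unitIntegral_legendre_mul n hr, hgr]
      simp [ha]

/-- Cauchy–Schwarz between `g` and its reproducing kernel, by expanding the square of `n² g - g(e)
K`. -/
lemma sq_le_of_kernel {n : ℕ} {e : ℝ} {K g : ℝ[X]} (hKK : unitIntegral (K * K) = (n : ℝ) ^ 2)
    (hrep : unitIntegral (g * K) = g.eval e) :
    g.eval e ^ 2 ≤ (n : ℝ) ^ 2 * unitIntegral (g * g) := by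
  rcases eq_or_ne (n : ℝ) 0 with hn | hn
  · have hK0 : K = 0 := by
      by_contra h
      have := unitIntegral_sq_pos h
      rw [hKK, hn] at this; simp at this
    rw [← hrep, hK0]; simp [hn]
  · set b := g.eval e
    have h := unitIntegral_sq_nonneg (((n : ℝ) ^ 2) • g - b • K)
    have e' : (((n : ℝ) ^ 2) • g - b • K) * (((n : ℝ) ^ 2) • g - b • K) =
        ((n : ℝ) ^ 4) • (g * g) - (2 * (n : ℝ) ^ 2 * b) • (g * K) + (b ^ 2) • (K * K) := by
      simp only [smul_eq_C_mul, C_mul, C_pow]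
      rw [show (C (2 : ℝ) : ℝ[X]) = 2 from rfl]; ring
    rw [e', map_add, map_sub, map_smul, map_smul, map_smul, hKK, hrep] at h
    simp only [smul_eq_mul] at h
    have hn2 : 0 < (n : ℝ) ^ 2 := by positivity
    have : 0 ≤ (n : ℝ) ^ 2 * ((n : ℝ) ^ 2 * unitIntegral (g * g) - b ^ 2) := by nlinarith
    nlinarith [nonneg_of_mul_nonneg_right this hn2]

lemma eval_one_sq_le {n : ℕ} {g : ℝ[X]} (hg : g.degree < n) :
    g.eval 1 ^ 2 ≤ (n : ℝ) ^ 2 * unitIntegral (g * g) := by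
  obtain ⟨K, -, hKK, hrep⟩ := exists_kernel_of_eval_sq legendre_eval_one_sq n
  exact sq_le_of_kernel hKK (hrep g hg)

lemma eval_zero_sq_le {n : ℕ} {g : ℝ[X]} (hg : g.degree < n) :
    g.eval 0 ^ 2 ≤ (n : ℝ) ^ 2 * unitIntegral (g * g) := by
  obtain ⟨K, -, hKK, hrep⟩ := exists_kernel_of_eval_sq legendre_eval_zero_sq n
  exact sq_le_of_kernel hKK (hrep g hg)

/-- As `φ''` has lower degree than `φ`, integration by parts turns `D = ∫ φ'²` into the endpoint
values of `φ φ'`. There `φ²` is `2n + 1` and `φ'²` is at most `n² D`, so `D²` is bounded by a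
multiple of `D`. -/
lemma unitIntegral_derivative_legendre_sq_le (n : ℕ) :
    unitIntegral (derivative (legendre n) * derivative (legendre n)) ≤
      4 * (n : ℝ) ^ 2 * (2 * n + 1) := by
  set d := derivative (legendre n) with hd
  set D := unitIntegral (d * d) with hD
  have hD0 : 0 ≤ D := unitIntegral_sq_nonneg d
  have h1 := eval_one_sq_le (degree_derivative_legendre_lt n)
  have h0 := eval_zero_sq_le (degree_derivative_legendre_lt n)
  rw [← hd, ← hD] at h1 h0
  have hdd : (derivative d).degree < n := by
    refine lt_of_le_of_lt ?_ (degree_derivative_legendre_lt n)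
    exact degree_derivative_le
  have hft := unitIntegral_derivative (legendre n * d)
  rw [derivative_mul, map_add, unitIntegral_legendre_mul n hdd, ← hd, ← hD] at hft
  simp only [eval_mul, add_zero] at hft
  have e1 := legendre_eval_one_sq n
  have e0 := legendre_eval_zero_sq n
  set a := (legendre n).eval 1
  set b := (legendre n).eval 0
  set x := d.eval 1
  set y := d.eval 0
  have hsq : D ^ 2 ≤ 4 * (n : ℝ) ^ 2 * (2 * n + 1) * D := by
    have hx : (a * x) ^ 2 ≤ (2 * n + 1) * ((n : ℝ) ^ 2 * D) := by
      rw [mul_pow, e1]; gcongr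
    have hy : (b * y) ^ 2 ≤ (2 * n + 1) * ((n : ℝ) ^ 2 * D) := by
      rw [mul_pow, e0]; gcongr
    have hD2 : D ^ 2 = (a * x - b * y) ^ 2 := congrArg (· ^ 2) hft
    nlinarith [sq_nonneg (a * x + b * y)]
  rcases hD0.eq_or_lt with h | h
  · rw [← h]; positivity
  · nlinarith

/-- The `L₂` Markov inequality on the unit interval. -/
lemma unitIntegral_derivative_sq_le (p : ℕ) {g : ℝ[X]} (hg : g.degree < (p + 1 : ℕ)) :
    unitIntegral (derivative g * derivative g) ≤
      4 * (p : ℝ) ^ 2 * (p + 1) ^ 2 * unitIntegral (g * g) := by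
  induction p generalizing g with
  | zero =>
    have : derivative g = 0 := by
      rcases eq_or_ne g 0 with h | h
      · simp [h]
      · exact derivative_of_natDegree_zero
          (Nat.lt_one_iff.1 ((natDegree_lt_iff_degree_lt h).2 (by simpa using hg)))
    simp [this]
  | succ p ih =>
    obtain ⟨c, r, hgr, hr, hsq⟩ := exists_legendre_decomposition (p + 1) hg
    have ih := ih hr
    have hl := unitIntegral_derivative_legendre_sq_le (p + 1)
    set l := derivative (legendre (p + 1)) with hldef
    set d := derivative r with hd
    set A : ℝ := 4 * (p : ℝ) ^ 2 * (p + 1) ^ 2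
    set L : ℝ := 4 * ((p + 1 : ℕ) : ℝ) ^ 2 * (2 * (p + 1 : ℕ) + 1) with hL
    have hA : 0 ≤ A := by positivity
    have hL0 : 0 < L := by positivity
    have e' : derivative g * derivative g = (c ^ 2) • (l * l) + (2 * c) • (l * d) + d * d := by
      rw [hgr, derivative_add, derivative_smul, ← hldef, ← hd]
      simp only [smul_eq_C_mul, C_mul, C_pow]
      rw [show (C (2 : ℝ) : ℝ[X]) = 2 from rfl]; ring
    rw [e', hsq, map_add, map_add, map_smul, map_smul, smul_eq_mul, smul_eq_mul]
    -- In `(A + L)(c² + R)` the products `L c²` and `A R` pay for the two squares, and `A c² + L R`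
    -- is what the mixed term costs by Cauchy–Schwarz.
    have hAL : A + L ≤ 4 * ((p + 1 : ℕ) : ℝ) ^ 2 * ((p + 1 : ℕ) + 1) ^ 2 := by
      simp only [A, L]; push_cast; nlinarith [sq_nonneg (p : ℝ), (Nat.cast_nonneg p : (0 : ℝ) ≤ p)]
    set R := unitIntegral (r * r) with hR
    have hR0 : 0 ≤ R := unitIntegral_sq_nonneg r
    refine le_trans ?_ (mul_le_mul_of_nonneg_right hAL (by positivity))
    -- Young's inequality with weights `A` and `L`
    have hy : ∀ s : ℝ, 0 ≤ unitIntegral (l * l) * s ^ 2 - 2 * s * unitIntegral (l * d)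
        + unitIntegral (d * d) := by
      intro s
      have := unitIntegral_sq_nonneg (s • l - d)
      have e2 : (s • l - d) * (s • l - d) = (s ^ 2) • (l * l) - (2 * s) • (l * d) + d * d := by
        simp only [smul_eq_C_mul, C_mul, C_pow]
        rw [show (C (2 : ℝ) : ℝ[X]) = 2 from rfl]; ring
      rw [e2, map_add, map_sub, map_smul, map_smul, smul_eq_mul, smul_eq_mul] at this
      linarith
    have hcs : unitIntegral (l * d) ^ 2 ≤ L * (A * R) := by
      set x := unitIntegral (l * d)
      set y := unitIntegral (d * d)
      have hdd : 0 ≤ y := unitIntegral_sq_nonneg d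
      have := hy (x / L)
      have h3 : L * (x / L) ^ 2 - 2 * (x / L) * x + y ≥ 0 := by
        nlinarith [mul_le_mul_of_nonneg_right hl (sq_nonneg (x / L))]
      have h4 : L * (x / L) ^ 2 - 2 * (x / L) * x + y = (L * y - x ^ 2) / L := by
        field_simp; ring
      rw [h4, ge_iff_le, le_div_iff₀ hL0, zero_mul] at h3
      nlinarith
    have hcross : 2 * c * unitIntegral (l * d) ≤ A * c ^ 2 + L * R := by
      refine le_of_abs_le (abs_le_of_sq_le_sq ?_ (by positivity))
      nlinarith [sq_nonneg (A * c ^ 2 - L * R), mul_le_mul_of_nonneg_left hcs (sq_nonneg c)]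
    nlinarith [mul_le_mul_of_nonneg_left hl (sq_nonneg c)]

end

section

/-! ### Polynomial functions on the plane -/

open MvPolynomial in
lemma hasFDerivAt_polyFun (P : MvPolynomial (Fin 2) ℝ) (z : Plane) :
    HasFDerivAt (polyFun P)
      (polyFun (pderiv 0 P) z • (EuclideanSpace.proj 0 : Plane →L[ℝ] ℝ) +
        polyFun (pderiv 1 P) z • (EuclideanSpace.proj 1 : Plane →L[ℝ] ℝ)) z := by
  induction P using MvPolynomial.induction_on with
  | C a =>
    have h : polyFun (C a) = fun _ => a := by funext w; simp [polyFun]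
    rw [h]
    convert! hasFDerivAt_const (𝕜 := ℝ) a z using 1
    simp [polyFun]
  | add P Q hP hQ =>
    have := hP.add hQ
    convert! this using 1
    · funext w; simp [polyFun]
    · ext w; simp [polyFun]; ring
  | mul_X P i hP =>
    have hX : HasFDerivAt (fun w : Plane => w i) (EuclideanSpace.proj i : Plane →L[ℝ] ℝ) z :=
      (EuclideanSpace.proj i : Plane →L[ℝ] ℝ).hasFDerivAt
    have := hP.mul hX
    convert! this using 1
    · funext w; simp [polyFun]
    · ext w
      fin_cases i <;> simp [polyFun, pderiv_X] <;> ring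

open MvPolynomial

lemma fderiv_polyFun (P : MvPolynomial (Fin 2) ℝ) (z e : Plane) :
    fderiv ℝ (polyFun P) z e = polyFun (pderiv 0 P) z * e 0 + polyFun (pderiv 1 P) z * e 1 := by
  rw [(hasFDerivAt_polyFun P z).fderiv]; simp

lemma dx_polyFun (P : MvPolynomial (Fin 2) ℝ) : dx (polyFun P) = polyFun (pderiv 0 P) := by
  funext z; simp [dx, fderiv_polyFun]

lemma dy_polyFun (P : MvPolynomial (Fin 2) ℝ) : dy (polyFun P) = polyFun (pderiv 1 P) := by
  funext z; simp [dy, fderiv_polyFun]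

lemma continuous_polyFun (P : MvPolynomial (Fin 2) ℝ) : Continuous (polyFun P) :=
  continuous_iff_continuousAt.2 fun z => (hasFDerivAt_polyFun P z).continuousAt

@[simp] lemma polyFun_add (P Q : MvPolynomial (Fin 2) ℝ) (z : Plane) :
    polyFun (P + Q) z = polyFun P z + polyFun Q z := by simp [polyFun]

@[simp] lemma polyFun_sub (P Q : MvPolynomial (Fin 2) ℝ) (z : Plane) :
    polyFun (P - Q) z = polyFun P z - polyFun Q z := by simp [polyFun]

@[simp] lemma polyFun_neg (P : MvPolynomial (Fin 2) ℝ) (z : Plane) :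
    polyFun (-P) z = -polyFun P z := by simp [polyFun]

@[simp] lemma polyFun_mul (P Q : MvPolynomial (Fin 2) ℝ) (z : Plane) :
    polyFun (P * Q) z = polyFun P z * polyFun Q z := by simp [polyFun]

@[simp] lemma polyFun_smul (c : ℝ) (P : MvPolynomial (Fin 2) ℝ) (z : Plane) :
    polyFun (c • P) z = c * polyFun P z := by simp [polyFun]

@[simp] lemma polyFun_one (z : Plane) : polyFun 1 z = 1 := by simp [polyFun]

@[simp] lemma polyFun_X (i : Fin 2) (z : Plane) : polyFun (X i) z = z i := by simp [polyFun]

lemma totalDegree_pderiv_le (i : Fin 2) (P : MvPolynomial (Fin 2) ℝ) :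
    (pderiv i P).totalDegree ≤ P.totalDegree := by
  refine Finset.sup_le fun m hm => ?_
  have hm' : P.coeff (m + Finsupp.single i 1) ≠ 0 := by
    intro h
    rw [mem_support_iff, coeff_pderiv] at hm
    exact hm (by simp [h])
  refine le_trans ?_ (le_totalDegree (mem_support_iff.2 hm'))
  rw [Finsupp.sum_add_index' (by simp) (by simp)]
  exact Nat.le_add_right _ _

/-- The restriction of a polynomial function to a line is a polynomial of one variable. -/
lemma exists_polynomial_line (P : MvPolynomial (Fin 2) ℝ) {p : ℕ} (hP : P.totalDegree ≤ p)
    (a b : Plane) : ∃ g : Polynomial ℝ, g.degree < (p + 1 : ℕ) ∧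
      (∀ r, g.eval r = polyFun P (a + r • b)) ∧
      ∀ r, (Polynomial.derivative g).eval r = fderiv ℝ (polyFun P) (a + r • b) b := by
  let f : Fin 2 → Polynomial ℝ := fun i => Polynomial.C (a i) + Polynomial.X * Polynomial.C (b i)
  obtain ⟨g, hg⟩ : ∃ g : Polynomial ℝ, g = aeval f P := ⟨_, rfl⟩
  have hev : ∀ r, g.eval r = polyFun P (a + r • b) := by
    intro r
    rw [hg]
    have : (Polynomial.evalRingHom r) (aeval f P) = polyFun P (a + r • b) := by
      rw [polyFun, aeval_def, MvPolynomial.hom_eval₂]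
      simp only [MvPolynomial.eval, eval₂Hom]
      congr 1
      · ext; simp
      · funext i; simp [f]; ring
    exact this
  refine ⟨g, ?_, hev, fun r => ?_⟩
  · rw [hg]
    refine lt_of_le_of_lt Polynomial.degree_le_natDegree ?_
    have := aeval_natDegree_le (n := 1) P hP f (fun i => ?_)
    · exact_mod_cast Nat.lt_succ_of_le (by simpa using this)
    · refine (Polynomial.natDegree_add_le _ _).trans (max_le (by simp) ?_)
      exact (Polynomial.natDegree_mul_C_le _ _).trans Polynomial.natDegree_X_le
  · have h1 := g.hasDerivAt r
    have h2 : HasDerivAt (fun r : ℝ => polyFun P (a + r • b))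
        (fderiv ℝ (polyFun P) (a + r • b) b) r := by
      have hl : HasDerivAt (fun r : ℝ => a + r • b) b r := by
        have := ((hasDerivAt_id r).smul_const b).const_add a
        rwa [one_smul] at this
      have hF := (hasFDerivAt_polyFun P (a + r • b)).differentiableAt.hasFDerivAt
      exact HasFDerivAt.comp_hasDerivAt (f := fun r : ℝ => a + r • b) r hF hl
    have h3 : (fun r : ℝ => polyFun P (a + r • b)) = fun r => g.eval r := by
      funext r; rw [hev]
    rw [h3] at h2
    exact h1.unique h2

/-! ### The plane as a product -/

/-- The plane as a product of two lines. -/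
def planeEquiv : Plane ≃ᵐ ℝ × ℝ :=
  (MeasurableEquiv.toLp 2 (Fin 2 → ℝ)).symm.trans MeasurableEquiv.finTwoArrow

@[simp] lemma planeEquiv_symm_zero (q : ℝ × ℝ) : (planeEquiv.symm q) 0 = q.1 := rfl

@[simp] lemma planeEquiv_symm_one (q : ℝ × ℝ) : (planeEquiv.symm q) 1 = q.2 := rfl

lemma measurePreserving_planeEquiv : MeasurePreserving planeEquiv :=
  (EuclideanSpace.volume_preserving_symm_measurableEquiv_toLp (Fin 2)).trans
    (volume_preserving_finTwoArrow ℝ)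

lemma plane_ext {z w : Plane} (h0 : z 0 = w 0) (h1 : z 1 = w 1) : z = w := by
  ext i; fin_cases i <;> assumption

/-- The cross product of `b - a` and `c - a`. -/
def cr (a b c : Plane) : ℝ := (b 0 - a 0) * (c 1 - a 1) - (b 1 - a 1) * (c 0 - a 0)

/-- The affine map of the reference triangle onto the triangle with vertices `a, b, c`. -/
def param (a b c : Plane) (q : ℝ × ℝ) : Plane := a + q.1 • (b - a) + q.2 • (c - a)

lemma continuous_param (a b c : Plane) : Continuous (param a b c) := by
  unfold param; fun_prop

@[simp] lemma param_apply (a b c : Plane) (q : ℝ × ℝ) (i : Fin 2) :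
    param a b c q i = a i + q.1 * (b i - a i) + q.2 * (c i - a i) := by
  simp [param]

/-- The reference map is a linear map of determinant `cr a b c`, followed by a translation. -/
lemma map_param {a b c : Plane} (h : cr a b c ≠ 0) :
    MeasurableEmbedding (param a b c) ∧
    (volume : Measure Plane) = ENNReal.ofReal |cr a b c| • Measure.map (param a b c) volume := by
  let A : Matrix (Fin 2) (Fin 2) ℝ := !![b 0 - a 0, c 0 - a 0; b 1 - a 1, c 1 - a 1]
  let f : Plane →ₗ[ℝ] Plane := (EuclideanSpace.basisFun (Fin 2) ℝ).toBasis.constr ℝ ![b - a, c - a]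
  have hf : ∀ z, f z = z 0 • (b - a) + z 1 • (c - a) := by
    intro z
    rw [Module.Basis.constr_apply_fintype]
    simp [Fin.sum_univ_two]
  have hdet : LinearMap.det f = cr a b c := by
    rw [← LinearMap.det_toMatrix (EuclideanSpace.basisFun (Fin 2) ℝ).toBasis, Matrix.det_fin_two]
    simp [LinearMap.toMatrix_apply, hf, cr]; ring
  have hd0 : LinearMap.det f ≠ 0 := hdet ▸ h
  let F := LinearMap.equivOfDetNeZero f hd0
  let G : Plane ≃L[ℝ] Plane := F.toContinuousLinearEquiv
  have hG : ∀ z, G z = f z := fun z => rfl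
  have hp : param a b c = (fun z => a + z) ∘ G ∘ planeEquiv.symm := by
    funext q
    simp [param, hG, hf, add_assoc]
  have hm : Measure.map (param a b c) volume = ENNReal.ofReal |(cr a b c)⁻¹| • volume := by
    have h1 : Measure.map G volume = ENNReal.ofReal |(cr a b c)⁻¹| • volume := by
      have := Measure.map_linearMap_addHaar_eq_smul_addHaar (volume : Measure Plane) hd0
      rw [hdet] at this; exact this
    rw [hp, ← Measure.map_map (measurable_const_add a)
      (G.continuous.measurable.comp planeEquiv.symm.measurable),
      ← Measure.map_map G.continuous.measurable planeEquiv.symm.measurable,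
      measurePreserving_planeEquiv.symm.map_eq, h1, Measure.map_smul,
      (measurePreserving_add_left volume a).map_eq]
  refine ⟨?_, ?_⟩
  · rw [hp]
    exact (MeasurableEquiv.addLeft a).measurableEmbedding.comp
      (G.toHomeomorph.measurableEmbedding.comp planeEquiv.symm.measurableEmbedding)
  · rw [hm, smul_smul, ← ENNReal.ofReal_mul (abs_nonneg _), ← abs_mul, mul_inv_cancel₀ h]
    simp

lemma setIntegral_param {a b c : Plane} (h : cr a b c ≠ 0) (S : Set (ℝ × ℝ)) (F : Plane → ℝ) :
    ∫ z in param a b c '' S, F z = |cr a b c| * ∫ q in S, F (param a b c q) := by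
  obtain ⟨he, hv⟩ := map_param h
  conv_lhs => rw [hv]
  rw [Measure.restrict_smul, integral_smul_measure, he.setIntegral_map,
    Set.preimage_image_eq _ he.injective, ENNReal.toReal_ofReal (abs_nonneg _), smul_eq_mul]

end

section

/-! ### Triangles in barycentric coordinates -/

lemma cr_rotate (a b c : Plane) : cr b c a = cr a b c := by simp only [cr]; ring

lemma cr_add_cr_add_cr (a b c z : Plane) : cr z b c + cr a z c + cr a b z = cr a b c := by
  simp only [cr]; ring

lemma continuous_cr {f g h : Plane → Plane} (hf : Continuous f) (hg : Continuous g)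
    (hh : Continuous h) : Continuous fun z => cr (f z) (g z) (h z) := by
  unfold cr
  have : ∀ i : Fin 2, Continuous fun z : Plane => z i := fun i => by fun_prop
  have h1 := fun i => (this i).comp hf
  have h2 := fun i => (this i).comp hg
  have h3 := fun i => (this i).comp hh
  simp only [Function.comp_def] at h1 h2 h3
  exact (((h2 0).sub (h1 0)).mul ((h3 1).sub (h1 1))).sub
    (((h2 1).sub (h1 1)).mul ((h3 0).sub (h1 0)))

lemma barycentric_combination {a b c : Plane} (h : cr a b c ≠ 0) (z : Plane) :
    z = (cr z b c / cr a b c) • a + (cr a z c / cr a b c) • b + (cr a b z / cr a b c) • c := by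
  refine plane_ext ?_ ?_ <;> simp <;> field_simp <;> simp only [cr] <;> ring

/-- The three ratios of signed areas are the barycentric coordinates: affine in `z`, with sum one,
each equal to one at its own vertex and to zero at the others. -/
lemma mem_convexHull_iff_cr {a b c : Plane} (h : cr a b c ≠ 0) (z : Plane) :
    z ∈ convexHull ℝ {a, b, c} ↔
      0 ≤ cr z b c / cr a b c ∧ 0 ≤ cr a z c / cr a b c ∧ 0 ≤ cr a b z / cr a b c := by
  constructor
  · let S : Set Plane := {z | 0 ≤ cr z b c / cr a b c ∧ 0 ≤ cr a z c / cr a b c ∧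
      0 ≤ cr a b z / cr a b c}
    have hconv : Convex ℝ S := by
      intro x hx y hy s t hs ht hst
      have ht' : t = 1 - s := by linarith
      obtain ⟨x1, x2, x3⟩ := hx
      obtain ⟨y1, y2, y3⟩ := hy
      have e1 : cr (s • x + t • y) b c = s * cr x b c + t * cr y b c := by
        subst ht'; simp [cr]; ring
      have e2 : cr a (s • x + t • y) c = s * cr a x c + t * cr a y c := by
        subst ht'; simp [cr]; ring
      have e3 : cr a b (s • x + t • y) = s * cr a b x + t * cr a b y := by
        subst ht'; simp [cr]; ring
      refine ⟨?_, ?_, ?_⟩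
      · rw [e1, add_div, mul_div_assoc, mul_div_assoc]; positivity
      · rw [e2, add_div, mul_div_assoc, mul_div_assoc]; positivity
      · rw [e3, add_div, mul_div_assoc, mul_div_assoc]; positivity
    have hsub : ({a, b, c} : Set Plane) ⊆ S := by
      rintro w (rfl | rfl | rfl) <;> refine ⟨?_, ?_, ?_⟩ <;> first
        | (rw [div_self h]; exact zero_le_one)
        | (refine le_of_eq (Eq.symm ?_); rw [div_eq_zero_iff]; left; simp only [cr]; ring)
    exact fun hz => convexHull_min hsub hconv hz
  · rintro ⟨h1, h2, h3⟩
    have hs : cr z b c / cr a b c + cr a z c / cr a b c + cr a b z / cr a b c = 1 := by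
      rw [← add_div, ← add_div, cr_add_cr_add_cr, div_self h]
    rw [barycentric_combination h z]
    have hc := convex_convexHull ℝ ({a, b, c} : Set Plane)
    have ha : a ∈ convexHull ℝ ({a, b, c} : Set Plane) := subset_convexHull ℝ _ (by simp)
    have hb : b ∈ convexHull ℝ ({a, b, c} : Set Plane) := subset_convexHull ℝ _ (by simp)
    have hcc : c ∈ convexHull ℝ ({a, b, c} : Set Plane) := subset_convexHull ℝ _ (by simp)
    have := hc.sum_mem (t := Finset.univ)
      (w := ![cr z b c / cr a b c, cr a z c / cr a b c, cr a b z / cr a b c]) (z := ![a, b, c])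
      (by intro i _; fin_cases i <;> simpa) (by simpa [Fin.sum_univ_three] using hs)
      (by intro i _; fin_cases i <;> simpa)
    simpa [Fin.sum_univ_three] using this

/-- The open triangle with vertices `a, b, c`. -/
def openTri (a b c : Plane) : Set Plane := interior (convexHull ℝ {a, b, c})

lemma mem_openTri_iff {a b c : Plane} (h : cr a b c ≠ 0) (z : Plane) :
    z ∈ openTri a b c ↔
      0 < cr z b c / cr a b c ∧ 0 < cr a z c / cr a b c ∧ 0 < cr a b z / cr a b c := by
  constructor
  · intro hz
    -- moving away from a vertex decreases the corresponding barycentric coordinate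
    have key : ∀ w : Plane, ∃ ε : ℝ, 0 < ε ∧ z + ε • (z - w) ∈ convexHull ℝ {a, b, c} := by
      intro w
      have hcont : ContinuousAt (fun ε : ℝ => z + ε • (z - w)) 0 := by fun_prop
      have hn : convexHull ℝ {a, b, c} ∈ 𝓝 (z + (0 : ℝ) • (z - w)) := by
        simpa using mem_interior_iff_mem_nhds.1 hz
      have h2 := hcont.preimage_mem_nhds hn
      obtain ⟨r, hr, hball⟩ := Metric.mem_nhds_iff.1 h2
      exact ⟨r / 2, by positivity, hball (by simp [abs_of_pos hr, hr])⟩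
    -- The coordinate `x` belonging to the vertex becomes `(1 + ε) x - ε` under the displacement.
    have aux : ∀ {x ε y : ℝ}, 0 < ε → y = (1 + ε) * x - ε → 0 ≤ y → 0 < x := by
      intro x ε y hε hy h0
      by_contra! hx
      nlinarith
    refine ⟨?_, ?_, ?_⟩
    · obtain ⟨ε, hε, hw⟩ := key a
      refine aux hε ?_ ((mem_convexHull_iff_cr h _).1 hw).1
      field_simp; simp [cr]; ring
    · obtain ⟨ε, hε, hw⟩ := key b
      refine aux hε ?_ ((mem_convexHull_iff_cr h _).1 hw).2.1
      field_simp; simp [cr]; ring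
    · obtain ⟨ε, hε, hw⟩ := key c
      refine aux hε ?_ ((mem_convexHull_iff_cr h _).1 hw).2.2
      field_simp; simp [cr]; ring
  · intro hz
    have hopen : IsOpen {z | 0 < cr z b c / cr a b c ∧ 0 < cr a z c / cr a b c ∧
        0 < cr a b z / cr a b c} := by
      refine IsOpen.inter ?_ (IsOpen.inter ?_ ?_)
      · exact isOpen_lt continuous_const ((continuous_cr continuous_id continuous_const
          continuous_const).div_const _)
      · exact isOpen_lt continuous_const ((continuous_cr continuous_const continuous_id
          continuous_const).div_const _)
      · exact isOpen_lt continuous_const ((continuous_cr continuous_const continuous_const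
          continuous_id).div_const _)
    refine interior_maximal ?_ hopen hz
    rintro w ⟨h1, h2, h3⟩
    exact (mem_convexHull_iff_cr h w).2 ⟨h1.le, h2.le, h3.le⟩

/-- The reference triangle. -/
def refTri : Set (ℝ × ℝ) := {q | 0 < q.1 ∧ 0 < q.2 ∧ q.1 + q.2 < 1}

lemma cr_param_left (a b c : Plane) (q : ℝ × ℝ) :
    cr (param a b c q) b c = (1 - q.1 - q.2) * cr a b c := by simp [cr]; ring

lemma cr_param_mid (a b c : Plane) (q : ℝ × ℝ) :
    cr a (param a b c q) c = q.1 * cr a b c := by simp [cr]; ring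

lemma cr_param_right (a b c : Plane) (q : ℝ × ℝ) :
    cr a b (param a b c q) = q.2 * cr a b c := by simp [cr]; ring

lemma param_mem_openTri_iff {a b c : Plane} (h : cr a b c ≠ 0) (q : ℝ × ℝ) :
    param a b c q ∈ openTri a b c ↔ q ∈ refTri := by
  rw [mem_openTri_iff h, cr_param_left, cr_param_mid, cr_param_right]
  simp only [mul_div_cancel_right₀ _ h, refTri, Set.mem_ofPred_eq]
  constructor
  · rintro ⟨h1, h2, h3⟩; exact ⟨h2, h3, by linarith⟩
  · rintro ⟨h1, h2, h3⟩; exact ⟨by linarith, h1, h2⟩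

lemma exists_param_eq {a b c : Plane} (h : cr a b c ≠ 0) (z : Plane) :
    param a b c (cr a z c / cr a b c, cr a b z / cr a b c) = z := by
  conv_rhs => rw [barycentric_combination h z]
  refine plane_ext ?_ ?_ <;> simp <;> field_simp <;> simp only [cr] <;> ring

lemma openTri_eq_image {a b c : Plane} (h : cr a b c ≠ 0) :
    openTri a b c = param a b c '' refTri := by
  ext z
  constructor
  · intro hz
    refine ⟨_, ?_, exists_param_eq h z⟩
    rw [← param_mem_openTri_iff h, exists_param_eq h]; exact hz
  · rintro ⟨q, hq, rfl⟩
    exact (param_mem_openTri_iff h q).2 hq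

lemma cr_points_ne_zero (T : Affine.Triangle ℝ Plane) (i : Fin 3) :
    cr (T.points i) (T.points (i + 1)) (T.points (i + 2)) ≠ 0 := by
  have main : cr (T.points 0) (T.points 1) (T.points 2) ≠ 0 := by
    intro h
    have hind := affineIndependent_iff.1 T.independent Finset.univ
    set a := T.points 0 with ha
    set b := T.points 1 with hb
    set c := T.points 2 with hc
    have key : ∀ w0 w1 w2 : ℝ, w0 + w1 + w2 = 0 → w0 * a 0 + w1 * b 0 + w2 * c 0 = 0 →
        w0 * a 1 + w1 * b 1 + w2 * c 1 = 0 → w1 = 0 ∧ w2 = 0 := by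
      intro w0 w1 w2 hs h0 h1
      have := hind ![w0, w1, w2] (by simpa [Fin.sum_univ_three] using hs) (by
        refine plane_ext ?_ ?_
        · simpa [Fin.sum_univ_three, ← ha, ← hb, ← hc] using h0
        · simpa [Fin.sum_univ_three, ← ha, ← hb, ← hc] using h1)
      exact ⟨by simpa using this 1 (Finset.mem_univ _), by simpa using this 2 (Finset.mem_univ _)⟩
    simp only [cr] at h
    -- If the signed area vanishes, either coordinate of the two edge vectors provides the weights
    -- of an affine dependence. Independence makes these coordinates zero, so two vertices coincide.
    have k1 := key (-(c 1 - a 1) + (b 1 - a 1)) (c 1 - a 1) (-(b 1 - a 1)) (by ring)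
      (by linarith) (by ring)
    have k0 := key (-(c 0 - a 0) + (b 0 - a 0)) (c 0 - a 0) (-(b 0 - a 0)) (by ring)
      (by ring) (by linarith)
    have k := key (-1) 1 0 (by norm_num) (by linarith [k0.2]) (by linarith [k1.2])
    exact one_ne_zero k.1
  fin_cases i
  · exact main
  · show cr (T.points 1) (T.points 2) (T.points 0) ≠ 0
    rwa [cr_rotate]
  · show cr (T.points 2) (T.points 0) (T.points 1) ≠ 0
    rwa [cr_rotate, cr_rotate]

lemma range_points (T : Affine.Triangle ℝ Plane) (i : Fin 3) :
    Set.range T.points = {T.points i, T.points (i + 1), T.points (i + 2)} := by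
  ext z
  simp only [Set.mem_range, Set.mem_insert_iff, Set.mem_singleton_iff]
  constructor
  · rintro ⟨j, rfl⟩
    have : j = i ∨ j = i + 1 ∨ j = i + 2 := by revert i j; decide
    rcases this with rfl | rfl | rfl <;> simp
  · rintro (rfl | rfl | rfl) <;> exact ⟨_, rfl⟩

lemma tri_eq_openTri (T : Affine.Triangle ℝ Plane) (i : Fin 3) :
    tri T = openTri (T.points i) (T.points (i + 1)) (T.points (i + 2)) := by
  rw [tri, openTri, range_points T i]

/-! ### Outward normals of triangles -/

/-- The unit normal to the edge from `a` to `b` that points away from `c`. -/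
def edgeNormal (a b c : Plane) : Plane :=
  !₂[SignType.sign (cr a b c) * (b 1 - a 1) / dist a b,
    -(SignType.sign (cr a b c) * (b 0 - a 0) / dist a b)]

lemma dist_sq_eq (a b : Plane) : dist a b ^ 2 = (b 0 - a 0) ^ 2 + (b 1 - a 1) ^ 2 := by
  rw [dist_comm, EuclideanSpace.dist_eq, Real.sq_sqrt (by positivity)]
  simp [Fin.sum_univ_two, Real.dist_eq]

lemma dist_pos_of_cr_ne_zero {a b c : Plane} (h : cr a b c ≠ 0) : 0 < dist a b := by
  refine dist_pos.2 fun hab => h ?_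
  subst hab; simp [cr]

lemma inner_plane (z w : Plane) : inner ℝ z w = z 0 * w 0 + z 1 * w 1 := by
  simp [PiLp.inner_apply, Fin.sum_univ_two, mul_comm]

/-- Near an inner point of the edge the barycentric coordinates at `a` and `b` stay positive.
Membership is then decided by the coordinate at `c`, a negative multiple of the inner product with
the normal. -/
lemma isOutwardNormal_edgeNormal {a b c : Plane} (h : cr a b c ≠ 0) {s : ℝ}
    (hs : s ∈ Set.Ioo (0 : ℝ) 1) :
    IsOutwardNormal (openTri a b c) (AffineMap.lineMap a b s) (edgeNormal a b c) := by
  have hd := dist_pos_of_cr_ne_zero h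
  have hsgn : ((SignType.sign (cr a b c) : SignType) : ℝ) ^ 2 = 1 := by
    rcases lt_or_gt_of_ne h with h' | h' <;> simp [h']
  set z : Plane := AffineMap.lineMap a b s with hz
  have hz' : z = param a b c (s, 0) := by simp [hz, AffineMap.lineMap_apply, param, add_comm]
  refine ⟨?_, ?_⟩
  · have hsq : ‖edgeNormal a b c‖ ^ 2 = 1 := by
      rw [← real_inner_self_eq_norm_sq, inner_plane]
      simp only [edgeNormal]
      simp
      field_simp
      rw [dist_sq_eq]
      linear_combination ((b 0 - a 0) ^ 2 + (b 1 - a 1) ^ 2) * hsgn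
    have h0 := norm_nonneg (edgeNormal a b c)
    nlinarith
  · have c1 : Continuous fun w => cr w b c / cr a b c :=
      (continuous_cr continuous_id continuous_const continuous_const).div_const _
    have c2 : Continuous fun w => cr a w c / cr a b c :=
      (continuous_cr continuous_const continuous_id continuous_const).div_const _
    have hopen : {w | 0 < cr w b c / cr a b c ∧ 0 < cr a w c / cr a b c} ∈ 𝓝 z := by
      refine IsOpen.mem_nhds ((isOpen_lt continuous_const c1).inter
        (isOpen_lt continuous_const c2)) ⟨?_, ?_⟩
      · rw [hz', cr_param_left, mul_div_cancel_right₀ _ h]; simp; exact hs.2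
      · rw [hz', cr_param_mid, mul_div_cancel_right₀ _ h]; simp; exact hs.1
    obtain ⟨r, hr, hball⟩ := Metric.mem_nhds_iff.1 hopen
    refine ⟨r, hr, fun w hw => ?_⟩
    obtain ⟨w1, w2⟩ := hball hw
    rw [mem_openTri_iff h]
    have hin : inner ℝ (w - z) (edgeNormal a b c) =
        -(SignType.sign (cr a b c) * cr a b w / dist a b) := by
      rw [inner_plane, hz']
      simp only [edgeNormal]
      simp [cr]
      field_simp
      ring
    rw [hin, neg_lt_zero]
    have e1 : 0 < SignType.sign (cr a b c) * cr a b w / dist a b ↔ 0 < cr a b w / cr a b c := by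
      rcases lt_or_gt_of_ne h with h' | h'
      · simp only [h', sign_neg, SignType.coe_neg_one]
        rw [div_pos_iff_of_pos_right hd, div_pos_iff]
        constructor
        · intro hh; right; exact ⟨by linarith, h'⟩
        · rintro (⟨_, hh⟩ | ⟨hh, _⟩) <;> linarith
      · simp only [h', sign_pos, SignType.coe_one, one_mul]
        rw [div_pos_iff_of_pos_right hd, div_pos_iff_of_pos_right h']
    rw [e1]
    exact ⟨fun hh => hh.2.2, fun hh => ⟨w1, w2, hh⟩⟩

end

section
open MvPolynomial

/-! ### Integration over triangles -/

lemma isOpen_tri (T : Affine.Triangle ℝ Plane) : IsOpen (tri T) := isOpen_interior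

lemma isCompact_hull_points (T : Affine.Triangle ℝ Plane) :
    IsCompact (convexHull ℝ (Set.range T.points)) :=
  Set.Finite.isCompact_convexHull ℝ (Set.finite_range _)

lemma isBounded_tri (T : Affine.Triangle ℝ Plane) : Bornology.IsBounded (tri T) :=
  (isCompact_hull_points T).isBounded.subset interior_subset

lemma Continuous.integrableOn_tri {F : Plane → ℝ} (hF : Continuous F)
    (T : Affine.Triangle ℝ Plane) : IntegrableOn F (tri T) :=
  (hF.continuousOn.integrableOn_compact (isCompact_hull_points T)).mono_set interior_subset

/-- The integral of a polynomial over a triangle, as a linear form. -/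
def triInt (T : Affine.Triangle ℝ Plane) : MvPolynomial (Fin 2) ℝ →ₗ[ℝ] ℝ where
  toFun P := ∫ z in tri T, polyFun P z
  map_add' P Q := by
    simp only [polyFun_add]
    exact integral_add (Continuous.integrableOn_tri (continuous_polyFun P) T)
      (Continuous.integrableOn_tri (continuous_polyFun Q) T)
  map_smul' c P := by simp [integral_const_mul]

lemma triInt_apply (T : Affine.Triangle ℝ Plane) (P : MvPolynomial (Fin 2) ℝ) :
    triInt T P = ∫ z in tri T, polyFun P z := rfl

/-- The mean value of a polynomial on the segment from `a` to `b`, as a linear form. -/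
def edgeInt (a b : Plane) : MvPolynomial (Fin 2) ℝ →ₗ[ℝ] ℝ where
  toFun P := ∫ s in (0 : ℝ)..1, polyFun P (AffineMap.lineMap a b s)
  map_add' P Q := by
    simp only [polyFun_add]
    have h : ∀ R, Continuous fun s : ℝ => polyFun R (AffineMap.lineMap a b s) := fun R =>
      (continuous_polyFun R).comp AffineMap.lineMap_continuous
    exact intervalIntegral.integral_add ((h P).intervalIntegrable _ _)
      ((h Q).intervalIntegrable _ _)
  map_smul' c P := by simp

lemma edgeInt_apply (a b : Plane) (P : MvPolynomial (Fin 2) ℝ) :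
    edgeInt a b P = ∫ s in (0 : ℝ)..1, polyFun P (AffineMap.lineMap a b s) := rfl

lemma edgeInt_symm (a b : Plane) (P : MvPolynomial (Fin 2) ℝ) : edgeInt a b P = edgeInt b a P := by
  rw [edgeInt_apply, edgeInt_apply]
  have := intervalIntegral.integral_comp_sub_left (a := 0) (b := 1)
    (fun s : ℝ => polyFun P (AffineMap.lineMap a b s)) 1
  simp only [sub_self, sub_zero, AffineMap.lineMap_apply_one_sub] at this
  exact this.symm

lemma setIntegral_refTri {G : ℝ × ℝ → ℝ} (hG : Continuous G) :
    ∫ q in refTri, G q = ∫ t in (0 : ℝ)..1, ∫ s in (0 : ℝ)..(1 - t), G (s, t) := by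
  have hm : MeasurableSet refTri := by
    refine IsOpen.measurableSet ?_
    exact (isOpen_lt continuous_const continuous_fst).inter
      ((isOpen_lt continuous_const continuous_snd).inter
        (isOpen_lt (continuous_fst.add continuous_snd) continuous_const))
  have hsub : refTri ⊆ Set.Icc (0 : ℝ) 1 ×ˢ Set.Icc (0 : ℝ) 1 := by
    rintro ⟨s, t⟩ ⟨h1, h2, h3⟩
    simp only at h1 h2 h3
    exact ⟨⟨h1.le, by simp; linarith⟩, ⟨h2.le, by simp; linarith⟩⟩
  have hint : IntegrableOn G refTri :=
    (hG.continuousOn.integrableOn_compact (isCompact_Icc.prod isCompact_Icc)).mono_set hsub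
  rw [← integral_indicator hm, Measure.volume_eq_prod, integral_prod_symm]
  swap
  · rw [← Measure.volume_eq_prod]; exact hint.integrable_indicator hm
  rw [intervalIntegral.integral_of_le zero_le_one, ← integral_Ioc_eq_integral_Ioo.symm,
    ← integral_indicator measurableSet_Ioo]
  congr 1
  funext t
  by_cases ht : t ∈ Set.Ioo (0 : ℝ) 1
  · rw [Set.indicator_of_mem ht, intervalIntegral.integral_of_le (by linarith [ht.2]),
      integral_Ioc_eq_integral_Ioo, ← integral_indicator measurableSet_Ioo]
    congr 1
    funext s
    by_cases hs : s ∈ Set.Ioo 0 (1 - t)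
    · rw [Set.indicator_of_mem hs, Set.indicator_of_mem]
      exact ⟨hs.1, ht.1, by have := hs.2; simp only; linarith⟩
    · rw [Set.indicator_of_notMem hs, Set.indicator_of_notMem]
      rintro ⟨h1, h2, h3⟩
      simp only at h1 h2 h3
      exact hs ⟨h1, by linarith⟩
  · rw [Set.indicator_of_notMem ht]
    have : ∀ s, refTri.indicator G (s, t) = 0 := fun s => by
      rw [Set.indicator_of_notMem]
      rintro ⟨h1, h2, h3⟩
      simp only at h1 h2 h3
      exact ht ⟨h2, by linarith⟩
    simp [this]

lemma triInt_eq_param (T : Affine.Triangle ℝ Plane) (i : Fin 3) (P : MvPolynomial (Fin 2) ℝ) :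
    triInt T P = |cr (T.points i) (T.points (i + 1)) (T.points (i + 2))| *
      ∫ q in refTri, polyFun P (param (T.points i) (T.points (i + 1)) (T.points (i + 2)) q) := by
  rw [triInt_apply, tri_eq_openTri T i, openTri_eq_image (cr_points_ne_zero T i),
    setIntegral_param (cr_points_ne_zero T i)]

/-- Integration of the derivative along the edge from `P_i` to `P_{i+1}`. -/
lemma triInt_directional (T : Affine.Triangle ℝ Plane) (i : Fin 3) (P : MvPolynomial (Fin 2) ℝ) :
    (T.points (i + 1) 0 - T.points i 0) * triInt T (pderiv 0 P) +
      (T.points (i + 1) 1 - T.points i 1) * triInt T (pderiv 1 P) =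
    |cr (T.points i) (T.points (i + 1)) (T.points (i + 2))| *
      (edgeInt (T.points (i + 1)) (T.points (i + 2)) P -
        edgeInt (T.points (i + 2)) (T.points i) P) := by
  rw [← smul_eq_mul, ← (triInt T).map_smul, ← smul_eq_mul (T.points (i + 1) 1 - T.points i 1),
    ← (triInt T).map_smul, ← (triInt T).map_add, triInt_eq_param T i, edgeInt_symm (T.points (i + 2))]
  congr 1
  set a := T.points i
  set b := T.points (i + 1)
  set c := T.points (i + 2)
  rw [setIntegral_refTri (G := fun q => polyFun ((b 0 - a 0) • pderiv 0 P +
    (b 1 - a 1) • pderiv 1 P) (param a b c q))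
    ((continuous_polyFun _).comp (continuous_param a b c)), edgeInt_apply, edgeInt_apply, ← intervalIntegral.integral_sub]
  rotate_left
  · exact ((continuous_polyFun _).comp AffineMap.lineMap_continuous).intervalIntegrable _ _
  · exact ((continuous_polyFun _).comp AffineMap.lineMap_continuous).intervalIntegrable _ _
  refine intervalIntegral.integral_congr fun t _ => ?_
  have hd : ∀ s ∈ Set.uIcc 0 (1 - t), HasDerivAt (fun s : ℝ => polyFun P (param a b c (s, t)))
      (polyFun ((b 0 - a 0) • pderiv 0 P + (b 1 - a 1) • pderiv 1 P) (param a b c (s, t))) s := by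
    intro s _
    have h1 : HasDerivAt (fun s : ℝ => param a b c (s, t)) (b - a) s := by
      have := (((hasDerivAt_id s).smul_const (b - a)).const_add a).add_const (t • (c - a))
      rw [one_smul] at this
      exact this
    have h2 := HasFDerivAt.comp_hasDerivAt (f := fun s : ℝ => param a b c (s, t)) s
      (hasFDerivAt_polyFun P (param a b c (s, t))) h1
    convert! h2 using 1
    simp; ring
  have hi := intervalIntegral.integral_eq_sub_of_hasDerivAt hd
    (Continuous.intervalIntegrable (by
      exact (continuous_polyFun _).comp ((continuous_param a b c).comp (by fun_prop))) _ _)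
  simp only
  rw [hi]
  -- The upper limit `s = 1 - t` runs along the edge from `b` to `c`, the lower limit `s = 0` along
  -- the one from `a` to `c`.
  congr 2
  · refine plane_ext ?_ ?_ <;> simp [AffineMap.lineMap_apply] <;> ring
  · refine plane_ext ?_ ?_ <;> simp [AffineMap.lineMap_apply] <;> ring

/-- The outward normal to the edge of a triangle from `P_i` to `P_{i+1}`. -/
def nrm (T : Affine.Triangle ℝ Plane) (i : Fin 3) : Plane :=
  edgeNormal (T.points i) (T.points (i + 1)) (T.points (i + 2))

/-- The length of the edge of a triangle from `P_i` to `P_{i+1}`. -/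
def len (T : Affine.Triangle ℝ Plane) (i : Fin 3) : ℝ := dist (T.points i) (T.points (i + 1))

/-- The mean value over the edge of a triangle from `P_i` to `P_{i+1}`. -/
def edg (T : Affine.Triangle ℝ Plane) (i : Fin 3) : MvPolynomial (Fin 2) ℝ →ₗ[ℝ] ℝ :=
  edgeInt (T.points i) (T.points (i + 1))

lemma len_pos (T : Affine.Triangle ℝ Plane) (i : Fin 3) : 0 < len T i :=
  dist_pos_of_cr_ne_zero (cr_points_ne_zero T i)

lemma len_mul_nrm_zero (T : Affine.Triangle ℝ Plane) (i : Fin 3) : len T i * nrm T i 0 =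
    SignType.sign (cr (T.points 0) (T.points 1) (T.points 2)) *
      (T.points (i + 1) 1 - T.points i 1) := by
  have hl := (len_pos T i).ne'
  have : cr (T.points i) (T.points (i + 1)) (T.points (i + 2)) =
      cr (T.points 0) (T.points 1) (T.points 2) := by
    fin_cases i
    · rfl
    · exact cr_rotate _ _ _
    · exact (cr_rotate _ _ _).trans (cr_rotate _ _ _)
  simp only [nrm, edgeNormal, this]
  unfold len at hl ⊢
  simp; field_simp

lemma len_mul_nrm_one (T : Affine.Triangle ℝ Plane) (i : Fin 3) : len T i * nrm T i 1 =
    -(SignType.sign (cr (T.points 0) (T.points 1) (T.points 2)) *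
      (T.points (i + 1) 0 - T.points i 0)) := by
  have hl := (len_pos T i).ne'
  have : cr (T.points i) (T.points (i + 1)) (T.points (i + 2)) =
      cr (T.points 0) (T.points 1) (T.points 2) := by
    fin_cases i
    · rfl
    · exact cr_rotate _ _ _
    · exact (cr_rotate _ _ _).trans (cr_rotate _ _ _)
  simp only [nrm, edgeNormal, this]
  unfold len at hl ⊢
  simp; field_simp

/-- The divergence theorem on a triangle. -/
lemma triInt_pderiv (T : Affine.Triangle ℝ Plane) (P : MvPolynomial (Fin 2) ℝ) :
    triInt T (pderiv 0 P) = ∑ i : Fin 3, len T i * nrm T i 0 * edg T i P ∧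
    triInt T (pderiv 1 P) = ∑ i : Fin 3, len T i * nrm T i 1 * edg T i P := by
  have h0 := triInt_directional T 0 P
  have h1 := triInt_directional T 1 P
  have h : cr (T.points 0) (T.points 1) (T.points 2) ≠ 0 := cr_points_ne_zero T 0
  simp only [len_mul_nrm_zero, len_mul_nrm_one, Fin.sum_univ_three, edg]
  simp only [show (0 : Fin 3) + 1 = 1 from rfl, show (0 : Fin 3) + 2 = 2 from rfl,
    show (1 : Fin 3) + 1 = 2 from rfl, show (1 : Fin 3) + 2 = 0 from rfl,
    show (2 : Fin 3) + 1 = 0 from rfl] at h0 h1 ⊢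
  rw [cr_rotate] at h1
  set D := cr (T.points 0) (T.points 1) (T.points 2) with hD
  have habs : |D| = SignType.sign D * D := (sign_mul_self D).symm
  rw [habs] at h0 h1
  have hD' : D = (T.points 1 0 - T.points 0 0) * (T.points 2 1 - T.points 1 1) -
      (T.points 1 1 - T.points 0 1) * (T.points 2 0 - T.points 1 0) := by
    rw [hD]; simp only [cr]; ring
  constructor
  · refine mul_left_cancel₀ h ?_
    linear_combination (T.points 2 1 - T.points 1 1) * h0 - (T.points 1 1 - T.points 0 1) * h1 +
      triInt T (pderiv 0 P) * hD'
  · refine mul_left_cancel₀ h ?_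
    linear_combination (T.points 1 0 - T.points 0 0) * h1 - (T.points 2 0 - T.points 1 0) * h0 +
      triInt T (pderiv 1 P) * hD'

lemma isOutwardNormal_nrm (T : Affine.Triangle ℝ Plane) (i : Fin 3) {s : ℝ}
    (hs : s ∈ Set.Ioo (0 : ℝ) 1) :
    IsOutwardNormal (tri T) (AffineMap.lineMap (T.points i) (T.points (i + 1)) s) (nrm T i) := by
  rw [tri_eq_openTri T i]
  exact isOutwardNormal_edgeNormal (cr_points_ne_zero T i) hs

lemma triInt_nonneg (T : Affine.Triangle ℝ Plane) {P : MvPolynomial (Fin 2) ℝ}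
    (h : ∀ z, 0 ≤ polyFun P z) : 0 ≤ triInt T P :=
  integral_nonneg h

lemma edg_mono_of_Ioo (T : Affine.Triangle ℝ Plane) (i : Fin 3) {P Q : MvPolynomial (Fin 2) ℝ}
    (h : ∀ s ∈ Set.Ioo (0 : ℝ) 1, polyFun P (AffineMap.lineMap (T.points i) (T.points (i + 1)) s) ≤
      polyFun Q (AffineMap.lineMap (T.points i) (T.points (i + 1)) s)) :
    edg T i P ≤ edg T i Q := by
  rw [edg, edgeInt_apply, edgeInt_apply]
  have hc : ∀ R, Continuous fun s : ℝ => polyFun R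
      (AffineMap.lineMap (T.points i) (T.points (i + 1)) s) := fun R =>
    (continuous_polyFun R).comp AffineMap.lineMap_continuous
  exact intervalIntegral.integral_mono_on_of_le_Ioo zero_le_one ((hc P).intervalIntegrable _ _)
    ((hc Q).intervalIntegrable _ _) h

lemma bdryNormSq_polyFun (T : Affine.Triangle ℝ Plane) (P : MvPolynomial (Fin 2) ℝ) :
    bdryNormSq T (polyFun P) = ∑ i : Fin 3, len T i * edg T i (P ^ 2) := by
  simp only [bdryNormSq, len, edg, edgeInt_apply, pow_two, polyFun_mul]

end

section
open MvPolynomial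

/-! ### Inverse inequalities on shape regular triangles -/

lemma closure_tri (T : Affine.Triangle ℝ Plane) :
    closure (tri T) = convexHull ℝ (Set.range T.points) := by
  have hne : (tri T).Nonempty := by
    refine ⟨param (T.points 0) (T.points 1) (T.points 2) (1 / 3, 1 / 3), ?_⟩
    rw [tri_eq_openTri T 0]
    refine (param_mem_openTri_iff (cr_points_ne_zero T 0) _).2 ?_
    norm_num [refTri]
  rw [tri, (convex_convexHull ℝ _).closure_interior_eq_closure_of_nonempty_interior hne,
    (isCompact_hull_points T).isClosed.closure_eq]

lemma hull_points_eq (T : Affine.Triangle ℝ Plane) (i : Fin 3) :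
    convexHull ℝ (Set.range T.points) =
      convexHull ℝ {T.points i, T.points (i + 1), T.points (i + 2)} := by
  rw [range_points T i]

lemma points_mem_closure_tri (T : Affine.Triangle ℝ Plane) (i : Fin 3) :
    T.points i ∈ closure (tri T) := by
  rw [closure_tri]; exact subset_convexHull ℝ _ ⟨i, rfl⟩

lemma dist_points_le_hT (T : Affine.Triangle ℝ Plane) (i j : Fin 3) :
    dist (T.points i) (T.points j) ≤ hT T := by
  rw [hT, ← Metric.diam_closure]
  refine Metric.dist_le_diam_of_mem ?_ (points_mem_closure_tri T i) (points_mem_closure_tri T j)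
  rw [closure_tri]; exact (isCompact_hull_points T).isBounded

lemma hT_pos (T : Affine.Triangle ℝ Plane) : 0 < hT T :=
  (len_pos T 0).trans_le (dist_points_le_hT T 0 1)

lemma triInt_one (T : Affine.Triangle ℝ Plane) (i : Fin 3) :
    triInt T 1 = |cr (T.points i) (T.points (i + 1)) (T.points (i + 2))| / 2 := by
  rw [triInt_eq_param T i, setIntegral_refTri (G := fun q => polyFun 1 _) (by
    simp only [polyFun_one]; exact continuous_const)]
  simp only [polyFun_one, intervalIntegral.integral_const, smul_eq_mul, mul_one, sub_zero]
  rw [intervalIntegral.integral_sub (by simp) (by simp)]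
  simp
  ring

/-- Compare areas: the inscribed disc has area at least `3 σ² h²`, as `π > 3`, and the triangle has
area `|cr| / 2`. -/
lemma le_abs_cr_of_shapeRegular {σ : ℝ} (hσ : 0 < σ) {T : Affine.Triangle ℝ Plane}
    (hT' : ShapeRegular σ T) (i : Fin 3) :
    6 * σ ^ 2 * hT T ^ 2 ≤ |cr (T.points i) (T.points (i + 1)) (T.points (i + 2))| := by
  obtain ⟨c, hc⟩ := hT'
  have h1 := triInt_one T i
  have h2 : triInt T 1 = volume.real (tri T) := by
    rw [triInt_apply]; simp [polyFun_one]
  have h3 : volume.real (Metric.ball c (σ * hT T)) ≤ volume.real (tri T) :=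
    measureReal_mono hc ((isBounded_tri T).measure_lt_top.ne)
  have h4 : volume.real (Metric.ball c (σ * hT T)) = (σ * hT T) ^ 2 * Real.pi := by
    rw [measureReal_def, EuclideanSpace.volume_ball_fin_two]
    have := (mul_pos hσ (hT_pos T)).le
    simp [ENNReal.toReal_ofReal this, Real.pi_pos.le]
  have := Real.pi_gt_three
  have h5 : 0 ≤ (σ * hT T) ^ 2 := by positivity
  nlinarith

lemma sq_le_integral_line {p : ℕ} {P : MvPolynomial (Fin 2) ℝ} (hP : P.totalDegree ≤ p)
    (a b : Plane) : polyFun P a ^ 2 ≤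
      ((p : ℝ) + 1) ^ 2 * ∫ r in (0 : ℝ)..1, polyFun P (a + r • b) ^ 2 := by
  obtain ⟨g, hg, hev, -⟩ := exists_polynomial_line P hP a b
  have := eval_zero_sq_le hg
  rw [unitIntegral_apply, hev] at this
  simp only [Polynomial.eval_mul, hev] at this
  simpa [pow_two] using this

lemma integral_line_deriv_le {p : ℕ} {P : MvPolynomial (Fin 2) ℝ} (hP : P.totalDegree ≤ p)
    (a b : Plane) : ∫ r in (0 : ℝ)..1, (fderiv ℝ (polyFun P) (a + r • b) b) ^ 2 ≤
      4 * (p : ℝ) ^ 2 * (p + 1) ^ 2 * ∫ r in (0 : ℝ)..1, polyFun P (a + r • b) ^ 2 := by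
  obtain ⟨g, hg, hev, hder⟩ := exists_polynomial_line P hP a b
  have := unitIntegral_derivative_sq_le p hg
  rw [unitIntegral_apply, unitIntegral_apply] at this
  simp only [Polynomial.eval_mul, hev, hder] at this
  simpa [pow_two] using this

/-- The integral of a polynomial over the unit square, transported to a parallelogram. -/
def quad (a b c : Plane) : MvPolynomial (Fin 2) ℝ →ₗ[ℝ] ℝ where
  toFun P := ∫ q in Set.Ioc (0 : ℝ) 1 ×ˢ Set.Ioc (0 : ℝ) 1, polyFun P (param a b c q)
  map_add' P Q := by
    simp only [polyFun_add]
    have h : ∀ R, IntegrableOn (fun q => polyFun R (param a b c q))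
        (Set.Ioc (0 : ℝ) 1 ×ˢ Set.Ioc (0 : ℝ) 1) := fun R =>
      (((continuous_polyFun R).comp (continuous_param a b c)).continuousOn.integrableOn_compact
        (isCompact_Icc.prod isCompact_Icc)).mono_set
        (Set.prod_mono Set.Ioc_subset_Icc_self Set.Ioc_subset_Icc_self)
    exact integral_add (h P) (h Q)
  map_smul' c P := by simp [integral_const_mul]

lemma quad_apply (a b c : Plane) (P : MvPolynomial (Fin 2) ℝ) : quad a b c P =
    ∫ q in Set.Ioc (0 : ℝ) 1 ×ˢ Set.Ioc (0 : ℝ) 1, polyFun P (param a b c q) := rfl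

lemma quad_swap (a b c : Plane) (P : MvPolynomial (Fin 2) ℝ) : quad a c b P = quad a b c P := by
  rw [quad_apply, quad_apply]
  have := setIntegral_prod_swap (μ := (volume : Measure ℝ)) (ν := (volume : Measure ℝ))
    (Set.Ioc (0 : ℝ) 1) (Set.Ioc (0 : ℝ) 1) (fun q => polyFun P (param a b c q))
  rw [← Measure.volume_eq_prod] at this
  rw [← this]
  congr 1
  funext q
  congr 1
  simp only [param, Prod.fst_swap, Prod.snd_swap]
  abel

lemma quad_eq_integral (a b c : Plane) (P : MvPolynomial (Fin 2) ℝ) : quad a b c P =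
    ∫ s in (0 : ℝ)..1, ∫ t in (0 : ℝ)..1, polyFun P (a + s • (b - a) + t • (c - a)) := by
  rw [quad_apply, Measure.volume_eq_prod, setIntegral_prod]
  · rw [intervalIntegral.integral_of_le zero_le_one]
    simp only [intervalIntegral.integral_of_le zero_le_one]; rfl
  · rw [← Measure.volume_eq_prod]
    exact (((continuous_polyFun P).comp (continuous_param a b c)).continuousOn.integrableOn_compact
        (isCompact_Icc.prod isCompact_Icc)).mono_set
        (Set.prod_mono Set.Ioc_subset_Icc_self Set.Ioc_subset_Icc_self)

lemma continuous_inner_integral (a b c : Plane) (P : MvPolynomial (Fin 2) ℝ) :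
    Continuous fun s : ℝ => ∫ t in (0 : ℝ)..1, polyFun P (a + s • (b - a) + t • (c - a)) := by
  refine intervalIntegral.continuous_parametric_intervalIntegral_of_continuous' ?_ 0 1
  exact (continuous_polyFun P).comp (by fun_prop)

/-- The half of an edge at `a` is controlled by the parallelogram at `a`. -/
lemma integral_edge_le_quad {p : ℕ} {P : MvPolynomial (Fin 2) ℝ} (hP : P.totalDegree ≤ p)
    (a b c : Plane) : ∫ s in (0 : ℝ)..1, polyFun (P ^ 2) (a + s • (b - a)) ≤
      ((p : ℝ) + 1) ^ 2 * quad a b c (P ^ 2) := by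
  rw [quad_eq_integral, ← intervalIntegral.integral_const_mul]
  refine intervalIntegral.integral_mono_on zero_le_one ?_ ?_ fun s _ => ?_
  · exact ((continuous_polyFun _).comp (by fun_prop)).intervalIntegrable _ _
  · exact (continuous_const.mul (continuous_inner_integral a b c _)).intervalIntegrable _ _
  · have := sq_le_integral_line hP (a + s • (b - a)) (c - a)
    simpa [pow_two] using this

lemma quad_deriv_le {p : ℕ} {P : MvPolynomial (Fin 2) ℝ} (hP : P.totalDegree ≤ p)
    (a b c : Plane) :
    quad a b c (((c 0 - a 0) • pderiv 0 P + (c 1 - a 1) • pderiv 1 P) ^ 2) ≤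
      4 * (p : ℝ) ^ 2 * (p + 1) ^ 2 * quad a b c (P ^ 2) := by
  rw [quad_eq_integral, quad_eq_integral, ← intervalIntegral.integral_const_mul]
  refine intervalIntegral.integral_mono_on zero_le_one ?_ ?_ fun s _ => ?_
  · exact (continuous_inner_integral a b c _).intervalIntegrable _ _
  · exact (continuous_const.mul (continuous_inner_integral a b c _)).intervalIntegrable _ _
  · have := integral_line_deriv_le hP (a + s • (b - a)) (c - a)
    simp only [fderiv_polyFun] at this
    convert! this using 1
    · refine intervalIntegral.integral_congr fun t _ => ?_
      simp [pow_two]; ring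
    · simp [pow_two]

lemma quad_nonneg (a b c : Plane) {P : MvPolynomial (Fin 2) ℝ} (h : ∀ z, 0 ≤ polyFun P z) :
    0 ≤ quad a b c P := integral_nonneg fun _ => h _

/-- Cramer's rule bounds `cr² |∇P|²` by `2 h²` times the sum of the squared derivatives along the
two sides, and the Markov inequality on lines bounds each of these. -/
lemma quad_gradient_le {p : ℕ} {P : MvPolynomial (Fin 2) ℝ} (hP : P.totalDegree ≤ p)
    {a b c : Plane} {h : ℝ} (hb : dist a b ≤ h) (hc : dist a c ≤ h) :
    cr a b c ^ 2 * quad a b c (pderiv 0 P ^ 2 + pderiv 1 P ^ 2) ≤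
      16 * h ^ 2 * (p : ℝ) ^ 2 * (p + 1) ^ 2 * quad a b c (P ^ 2) := by
  set U := (b 0 - a 0) • pderiv 0 P + (b 1 - a 1) • pderiv 1 P with hU
  set V := (c 0 - a 0) • pderiv 0 P + (c 1 - a 1) • pderiv 1 P with hV
  have h1 := quad_deriv_le hP a b c
  have h2 := quad_deriv_le hP a c b
  rw [quad_swap, quad_swap a b c, ← hU] at h2
  rw [← hV] at h1
  have hb2 := dist_sq_eq a b
  have hc2 := dist_sq_eq a c
  have hbh : dist a b ^ 2 ≤ h ^ 2 := by gcongr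
  have hch : dist a c ^ 2 ≤ h ^ 2 := by gcongr
  have key : 0 ≤ quad a b c ((2 * h ^ 2) • (U ^ 2 + V ^ 2) -
      (cr a b c ^ 2) • (pderiv 0 P ^ 2 + pderiv 1 P ^ 2)) := by
    refine quad_nonneg _ _ _ fun z => ?_
    simp only [polyFun_sub, polyFun_add, polyFun_smul, pow_two, polyFun_mul, hU, hV]
    set x := polyFun (pderiv 0 P) z
    set y := polyFun (pderiv 1 P) z
    set u := (b 0 - a 0) * x + (b 1 - a 1) * y with hu
    set v := (c 0 - a 0) * x + (c 1 - a 1) * y with hv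
    have e1 : cr a b c * x = (c 1 - a 1) * u - (b 1 - a 1) * v := by
      rw [hu, hv]; simp only [cr]; ring
    have e2 : cr a b c * y = (b 0 - a 0) * v - (c 0 - a 0) * u := by
      rw [hu, hv]; simp only [cr]; ring
    have e3 : cr a b c * cr a b c * (x * x + y * y) =
        ((c 1 - a 1) * u - (b 1 - a 1) * v) ^ 2 + ((b 0 - a 0) * v - (c 0 - a 0) * u) ^ 2 := by
      rw [← e1, ← e2]; ring
    rw [e3]
    have aux : ∀ A B : ℝ, (A - B) ^ 2 ≤ 2 * (A ^ 2 + B ^ 2) := fun A B => by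
      nlinarith [sq_nonneg (A + B)]
    have i1 := aux ((c 1 - a 1) * u) ((b 1 - a 1) * v)
    have i2 := aux ((b 0 - a 0) * v) ((c 0 - a 0) * u)
    have i3 := mul_le_mul_of_nonneg_right (hc2 ▸ hch) (sq_nonneg u)
    have i4 := mul_le_mul_of_nonneg_right (hb2 ▸ hbh) (sq_nonneg v)
    linarith
  rw [map_sub, map_smul, map_smul, map_add, smul_eq_mul, smul_eq_mul] at key
  have hh : 0 ≤ 2 * h ^ 2 := by positivity
  nlinarith [mul_le_mul_of_nonneg_left h1 hh, mul_le_mul_of_nonneg_left h2 hh]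

/-- The parallelogram spanned at the vertex `P_i` by the two adjacent half edges. -/
def vquad (T : Affine.Triangle ℝ Plane) (i : Fin 3) : MvPolynomial (Fin 2) ℝ →ₗ[ℝ] ℝ :=
  quad (T.points i) (midpoint ℝ (T.points i) (T.points (i + 1)))
    (midpoint ℝ (T.points i) (T.points (i + 2)))

lemma midpoint_apply_plane (a b : Plane) (i : Fin 2) : midpoint ℝ a b i = (a i + b i) / 2 := by
  rw [midpoint_eq_smul_add]; simp; ring

lemma cr_midpoint (a b c : Plane) :
    cr a (midpoint ℝ a b) (midpoint ℝ a c) = cr a b c / 4 := by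
  simp only [cr, midpoint_apply_plane]; ring

lemma param_midpoint (a b c : Plane) (q : ℝ × ℝ) :
    param a (midpoint ℝ a b) (midpoint ℝ a c) q = param a b c (q.1 / 2, q.2 / 2) := by
  refine plane_ext ?_ ?_ <;> simp [midpoint_apply_plane] <;> ring

lemma setIntegral_vquad (T : Affine.Triangle ℝ Plane) (i : Fin 3) (P : MvPolynomial (Fin 2) ℝ) :
    ∫ z in param (T.points i) (midpoint ℝ (T.points i) (T.points (i + 1)))
      (midpoint ℝ (T.points i) (T.points (i + 2))) '' (Set.Ioc (0 : ℝ) 1 ×ˢ Set.Ioc (0 : ℝ) 1),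
        polyFun P z =
    |cr (T.points i) (T.points (i + 1)) (T.points (i + 2))| / 4 * vquad T i P := by
  have h := cr_points_ne_zero T i
  rw [setIntegral_param, cr_midpoint, abs_div, abs_of_pos (four_pos (α := ℝ))]
  · rfl
  · rw [cr_midpoint]; exact div_ne_zero h four_ne_zero

/-- Barycentric coordinates place the parallelogram in the closed triangle, whose boundary is null;
its Jacobian is `|cr| / 4`. -/
lemma vquad_le_triInt (T : Affine.Triangle ℝ Plane) (i : Fin 3) {P : MvPolynomial (Fin 2) ℝ}
    (hP : ∀ z, 0 ≤ polyFun P z) :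
    |cr (T.points i) (T.points (i + 1)) (T.points (i + 2))| / 4 * vquad T i P ≤ triInt T P := by
  rw [← setIntegral_vquad, triInt_apply]
  have hcl : ∫ z in tri T, polyFun P z = ∫ z in closure (tri T), polyFun P z := by
    refine setIntegral_congr_set ?_
    have hnull : volume (frontier (tri T)) = 0 := by
      have : Convex ℝ (tri T) := (convex_convexHull ℝ _).interior
      exact this.addHaar_frontier volume
    refine (ae_eq_set.2 ⟨?_, ?_⟩)
    · rw [Set.sdiff_eq_empty.2 subset_closure]; exact measure_empty
    · rwa [← (isOpen_tri T).frontier_eq]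
  rw [hcl]
  refine setIntegral_mono_set ?_ (Eventually.of_forall hP) (Eventually.of_forall ?_)
  · rw [closure_tri]
    exact (continuous_polyFun P).continuousOn.integrableOn_compact (isCompact_hull_points T)
  · rintro _ ⟨⟨s, t⟩, ⟨⟨hs0, hs1⟩, ⟨ht0, ht1⟩⟩, rfl⟩
    simp only at hs0 hs1 ht0 ht1
    rw [param_midpoint]
    show _ ∈ closure (tri T)
    have h := cr_points_ne_zero T i
    rw [closure_tri, hull_points_eq T i, mem_convexHull_iff_cr h, cr_param_left, cr_param_mid, cr_param_right]
    simp only [mul_div_cancel_right₀ _ h]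
    refine ⟨by linarith, by positivity, by positivity⟩

/-- The three parallelograms cover the triangle; their overlaps are harmless for a non-negative
integrand. -/
lemma triInt_le_sum_vquad (T : Affine.Triangle ℝ Plane) {P : MvPolynomial (Fin 2) ℝ}
    (hP : ∀ z, 0 ≤ polyFun P z) : triInt T P ≤ ∑ i : Fin 3,
      |cr (T.points i) (T.points (i + 1)) (T.points (i + 2))| / 4 * vquad T i P := by
  set S : Fin 3 → Set Plane := fun i =>
    param (T.points i) (midpoint ℝ (T.points i) (T.points (i + 1)))
      (midpoint ℝ (T.points i) (T.points (i + 2))) '' (Set.Ioc (0 : ℝ) 1 ×ˢ Set.Ioc (0 : ℝ) 1)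
    with hS
  have hm : ∀ i, cr (T.points i) (midpoint ℝ (T.points i) (T.points (i + 1)))
      (midpoint ℝ (T.points i) (T.points (i + 2))) ≠ 0 := fun i => by
    rw [cr_midpoint]; exact div_ne_zero (cr_points_ne_zero T i) four_ne_zero
  have hmeas : ∀ i, MeasurableSet (S i) := fun i =>
    (map_param (hm i)).1.measurableSet_image' (measurableSet_Ioc.prod measurableSet_Ioc)
  have hint : ∀ i, IntegrableOn (polyFun P) (S i) := fun i =>
    ((continuous_polyFun P).continuousOn.integrableOn_compact
      ((isCompact_Icc.prod isCompact_Icc).image (continuous_param _ _ _))).mono_set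
      (Set.image_mono (Set.prod_mono Set.Ioc_subset_Icc_self Set.Ioc_subset_Icc_self))
  have hcover : ∀ z ∈ tri T, ∃ i, z ∈ S i := by
    intro z hz
    have hsel : ∀ i : Fin 3, cr (T.points i) z (T.points (i + 2)) /
        cr (T.points i) (T.points (i + 1)) (T.points (i + 2)) ≤ 1 / 2 →
        cr (T.points i) (T.points (i + 1)) z /
        cr (T.points i) (T.points (i + 1)) (T.points (i + 2)) ≤ 1 / 2 → z ∈ S i := by
      intro i h1 h2
      have h := cr_points_ne_zero T i
      obtain ⟨-, p1, p2⟩ := (mem_openTri_iff h z).1 (tri_eq_openTri T i ▸ hz)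
      refine ⟨(2 * (cr (T.points i) z (T.points (i + 2)) /
        cr (T.points i) (T.points (i + 1)) (T.points (i + 2))),
        2 * (cr (T.points i) (T.points (i + 1)) z /
        cr (T.points i) (T.points (i + 1)) (T.points (i + 2)))),
        ⟨⟨by positivity, by simp only; linarith⟩, ⟨by positivity, by simp only; linarith⟩⟩, ?_⟩
      rw [param_midpoint]
      simp only [mul_div_cancel_left₀ _ (two_ne_zero (α := ℝ))]
      exact exists_param_eq h z
    have h := cr_points_ne_zero T 0
    obtain ⟨p0, p1, p2⟩ := (mem_openTri_iff h z).1 (tri_eq_openTri T 0 ▸ hz)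
    have hs := cr_add_cr_add_cr (T.points 0) (T.points 1) (T.points 2) z
    have s0 := hsel 0
    have s1 := hsel 1
    have s2 := hsel 2
    simp only [show (0 : Fin 3) + 1 = 1 from rfl, show (0 : Fin 3) + 2 = 2 from rfl,
      show (1 : Fin 3) + 1 = 2 from rfl, show (1 : Fin 3) + 2 = 0 from rfl,
      show (2 : Fin 3) + 1 = 0 from rfl, show (2 : Fin 3) + 2 = 1 from rfl] at h p0 p1 p2 s0 s1 s2
    rw [cr_rotate (T.points 0) (T.points 1) (T.points 2)] at s1
    rw [← cr_rotate (T.points 2) (T.points 0) (T.points 1)] at s2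
    have r1 : cr (T.points 1) z (T.points 0) = cr (T.points 0) (T.points 1) z := cr_rotate _ _ _
    have r2 : cr (T.points 1) (T.points 2) z = cr z (T.points 1) (T.points 2) := cr_rotate _ _ _
    have r3 : cr (T.points 2) z (T.points 1) = cr z (T.points 1) (T.points 2) :=
      (cr_rotate _ _ _).symm
    have r4 : cr (T.points 2) (T.points 0) z = cr (T.points 0) z (T.points 2) :=
      (cr_rotate _ _ _).symm
    rw [r1, r2] at s1
    rw [r3, r4] at s2
    set D := cr (T.points 0) (T.points 1) (T.points 2)
    have hsum : cr z (T.points 1) (T.points 2) / D + cr (T.points 0) z (T.points 2) / D +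
        cr (T.points 0) (T.points 1) z / D = 1 := by
      rw [← add_div, ← add_div, hs, div_self h]
    -- A point lies in the parallelogram at a vertex if its other two coordinates are at most `1/2`.
    -- The coordinates are positive with sum one, so some vertex qualifies.
    by_cases g0 : cr (T.points 0) z (T.points 2) / D ≤ 1 / 2
    · by_cases g1 : cr (T.points 0) (T.points 1) z / D ≤ 1 / 2
      · exact ⟨0, s0 g0 g1⟩
      · refine ⟨2, s2 ?_ ?_⟩ <;> linarith
    · refine ⟨1, s1 ?_ ?_⟩ <;> linarith
  simp only [← setIntegral_vquad]
  rw [triInt_apply, ← integral_indicator (isOpen_tri T).measurableSet]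
  have : ∑ i : Fin 3, ∫ z in S i, polyFun P z = ∫ z, ∑ i : Fin 3, (S i).indicator (polyFun P) z := by
    rw [integral_finsetSum _ fun i _ => (hint i).integrable_indicator (hmeas i)]
    exact Finset.sum_congr rfl fun i _ => (integral_indicator (hmeas i)).symm
  rw [this]
  refine integral_mono ?_ ?_ fun z => ?_
  · exact (Continuous.integrableOn_tri (continuous_polyFun P) T).integrable_indicator
      (isOpen_tri T).measurableSet
  · exact integrable_finsetSum _ fun i _ => (hint i).integrable_indicator (hmeas i)
  · have hnn : ∀ i ∈ Finset.univ, 0 ≤ (S i).indicator (polyFun P) z := fun i _ =>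
      Set.indicator_nonneg (fun w _ => hP w) z
    by_cases hz : z ∈ tri T
    · obtain ⟨i, hi⟩ := hcover z hz
      rw [Set.indicator_of_mem hz]
      refine le_trans ?_ (Finset.single_le_sum hnn (Finset.mem_univ i))
      rw [Set.indicator_of_mem hi]
    · rw [Set.indicator_of_notMem hz]; exact Finset.sum_nonneg hnn

end

/-! ### The inverse inequalities with explicit constants -/

section
open MvPolynomial

lemma ip_polyFun (T : Affine.Triangle ℝ Plane) (P Q : MvPolynomial (Fin 2) ℝ) :
    ip (tri T) (polyFun P) (polyFun Q) = triInt T (P * Q) := by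
  simp only [ip, triInt_apply, polyFun_mul]

lemma polyFun_sq_nonneg (P : MvPolynomial (Fin 2) ℝ) (z : Plane) : 0 ≤ polyFun (P ^ 2) z := by
  simp only [pow_two, polyFun_mul]; exact mul_self_nonneg _

lemma triInt_sq_nonneg (T : Affine.Triangle ℝ Plane) (P : MvPolynomial (Fin 2) ℝ) :
    0 ≤ triInt T (P ^ 2) := triInt_nonneg T (polyFun_sq_nonneg P)

lemma Fin.add_one_add_one (i : Fin 3) : i + 1 + 1 = i + 2 := by revert i; decide

lemma Fin.add_one_add_two (i : Fin 3) : i + 1 + 2 = i := by revert i; decide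

/-- The edge is cut at its midpoint; each half is a side of the parallelogram at its own end, where
the one-variable endpoint bound applies on transversal lines. -/
lemma edg_sq_le {p : ℕ} {P : MvPolynomial (Fin 2) ℝ} (hP : P.totalDegree ≤ p)
    (T : Affine.Triangle ℝ Plane) (i : Fin 3) :
    edg T i (P ^ 2) ≤ ((p : ℝ) + 1) ^ 2 * ((vquad T i (P ^ 2) + vquad T (i + 1) (P ^ 2)) / 2) := by
  set a := T.points i with ha
  set b := T.points (i + 1) with hb
  set f : ℝ → ℝ := fun s => polyFun (P ^ 2) (AffineMap.lineMap a b s) with hf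
  have hfc : Continuous f := (continuous_polyFun _).comp AffineMap.lineMap_continuous
  have h1 := integral_edge_le_quad hP a (midpoint ℝ a b) (midpoint ℝ a (T.points (i + 2)))
  have h2 := integral_edge_le_quad hP b (midpoint ℝ b a) (midpoint ℝ b (T.points (i + 2)))
  rw [quad_swap] at h2
  have e1 : ∀ s : ℝ, a + s • (midpoint ℝ a b - a) = AffineMap.lineMap a b (s / 2) := by
    intro s
    refine plane_ext ?_ ?_ <;> simp [AffineMap.lineMap_apply] <;> ring
  have e2 : ∀ s : ℝ, b + s • (midpoint ℝ b a - b) = AffineMap.lineMap a b (1 - s / 2) := by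
    intro s
    refine plane_ext ?_ ?_ <;> simp [AffineMap.lineMap_apply] <;> ring
  have v2 : vquad T (i + 1) = quad b (midpoint ℝ b (T.points (i + 2))) (midpoint ℝ b a) := by
    rw [vquad, Fin.add_one_add_one, Fin.add_one_add_two]
  rw [v2]
  simp only [e1] at h1
  simp only [e2] at h2
  have i1 : ∫ s in (0 : ℝ)..1, f (s / 2) = 2 * ∫ s in (0 : ℝ)..(1 / 2), f s := by
    rw [intervalIntegral.integral_comp_div _ two_ne_zero]; simp
  have i2 : ∫ s in (0 : ℝ)..1, f (1 - s / 2) = 2 * ∫ s in (1 / 2 : ℝ)..1, f s := by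
    rw [intervalIntegral.integral_comp_sub_div _ two_ne_zero]; norm_num
  have i3 := intervalIntegral.integral_add_adjacent_intervals
    (hfc.intervalIntegrable (μ := volume) 0 (1 / 2)) (hfc.intervalIntegrable (1 / 2) 1)
  have : edg T i (P ^ 2) = ∫ s in (0 : ℝ)..1, f s := rfl
  rw [this, vquad]
  rw [i1] at h1
  rw [i2] at h2
  linarith

lemma vquad_le {σ : ℝ} (hσ : 0 < σ) {T : Affine.Triangle ℝ Plane} (hT' : ShapeRegular σ T)
    (i : Fin 3) (P : MvPolynomial (Fin 2) ℝ) :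
    6 * σ ^ 2 * hT T ^ 2 * vquad T i (P ^ 2) ≤ 4 * triInt T (P ^ 2) := by
  have h1 := vquad_le_triInt T i (polyFun_sq_nonneg P)
  have h2 := le_abs_cr_of_shapeRegular hσ hT' i
  have h3 : 0 ≤ vquad T i (P ^ 2) := quad_nonneg _ _ _ (polyFun_sq_nonneg P)
  nlinarith [mul_le_mul_of_nonneg_right h2 h3]

/-- Three edges of length at most `h`, the bound `(p + 1)² ≤ 4 p²` and the Jacobian bound `6 σ² h²`
give `3 · 4 · 4 / 6 = 8`. -/
lemma traceInverse_of_shapeRegular {σ : ℝ} (hσ : 0 < σ) {T : Affine.Triangle ℝ Plane}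
    (hT' : ShapeRegular σ T) {p : ℕ} (hp : 1 ≤ p) : TraceInverse (8 / σ ^ 2) p T := by
  intro P hP
  have hpos := hT_pos T
  have hp' : (1 : ℝ) ≤ p := by exact_mod_cast hp
  rw [bdryNormSq_polyFun, ip_polyFun, ← pow_two]
  have hI := triInt_sq_nonneg T P
  have hterm : ∀ i : Fin 3, len T i * edg T i (P ^ 2) ≤
      hT T * (((p : ℝ) + 1) ^ 2 * (4 * triInt T (P ^ 2) / (6 * σ ^ 2 * hT T ^ 2))) := by
    intro i
    have hq : ∀ j, vquad T j (P ^ 2) ≤ 4 * triInt T (P ^ 2) / (6 * σ ^ 2 * hT T ^ 2) := fun j => by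
      rw [le_div_iff₀ (by positivity)]; linarith [vquad_le hσ hT' j P]
    have he := edg_sq_le hP T i
    have h0 : 0 ≤ edg T i (P ^ 2) :=
      intervalIntegral.integral_nonneg zero_le_one fun s _ => polyFun_sq_nonneg P _
    refine mul_le_mul (dist_points_le_hT T _ _) (he.trans ?_) h0 hpos.le
    refine mul_le_mul_of_nonneg_left ?_ (by positivity)
    linarith [hq i, hq (i + 1)]
  refine (Finset.sum_le_sum fun i _ => hterm i).trans ?_
  rw [Finset.sum_const, Finset.card_univ, Fintype.card_fin, nsmul_eq_mul]
  have hpp : ((p : ℝ) + 1) ^ 2 ≤ 4 * (p : ℝ) ^ 2 := by nlinarith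
  calc ((3 : ℕ) : ℝ) * (hT T * (((p : ℝ) + 1) ^ 2 *
        (4 * triInt T (P ^ 2) / (6 * σ ^ 2 * hT T ^ 2))))
      ≤ ((3 : ℕ) : ℝ) * (hT T * ((4 * (p : ℝ) ^ 2) *
        (4 * triInt T (P ^ 2) / (6 * σ ^ 2 * hT T ^ 2)))) := by gcongr
    _ = 8 / σ ^ 2 * (p : ℝ) ^ 2 / hT T * triInt T (P ^ 2) := by field_simp; ring

lemma gradInverse_iff (C : ℝ) (hC : 0 ≤ C) (p : ℕ) (T : Affine.Triangle ℝ Plane) :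
    GradInverse C p T ↔ ∀ P : MvPolynomial (Fin 2) ℝ, P.totalDegree ≤ p →
      triInt T (pderiv 0 P ^ 2 + pderiv 1 P ^ 2) ≤
        (C * p ^ 2 / hT T) ^ 2 * triInt T (P ^ 2) := by
  have hpos := hT_pos T
  refine forall₂_congr fun P _ => ?_
  rw [dx_polyFun, dy_polyFun, ip_polyFun, ip_polyFun, ip_polyFun, ← map_add]
  simp only [← pow_two]
  have hC' : 0 ≤ C * p ^ 2 / hT T := by positivity
  rw [Real.sqrt_le_left (by positivity), mul_pow, Real.sq_sqrt (triInt_sq_nonneg T P)]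

/-- The sum over the three parallelograms gives the squared constant `(64/3) / σ⁴`, and `64/3 ≤ 5²`.
-/
lemma gradInverse_of_shapeRegular {σ : ℝ} (hσ : 0 < σ) {T : Affine.Triangle ℝ Plane}
    (hT' : ShapeRegular σ T) {p : ℕ} (hp : 1 ≤ p) : GradInverse (5 / σ ^ 2) p T := by
  rw [gradInverse_iff _ (by positivity)]
  intro P hP
  have hpos := hT_pos T
  have hp' : (1 : ℝ) ≤ p := by exact_mod_cast hp
  have hI := triInt_sq_nonneg T P
  have hG : ∀ z, 0 ≤ polyFun (pderiv 0 P ^ 2 + pderiv 1 P ^ 2) z := fun z => by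
    rw [polyFun_add]; exact add_nonneg (polyFun_sq_nonneg _ z) (polyFun_sq_nonneg _ z)
  have hterm : ∀ i : Fin 3, |cr (T.points i) (T.points (i + 1)) (T.points (i + 2))| / 4 *
      vquad T i (pderiv 0 P ^ 2 + pderiv 1 P ^ 2) ≤
      64 * (p : ℝ) ^ 2 * (p + 1) ^ 2 / (36 * σ ^ 4 * hT T ^ 2) * triInt T (P ^ 2) := by
    intro i
    have hmid : ∀ j, dist (T.points i) (midpoint ℝ (T.points i) (T.points j)) ≤ hT T / 2 := by
      intro j
      rw [dist_left_midpoint]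
      have := dist_points_le_hT T i j
      norm_num
      linarith
    have h1 := quad_gradient_le hP (hmid (i + 1)) (hmid (i + 2))
    rw [cr_midpoint] at h1
    have h2 := le_abs_cr_of_shapeRegular hσ hT' i
    have h3 := vquad_le_triInt T i (polyFun_sq_nonneg P)
    set D := |cr (T.points i) (T.points (i + 1)) (T.points (i + 2))| with hD
    have hDsq : (cr (T.points i) (T.points (i + 1)) (T.points (i + 2)) / 4) ^ 2 = D ^ 2 / 16 := by
      rw [hD, div_pow, sq_abs]; norm_num
    rw [hDsq] at h1
    change D ^ 2 / 16 * vquad T i (pderiv 0 P ^ 2 + pderiv 1 P ^ 2) ≤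
      _ * vquad T i (P ^ 2) at h1
    set G := vquad T i (pderiv 0 P ^ 2 + pderiv 1 P ^ 2)
    set V := vquad T i (P ^ 2)
    set I := triInt T (P ^ 2)
    set h := hT T
    have hDpos : 0 < D := lt_of_lt_of_le (by positivity) h2
    have hD2 : (6 * σ ^ 2 * h ^ 2) ^ 2 ≤ D ^ 2 := by gcongr
    have h4 : D ^ 2 * (D / 4 * G) ≤ 64 * h ^ 2 * (p : ℝ) ^ 2 * (p + 1) ^ 2 * I := by
      calc D ^ 2 * (D / 4 * G) = 4 * D * (D ^ 2 / 16 * G) := by ring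
        _ ≤ 4 * D * (16 * (h / 2) ^ 2 * (p : ℝ) ^ 2 * (p + 1) ^ 2 * V) := by gcongr
        _ = 64 * h ^ 2 * (p : ℝ) ^ 2 * (p + 1) ^ 2 * (D / 4 * V) := by ring
        _ ≤ _ := by gcongr
    have hGn : 0 ≤ D / 4 * G := by
      have : 0 ≤ G := quad_nonneg _ _ _ hG
      positivity
    have h5 : (6 * σ ^ 2 * h ^ 2) ^ 2 * (D / 4 * G) ≤
        64 * h ^ 2 * (p : ℝ) ^ 2 * (p + 1) ^ 2 * I :=
      (mul_le_mul_of_nonneg_right hD2 hGn).trans h4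
    have e : 64 * (p : ℝ) ^ 2 * (p + 1) ^ 2 / (36 * σ ^ 4 * h ^ 2) * I =
        64 * h ^ 2 * (p : ℝ) ^ 2 * (p + 1) ^ 2 * I / (6 * σ ^ 2 * h ^ 2) ^ 2 := by
      field_simp; ring
    rw [e, le_div_iff₀ (by positivity)]
    linarith
  refine (triInt_le_sum_vquad T hG).trans ((Finset.sum_le_sum fun i _ => hterm i).trans ?_)
  rw [Finset.sum_const, Finset.card_univ, Fintype.card_fin, nsmul_eq_mul]
  have hpp : ((p : ℝ) + 1) ^ 2 ≤ 4 * (p : ℝ) ^ 2 := by nlinarith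
  calc ((3 : ℕ) : ℝ) * (64 * (p : ℝ) ^ 2 * (p + 1) ^ 2 / (36 * σ ^ 4 * hT T ^ 2) *
        triInt T (P ^ 2))
      ≤ ((3 : ℕ) : ℝ) * (64 * (p : ℝ) ^ 2 * (4 * (p : ℝ) ^ 2) / (36 * σ ^ 4 * hT T ^ 2) *
        triInt T (P ^ 2)) := by gcongr
    _ = (64 / 3) / σ ^ 4 * (p : ℝ) ^ 4 / hT T ^ 2 * triInt T (P ^ 2) := by
        field_simp; ring
    _ ≤ 25 / σ ^ 4 * (p : ℝ) ^ 4 / hT T ^ 2 * triInt T (P ^ 2) := by gcongr; norm_num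
    _ = (5 / σ ^ 2 * (p : ℝ) ^ 2 / hT T) ^ 2 * triInt T (P ^ 2) := by field_simp; ring

/-- Trace-inverse and inverse inequalities with constants depending on the shape only. -/
lemma exists_inverse_constants {σ : ℝ} (hσ : 0 < σ) :
    ∃ Cinv > 0, ∃ CINV > 0, ∀ T : Affine.Triangle ℝ Plane, ShapeRegular σ T → ∀ p ≥ 1,
      TraceInverse Cinv p T ∧ GradInverse CINV p T :=
  ⟨8 / σ ^ 2, by positivity, 5 / σ ^ 2, by positivity, fun _ hT' _ hp =>
    ⟨traceInverse_of_shapeRegular hσ hT' hp, gradInverse_of_shapeRegular hσ hT' hp⟩⟩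

end

section
open MvPolynomial

/-! ### Suprema of normals -/

lemma IsOutwardNormal.mem_closure {Ω : Set Plane} {z n : Plane} (h : IsOutwardNormal Ω z n) :
    z ∈ closure Ω := by
  obtain ⟨hn, r, hr, hball⟩ := h
  rw [Metric.mem_closure_iff]
  intro ε hε
  have hmin : 0 < min r ε := lt_min hr hε
  have hd : dist z (z - (min r ε / 2) • n) = min r ε / 2 := by
    rw [dist_eq_norm, sub_sub_cancel, norm_smul, hn, mul_one, Real.norm_of_nonneg (by positivity)]
  refine ⟨z - (min r ε / 2) • n, ?_, ?_⟩
  · rw [hball]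
    · rw [sub_sub_cancel_left, inner_neg_left, real_inner_smul_left, real_inner_self_eq_norm_sq, hn]
      linarith
    · rw [Metric.mem_ball, dist_comm, hd]
      linarith [min_le_left r ε]
  · rw [hd]; linarith [min_le_right r ε]

lemma abs_apply_le_norm (z : Plane) (i : Fin 2) : |z i| ≤ ‖z‖ := by
  simpa using PiLp.norm_apply_le z i

lemma abs_le_of_isOutwardNormal {T : Affine.Triangle ℝ Plane} {R : ℝ}
    (hR : ∀ z ∈ closure (tri T), |z 0| ≤ R) {z n : Plane} (h : IsOutwardNormal (tri T) z n) :
    |z 0 * n 1| ≤ R := by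
  rw [abs_mul]
  have h1 : |n 1| ≤ 1 := h.1 ▸ abs_apply_le_norm n 1
  have := hR z h.mem_closure
  nlinarith [abs_nonneg (z 0), abs_nonneg (n 1)]

lemma exists_abs_le_on_tri (T : Affine.Triangle ℝ Plane) :
    ∃ R, ∀ z ∈ closure (tri T), |z 0| ≤ R := by
  obtain ⟨R, hR⟩ := (isBounded_tri T).closure.exists_norm_le
  exact ⟨R, fun z hz => (abs_apply_le_norm z 0).trans (hR z hz)⟩

lemma supInflow_nonneg (T : Affine.Triangle ℝ Plane) : 0 ≤ supInflow T := by
  refine Real.sSup_nonneg ?_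
  rintro a ⟨z, n, -, -, rfl⟩
  exact abs_nonneg _

lemma supInflow_le {T : Affine.Triangle ℝ Plane} {R : ℝ} (hR0 : 0 ≤ R)
    (hR : ∀ z ∈ closure (tri T), |z 0| ≤ R) : supInflow T ≤ R := by
  refine Real.sSup_le ?_ hR0
  rintro a ⟨z, n, hn, -, rfl⟩
  exact abs_le_of_isOutwardNormal hR hn

/-- Only inflow points need the supremum, which is non-negative in any case. Through this one-sided
bound the outflow part of the boundary stays out of `δ_T`. -/
lemma neg_le_supInflow {T : Affine.Triangle ℝ Plane} {z n : Plane}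
    (h : IsOutwardNormal (tri T) z n) : -(z 0 * n 1) ≤ supInflow T := by
  rcases lt_or_ge (z 0 * n 1) 0 with hneg | hpos
  · obtain ⟨R, hR⟩ := exists_abs_le_on_tri T
    rw [← abs_of_neg hneg]
    refine le_csSup ⟨R, ?_⟩ ⟨z, n, h, hneg, rfl⟩
    rintro a ⟨z, n, hn, -, rfl⟩
    exact abs_le_of_isOutwardNormal hR hn
  · linarith [supInflow_nonneg T]

lemma supNormalX_le_one (T : Affine.Triangle ℝ Plane) : supNormalX T ≤ 1 := by
  refine Real.sSup_le ?_ zero_le_one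
  rintro a ⟨z, n, hn, rfl⟩
  exact hn.1 ▸ abs_apply_le_norm n 0

lemma abs_le_supNormalX {T : Affine.Triangle ℝ Plane} {z n : Plane}
    (h : IsOutwardNormal (tri T) z n) : |n 0| ≤ supNormalX T := by
  refine le_csSup ⟨1, ?_⟩ ⟨z, n, h, rfl⟩
  rintro a ⟨z, n, hn, rfl⟩
  exact hn.1 ▸ abs_apply_le_norm n 0

lemma supNormalX_nonneg (T : Affine.Triangle ℝ Plane) : 0 ≤ supNormalX T := by
  refine Real.sSup_nonneg ?_
  rintro a ⟨z, n, -, rfl⟩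
  exact abs_nonneg _

lemma abs_nrm_zero_le (T : Affine.Triangle ℝ Plane) (i : Fin 3) :
    |nrm T i 0| ≤ supNormalX T :=
  abs_le_supNormalX (isOutwardNormal_nrm T i (s := 1 / 2) (by norm_num))

/-- If every edge had vertical extent below `σ h`, the triangle would be too flat to contain the
vertical diameter of a disc of radius `σ h`. -/
lemma exists_abs_sub_ge_of_shapeRegular {σ : ℝ} (hσ : 0 < σ) {T : Affine.Triangle ℝ Plane}
    (hT' : ShapeRegular σ T) : ∃ i : Fin 3, σ * hT T ≤ |T.points (i + 1) 1 - T.points i 1| := by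
  obtain ⟨c, hc⟩ := hT'
  have hpos := mul_pos hσ (hT_pos T)
  by_contra! hlt
  have hlt' : ∀ i j, |T.points i 1 - T.points j 1| < σ * hT T := by
    have h0 := abs_lt.1 (hlt 0)
    have h1 := abs_lt.1 (hlt 1)
    have h2 := abs_lt.1 (hlt 2)
    simp only [show (0 : Fin 3) + 1 = 1 from rfl, show (1 : Fin 3) + 1 = 2 from rfl,
      show (2 : Fin 3) + 1 = 0 from rfl] at h0 h1 h2
    intro i j
    fin_cases i <;> fin_cases j <;> simp <;> first | exact hpos | (rw [abs_lt]; constructor <;> linarith)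
  -- all points of the triangle are within `σ h` of the vertex `P₀` in the vertical direction
  have hstrip : ∀ z ∈ tri T, ∀ j, |z 1 - T.points j 1| < σ * hT T := by
    intro z hz j
    have hconv : Convex ℝ {z : Plane | |z 1 - T.points j 1| < σ * hT T} := by
      have : {z : Plane | |z 1 - T.points j 1| < σ * hT T} =
          (EuclideanSpace.proj 1 : Plane →L[ℝ] ℝ) ⁻¹' Metric.ball (T.points j 1) (σ * hT T) := by
        ext w; simp [Real.dist_eq]
      rw [this]
      exact (convex_ball _ _).linear_preimage (EuclideanSpace.proj 1 : Plane →L[ℝ] ℝ).toLinearMap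
    refine convexHull_min ?_ hconv (interior_subset hz)
    rintro _ ⟨i, rfl⟩
    exact hlt' i j
  set e : Plane := EuclideanSpace.single 1 1 with he
  have hnorm : ‖e‖ = 1 := by simp [he]
  -- the highest vertex bounds the triangle from above
  obtain ⟨j, -, hj⟩ := Finset.exists_max_image Finset.univ (fun i : Fin 3 => T.points i 1)
    Finset.univ_nonempty
  have htop : ∀ z ∈ tri T, z 1 ≤ T.points j 1 := by
    intro z hz
    have hconv : Convex ℝ {z : Plane | z 1 ≤ T.points j 1} :=
      convex_halfSpace_le (EuclideanSpace.proj 1 : Plane →L[ℝ] ℝ).toLinearMap.isLinear _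
    refine convexHull_min ?_ hconv (interior_subset hz)
    rintro _ ⟨i, rfl⟩
    exact hj i (Finset.mem_univ i)
  have hcball : ∀ r, |r| < σ * hT T → c + r • e ∈ tri T := fun r hr => hc (by
    rw [Metric.mem_ball, dist_eq_norm, add_sub_cancel_left, norm_smul, hnorm, mul_one]; exact hr)
  have hev : ∀ r : ℝ, (c + r • e) 1 = c 1 + r := fun r => by simp [he]
  have h1 := htop _ (hcball (σ * hT T / 2) (by rw [abs_of_pos (by positivity)]; linarith))
  have h2 := hstrip _ (hcball (-(σ * hT T / 2)) (by rw [abs_neg, abs_of_pos (by positivity)]; linarith)) j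
  rw [hev] at h1 h2
  rw [abs_lt] at h2
  linarith [h2.1]

/-- The component `|n₁|` on an edge is its vertical extent divided by its length, and the length is
at most `h`. This keeps `δ_T` away from zero. -/
lemma le_supNormalX {σ : ℝ} (hσ : 0 < σ) {T : Affine.Triangle ℝ Plane}
    (hT' : ShapeRegular σ T) : σ ≤ supNormalX T := by
  obtain ⟨i, hi⟩ := exists_abs_sub_ge_of_shapeRegular hσ hT'
  refine le_trans ?_ (abs_nrm_zero_le T i)
  have hl := len_pos T i
  have hlh : len T i ≤ hT T := dist_points_le_hT T _ _
  have h1 := congrArg (fun x : ℝ => |x|) (len_mul_nrm_zero T i)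
  simp only [abs_mul, abs_of_pos hl] at h1
  have hsgn : |((SignType.sign (cr (T.points 0) (T.points 1) (T.points 2)) : SignType) : ℝ)| = 1 := by
    have h : cr (T.points 0) (T.points 1) (T.points 2) ≠ 0 := cr_points_ne_zero T 0
    rcases lt_or_gt_of_ne h with h' | h' <;> simp [h']
  rw [hsgn, one_mul] at h1
  rw [← h1] at hi
  nlinarith [hT_pos T, abs_nonneg (nrm T i 0)]

/-! ### Estimates on a single triangle -/

/-- The operator `L` on polynomials. -/
def opLp (P : MvPolynomial (Fin 2) ℝ) : MvPolynomial (Fin 2) ℝ :=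
  -pderiv 0 (pderiv 0 P) + X 0 * pderiv 1 P

lemma opL_polyFun (P : MvPolynomial (Fin 2) ℝ) : opL (polyFun P) = polyFun (opLp P) := by
  funext z
  simp [opL, opLp, dx_polyFun, xdy, dy_polyFun]

lemma trace_edges {C : ℝ} {p : ℕ} {T : Affine.Triangle ℝ Plane} (h : TraceInverse C p T)
    {P : MvPolynomial (Fin 2) ℝ} (hP : P.totalDegree ≤ p) :
    ∑ i : Fin 3, len T i * edg T i (P ^ 2) ≤ C * p ^ 2 / hT T * triInt T (P ^ 2) := by
  have := h P hP
  rwa [bdryNormSq_polyFun, ip_polyFun, ← pow_two] at this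

/-- Test with the constant `1`: the perimeter is at most `K` times the area, the area is at most
half an edge length times `h`, and `h < 1`. -/
lemma two_le_of_traceInverse {C : ℝ} {p : ℕ} {T : Affine.Triangle ℝ Plane}
    (h : TraceInverse C p T) (hh : hT T < 1) : 2 ≤ C * p ^ 2 / hT T := by
  have hpos := hT_pos T
  have h1 := trace_edges h (P := 1) (by simp)
  rw [one_pow, triInt_one T 0] at h1
  have hedg : ∀ i, edg T i 1 = 1 := fun i => by simp [edg, edgeInt_apply]
  simp only [hedg, mul_one, Fin.sum_univ_three] at h1
  have l0 := len_pos T 0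
  have l1 := len_pos T 1
  have l2 := len_pos T 2
  have hcr : |cr (T.points 0) (T.points (0 + 1)) (T.points (0 + 2))| ≤ len T 0 * hT T := by
    have e0 := dist_sq_eq (T.points 0) (T.points (0 + 1))
    have e1 := dist_sq_eq (T.points 0) (T.points (0 + 2))
    have hd := dist_points_le_hT T 0 (0 + 2)
    refine le_trans (abs_le_of_sq_le_sq ?_ (by positivity))
      (mul_le_mul_of_nonneg_left hd l0.le)
    rw [mul_pow, len, e0, e1]
    simp only [cr]
    nlinarith [sq_nonneg ((T.points (0 + 1) 0 - T.points 0 0) * (T.points (0 + 2) 0 - T.points 0 0) +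
      (T.points (0 + 1) 1 - T.points 0 1) * (T.points (0 + 2) 1 - T.points 0 1))]
  set K := C * p ^ 2 / hT T with hK
  set D := |cr (T.points 0) (T.points (0 + 1)) (T.points (0 + 2))|
  have hD : 0 ≤ D := abs_nonneg _
  have hKpos : 0 ≤ K := by
    by_contra! hneg
    nlinarith
  have : len T 0 * 2 ≤ len T 0 * K := by
    have h2 : D ≤ len T 0 := hcr.trans (by nlinarith)
    nlinarith
  exact le_of_mul_le_mul_left this l0

/-- Advection: only the inflow part of the boundary contributes negatively. -/
lemma triInt_advection_ge {C : ℝ} {p : ℕ} {T : Affine.Triangle ℝ Plane} (h : TraceInverse C p T)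
    {r : MvPolynomial (Fin 2) ℝ} (hr : r.totalDegree ≤ p) :
    -(supInflow T * (C * p ^ 2 / hT T) / 2 * triInt T (r ^ 2)) ≤
      triInt T (X 0 * pderiv 1 r * r) := by
  have hdiv := (triInt_pderiv T (X 0 * r ^ 2)).2
  have e : pderiv 1 (X 0 * r ^ 2) = (2 : ℝ) • (X 0 * pderiv 1 r * r) := by
    rw [pow_two, Derivation.leibniz, Derivation.leibniz, pderiv_X]
    simp [smul_eq_C_mul]
    rw [show (MvPolynomial.C (2 : ℝ) : MvPolynomial (Fin 2) ℝ) = 2 from rfl]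
    ring
  rw [e, map_smul, smul_eq_mul] at hdiv
  have htr := trace_edges h hr
  have hterm : ∀ i : Fin 3, -(supInflow T * (len T i * edg T i (r ^ 2))) ≤
      len T i * nrm T i 1 * edg T i (X 0 * r ^ 2) := by
    intro i
    have : edg T i ((-supInflow T) • r ^ 2) ≤ edg T i (nrm T i 1 • (X 0 * r ^ 2)) := by
      refine edg_mono_of_Ioo T i fun s hs => ?_
      have hn := neg_le_supInflow (isOutwardNormal_nrm T i hs)
      have h0 := polyFun_sq_nonneg r (AffineMap.lineMap (T.points i) (T.points (i + 1)) s)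
      rw [polyFun_smul, polyFun_smul, polyFun_mul, polyFun_X]
      nlinarith
    rw [map_smul, map_smul, smul_eq_mul, smul_eq_mul] at this
    nlinarith [len_pos T i]
  have hsum := Finset.sum_le_sum fun i (_ : i ∈ Finset.univ) => hterm i
  rw [Finset.sum_neg_distrib, ← Finset.mul_sum, ← hdiv] at hsum
  nlinarith [mul_le_mul_of_nonneg_left htr (supInflow_nonneg T)]

/-- Integration by parts leaves `‖r_x‖²` minus a boundary integral of `n₁ r_x r`. Young's inequality
with weight `1/(2K)` on the trace of `r_x` costs half of `‖r_x‖²`, the rest is a multiple of `‖r‖²`.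
-/
lemma triInt_diffusion_ge {C : ℝ} {p : ℕ} {T : Affine.Triangle ℝ Plane} (h : TraceInverse C p T)
    (hK : 0 < C * p ^ 2 / hT T) {r : MvPolynomial (Fin 2) ℝ} (hr : r.totalDegree ≤ p) :
    -(supNormalX T ^ 2 * (C * p ^ 2 / hT T) ^ 2 / 2 * triInt T (r ^ 2)) ≤
      triInt T (-pderiv 0 (pderiv 0 r) * r) := by
  have hdiv := (triInt_pderiv T (pderiv 0 r * r)).1
  have e : pderiv 0 (pderiv 0 r * r) = pderiv 0 r ^ 2 - (-pderiv 0 (pderiv 0 r) * r) := by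
    rw [Derivation.leibniz, smul_eq_mul, smul_eq_mul]; ring
  rw [e, map_sub] at hdiv
  have ht1 := trace_edges h hr
  have ht2 := trace_edges h ((totalDegree_pderiv_le 0 r).trans hr)
  set K := C * p ^ 2 / hT T
  set N := supNormalX T
  set q := pderiv 0 r
  have hterm : ∀ i : Fin 3, len T i * nrm T i 0 * edg T i (q * r) ≤
      1 / (2 * K) * (len T i * edg T i (q ^ 2)) + N ^ 2 * K / 2 * (len T i * edg T i (r ^ 2)) := by
    intro i
    have : edg T i (nrm T i 0 • (q * r)) ≤
        edg T i ((1 / (2 * K)) • q ^ 2 + (N ^ 2 * K / 2) • r ^ 2) := by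
      refine edg_mono_of_Ioo T i fun s hs => ?_
      have hn := abs_nrm_zero_le T i
      simp only [polyFun_smul, polyFun_add, polyFun_mul, pow_two]
      set a := polyFun q (AffineMap.lineMap (T.points i) (T.points (i + 1)) s)
      set b := polyFun r (AffineMap.lineMap (T.points i) (T.points (i + 1)) s)
      have hn2 : nrm T i 0 ^ 2 ≤ N ^ 2 := sq_le_sq' (by linarith [(abs_le.1 hn).1]) (abs_le.1 hn).2
      have h3 : 1 / (2 * K) * (a * a) + N * N * K / 2 * (b * b) - nrm T i 0 * (a * b) =
          ((a - K * nrm T i 0 * b) ^ 2 + K ^ 2 * b ^ 2 * (N ^ 2 - nrm T i 0 ^ 2)) / (2 * K) := by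
        field_simp; ring
      have h4 : 0 ≤ ((a - K * nrm T i 0 * b) ^ 2 + K ^ 2 * b ^ 2 * (N ^ 2 - nrm T i 0 ^ 2)) /
          (2 * K) := by
        have : 0 ≤ N ^ 2 - nrm T i 0 ^ 2 := by linarith
        positivity
      linarith
    rw [map_add, map_smul, map_smul, map_smul, smul_eq_mul, smul_eq_mul, smul_eq_mul] at this
    nlinarith [len_pos T i]
  have hsum := Finset.sum_le_sum fun i (_ : i ∈ Finset.univ) => hterm i
  rw [Finset.sum_add_distrib, ← Finset.mul_sum, ← Finset.mul_sum, ← hdiv] at hsum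
  have h1 : 1 / (2 * K) * ∑ i : Fin 3, len T i * edg T i (q ^ 2) ≤ 1 / 2 * triInt T (q ^ 2) := by
    calc _ ≤ 1 / (2 * K) * (K * triInt T (q ^ 2)) := by gcongr
      _ = _ := by field_simp
  have h2 := mul_le_mul_of_nonneg_left ht1 (show 0 ≤ N ^ 2 * K / 2 by positivity)
  have h3 := triInt_sq_nonneg T q
  nlinarith

/-- With `K = C p² / h`, advection loses a multiple of `K` and diffusion one of `K²`. Since `K ≥ 2`,
both fit into `δ_T`, which scales like `K²`. -/
lemma triInt_opLp_ge {C : ℝ} {p : ℕ} {T : Affine.Triangle ℝ Plane} (h : TraceInverse C p T)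
    (hh : hT T < 1) {r : MvPolynomial (Fin 2) ℝ} (hr : r.totalDegree ≤ p) :
    -(3 / 2 * delta C p T * triInt T (r ^ 2)) ≤ triInt T (opLp r * r) := by
  have h2 := two_le_of_traceInverse h hh
  have ha := triInt_advection_ge h hr
  have hd := triInt_diffusion_ge h (by linarith) hr
  have e : opLp r * r = -pderiv 0 (pderiv 0 r) * r + X 0 * pderiv 1 r * r := by
    rw [opLp]; ring
  rw [e, map_add]
  have hdelta : delta C p T = (3 * supInflow T + 2 * supNormalX T ^ 2) / 6 *
      (C * p ^ 2 / hT T) ^ 2 := by rw [delta]; ring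
  rw [hdelta]
  set K := C * p ^ 2 / hT T
  have hS := supInflow_nonneg T
  have hI := triInt_sq_nonneg T r
  have : supInflow T * K / 2 ≤ 3 / 4 * supInflow T * K ^ 2 := by nlinarith [mul_nonneg hS (by linarith : 0 ≤ K)]
  nlinarith [mul_le_mul_of_nonneg_right this hI]

/-- The commutator of two derivations is a derivation, and it vanishes on the variables. -/
lemma pderiv_pderiv_comm (P : MvPolynomial (Fin 2) ℝ) :
    pderiv 1 (pderiv 0 P) = pderiv 0 (pderiv 1 P) := by
  have h : ⁅(pderiv 1 : Derivation ℝ (MvPolynomial (Fin 2) ℝ) (MvPolynomial (Fin 2) ℝ)),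
      (pderiv 0 : Derivation ℝ (MvPolynomial (Fin 2) ℝ) (MvPolynomial (Fin 2) ℝ))⁆ = 0 := by
    refine MvPolynomial.derivation_ext fun i => ?_
    fin_cases i <;> simp [Derivation.commutator_apply, pderiv_X]
  have := congrArg (fun D : Derivation ℝ (MvPolynomial (Fin 2) ℝ) (MvPolynomial (Fin 2) ℝ) => D P) h
  simpa [Derivation.commutator_apply, sub_eq_zero] using this

/-- The form `(∇v, A ∇w)_T` on polynomials, for given gradients. -/
lemma ipA_polyFun (C : ℝ) (p : ℕ) (T : Affine.Triangle ℝ Plane)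
    (a b c d : MvPolynomial (Fin 2) ℝ) :
    ipA C p T (polyFun a) (polyFun b) (polyFun c) (polyFun d) =
      alpha C p T * triInt T (a * c) + beta C p T * (triInt T (a * d) + triInt T (b * c)) +
        gamma C p T * triInt T (b * d) := by
  have e : ∀ (s t : ℝ) (P Q : MvPolynomial (Fin 2) ℝ),
      (fun z => s * polyFun P z + t * polyFun Q z) = polyFun (s • P + t • Q) := by
    intro s t P Q; funext z; simp
  rw [ipA, e, e, ip_polyFun, ip_polyFun, mul_add, mul_add, map_add, map_add, mul_smul_comm,
    mul_smul_comm, mul_smul_comm, mul_smul_comm, map_smul, map_smul, map_smul, map_smul]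
  simp only [smul_eq_mul]; ring

/-- Hypocoercivity on a single triangle. -/
lemma ipA_opLp_ge {C : ℝ} {p : ℕ} {T : Affine.Triangle ℝ Plane} (h : TraceInverse C p T)
    (hh : hT T < 1) (hδ : 0 < delta C p T) {P : MvPolynomial (Fin 2) ℝ} (hP : P.totalDegree ≤ p) :
    -(3 / 16) * triInt T (pderiv 0 P ^ 2) + 7 / 384 / delta C p T ^ 2 * triInt T (pderiv 1 P ^ 2) ≤
      ipA C p T (polyFun (pderiv 0 (opLp P))) (polyFun (pderiv 1 (opLp P)))
        (polyFun (pderiv 0 P)) (polyFun (pderiv 1 P)) := by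
  rw [ipA_polyFun]
  set δ := delta C p T with hδdef
  have hα : alpha C p T = 1 / (8 * δ) := by rw [alpha, one_div]
  have hβ : beta C p T = 1 / (24 * δ ^ 2) := by rw [beta, one_div]
  have hγ : gamma C p T = 1 / (64 * δ ^ 3) := by rw [gamma, one_div]
  rw [hα, hβ, hγ]
  have hdx : (pderiv 0 P).totalDegree ≤ p := (totalDegree_pderiv_le 0 P).trans hP
  have hdy : (pderiv 1 P).totalDegree ≤ p := (totalDegree_pderiv_le 1 P).trans hP
  set Px := pderiv 0 P with hPx
  set Py := pderiv 1 P with hPy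
  have hcomm : pderiv 1 Px = pderiv 0 Py := by
    rw [hPx, hPy]; exact pderiv_pderiv_comm P
  -- Differentiating the coefficient `x` of `L` produces the extra `P_y`; paired with `β P_y` it is
  -- the source of all control of `P_y`.
  have e0 : pderiv 0 (opLp P) = opLp Px + Py := by
    rw [opLp, opLp, map_add, map_neg, ← hPx, ← hPy, Derivation.leibniz, pderiv_X, hcomm]
    simp; ring
  have e1 : pderiv 1 (opLp P) = opLp Py := by
    have h3 : pderiv 1 (pderiv 0 Px) = pderiv 0 (pderiv 0 Py) := by
      rw [← hcomm]; exact pderiv_pderiv_comm Px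
    rw [opLp, opLp, map_add, map_neg, ← hPx, ← hPy, Derivation.leibniz, pderiv_X, h3]
    simp
  -- the form is diagonal in `q = P_x + P_y / (3 δ)` and `P_y`
  set q := Px + (1 / (3 * δ)) • Py with hq
  have hqdeg : q.totalDegree ≤ p :=
    (totalDegree_add _ _).trans (max_le hdx ((totalDegree_smul_le _ _).trans hdy))
  have hLq : opLp q = opLp Px + (1 / (3 * δ)) • opLp Py := by
    rw [hq]
    simp only [opLp, map_add, smul_eq_C_mul, pderiv_C_mul]
    ring
  have k1 := triInt_opLp_ge h hh hqdeg
  have k2 := triInt_opLp_ge h hh hdy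
  have x1 : triInt T (opLp q * q) = triInt T (opLp Px * Px) + 1 / (3 * δ) *
      (triInt T (opLp Px * Py) + triInt T (opLp Py * Px)) +
      (1 / (3 * δ)) ^ 2 * triInt T (opLp Py * Py) := by
    have : opLp q * q = opLp Px * Px + (1 / (3 * δ)) • (opLp Px * Py + opLp Py * Px) +
        ((1 / (3 * δ)) ^ 2) • (opLp Py * Py) := by
      rw [hLq, hq]; simp only [smul_eq_C_mul, C_pow]; ring
    rw [this, map_add, map_add, map_smul, map_smul, map_add, smul_eq_mul, smul_eq_mul]
  have x2 : triInt T (q ^ 2) = triInt T (Px ^ 2) + 2 * (1 / (3 * δ)) * triInt T (Px * Py) +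
      (1 / (3 * δ)) ^ 2 * triInt T (Py ^ 2) := by
    have : q ^ 2 = Px ^ 2 + (2 * (1 / (3 * δ))) • (Px * Py) + ((1 / (3 * δ)) ^ 2) • (Py ^ 2) := by
      rw [hq]; simp only [smul_eq_C_mul, C_pow, C_mul]
      rw [show (MvPolynomial.C (2 : ℝ) : MvPolynomial (Fin 2) ℝ) = 2 from rfl]; ring
    rw [this, map_add, map_add, map_smul, map_smul, smul_eq_mul, smul_eq_mul]
  rw [x1, x2] at k1
  rw [e0, e1, add_mul, add_mul, map_add, map_add, mul_comm Py Px, ← pow_two]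
  set I1 := triInt T (opLp Px * Px)
  set I2 := triInt T (opLp Px * Py)
  set I3 := triInt T (opLp Py * Px)
  set I4 := triInt T (opLp Py * Py)
  set x := triInt T (Px ^ 2)
  set m := triInt T (Px * Py)
  set y := triInt T (Py ^ 2)
  have w1 : 0 ≤ 1 / (8 * δ) := by positivity
  -- The square of `q` uses up `1/(72 δ³)` of `γ`. The remainder `1/(576 δ³)` is positive and is the
  -- second diagonal entry.
  have w2 : 0 ≤ 1 / (64 * δ ^ 3) - 1 / (72 * δ ^ 3) := by
    have : 1 / (64 * δ ^ 3) - 1 / (72 * δ ^ 3) = 1 / (576 * δ ^ 3) := by field_simp; norm_num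
    rw [this]; positivity
  have m1 := mul_le_mul_of_nonneg_left k1 w1
  have m2 := mul_le_mul_of_nonneg_left k2 w2
  have f1 : 1 / (8 * δ) * (I1 + 1 / (3 * δ) * (I2 + I3) + (1 / (3 * δ)) ^ 2 * I4) +
      (1 / (64 * δ ^ 3) - 1 / (72 * δ ^ 3)) * I4 =
      1 / (8 * δ) * I1 + 1 / (24 * δ ^ 2) * (I2 + I3) + 1 / (64 * δ ^ 3) * I4 := by
    field_simp; ring
  -- The term `-m/(8δ)` cancels against the mixed commutator term `α (P_y, P_x)`; this fixes the
  -- shift `1/(3δ)` in `q`.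
  have f2 : 1 / (8 * δ) * -(3 / 2 * δ * (x + 2 * (1 / (3 * δ)) * m + (1 / (3 * δ)) ^ 2 * y)) +
      (1 / (64 * δ ^ 3) - 1 / (72 * δ ^ 3)) * -(3 / 2 * δ * y) =
      -(3 / 16) * x - 1 / (8 * δ) * m - 3 / 128 / δ ^ 2 * y := by
    field_simp; ring
  -- The gain `β` is `16/384` over `δ²` and the loss is `9/384`.
  have f3 : 1 / (24 * δ ^ 2) * y - 3 / 128 / δ ^ 2 * y = 7 / 384 / δ ^ 2 * y := by
    field_simp; ring
  nlinarith

/-- The streamline term on a single triangle. -/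
lemma ip_streamline_ge {CINV : ℝ} (hC : 0 < CINV) {p : ℕ} (hp : 1 ≤ p)
    {T : Affine.Triangle ℝ Plane} (h : GradInverse CINV p T) {P : MvPolynomial (Fin 2) ℝ}
    (hP : P.totalDegree ≤ p) (W : MvPolynomial (Fin 2) ℝ) :
    -(1 / 16) * triInt T (pderiv 0 P ^ 2) ≤
      tau CINV p T * triInt T ((W + opLp P) * (W + X 0 * pderiv 1 P)) := by
  have hpos := hT_pos T
  have hp' : (0 : ℝ) < p := by exact_mod_cast hp
  have hg := (gradInverse_iff CINV hC.le p T).1 h (pderiv 0 P) ((totalDegree_pderiv_le 0 P).trans hP)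
  -- With `s = W + x P_y` the integrand is `(s - P_xx) s ≥ -P_xx²/4`, whatever `W` is. The square of
  -- `P_xy` is added to form the full gradient of `P_x`.
  have h1 : 0 ≤ triInt T ((W + opLp P) * (W + X 0 * pderiv 1 P) +
      (1 / 4 : ℝ) • (pderiv 0 (pderiv 0 P) ^ 2 + pderiv 1 (pderiv 0 P) ^ 2)) := by
    refine triInt_nonneg T fun z => ?_
    simp only [opLp, polyFun_add, polyFun_mul, polyFun_smul, polyFun_neg, pow_two]
    nlinarith [sq_nonneg (polyFun W z + polyFun (X 0) z * polyFun (pderiv 1 P) z -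
      polyFun (pderiv 0 (pderiv 0 P)) z / 2), sq_nonneg (polyFun (pderiv 1 (pderiv 0 P)) z)]
  rw [map_add, map_smul, smul_eq_mul] at h1
  have hτ : 0 < tau CINV p T := by rw [tau]; positivity
  have hτ2 : tau CINV p T * (CINV * p ^ 2 / hT T) ^ 2 = 1 / 4 := by
    rw [tau]; field_simp
  set G := triInt T (pderiv 0 (pderiv 0 P) ^ 2 + pderiv 1 (pderiv 0 P) ^ 2)
  have h2 := mul_le_mul_of_nonneg_left hg hτ.le
  rw [← mul_assoc, hτ2] at h2
  nlinarith [mul_nonneg hτ.le h1]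

end

section
open MvPolynomial

/-! ### The skeleton of a triangulation -/

/-- The union of the lines through the edges of the triangles. -/
def skel (𝒯 : Finset (Affine.Triangle ℝ Plane)) : Set Plane :=
  ⋃ T ∈ 𝒯, ⋃ i : Fin 3, {z | cr (T.points i) (T.points (i + 1)) z = 0}

lemma mem_skel {𝒯 : Finset (Affine.Triangle ℝ Plane)} {z : Plane} :
    z ∈ skel 𝒯 ↔ ∃ T ∈ 𝒯, ∃ i, cr (T.points i) (T.points (i + 1)) z = 0 := by
  simp [skel]

lemma points_ne (T : Affine.Triangle ℝ Plane) (i : Fin 3) : T.points i ≠ T.points (i + 1) := by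
  intro h
  have := len_pos T i
  rw [len, h, dist_self] at this
  exact this.false

lemma cr_add_perp (a b z : Plane) (ε : ℝ) :
    cr a b (z + ε • !₂[-(b 1 - a 1), b 0 - a 0]) = cr a b z + ε * dist a b ^ 2 := by
  rw [dist_sq_eq]; simp [cr]; ring

/-- An open set meets both sides of a line through one of its points. -/
lemma exists_cr_pos_of_isOpen {O : Set Plane} (hO : IsOpen O) {a b z : Plane} (hab : a ≠ b)
    (hz : z ∈ O) (h0 : cr a b z = 0) : ∃ w ∈ O, 0 < cr a b w := by
  have hcont : ContinuousAt (fun ε : ℝ => z + ε • !₂[-(b 1 - a 1), b 0 - a 0]) 0 := by fun_prop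
  have hn : O ∈ 𝓝 (z + (0 : ℝ) • !₂[-(b 1 - a 1), b 0 - a 0]) := by
    simpa using hO.mem_nhds hz
  obtain ⟨r, hr, hball⟩ := Metric.mem_nhds_iff.1 (hcont.preimage_mem_nhds hn)
  have hmem : r / 2 ∈ Metric.ball (0 : ℝ) r := by simp [abs_of_pos hr, hr]
  refine ⟨_, hball hmem, ?_⟩
  rw [cr_add_perp, h0]
  have := dist_pos.2 hab
  positivity

/-- A closed convex set with empty interior is its own frontier, and frontiers of convex sets are
null. -/
lemma volume_line_eq_zero {a b : Plane} (hab : a ≠ b) : volume {z | cr a b z = 0} = 0 := by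
  have hconv : Convex ℝ {z | cr a b z = 0} := by
    intro x hx y hy s t hs ht hst
    have ht' : t = 1 - s := by linarith
    have : cr a b (s • x + t • y) = s * cr a b x + t * cr a b y := by subst ht'; simp [cr]; ring
    rw [Set.mem_ofPred_eq] at hx hy ⊢
    rw [this, hx, hy]; ring
  have hclosed : IsClosed {z | cr a b z = 0} :=
    isClosed_eq (continuous_cr continuous_const continuous_const continuous_id) continuous_const
  have hint : interior {z | cr a b z = 0} = ∅ := by
    rw [Set.eq_empty_iff_forall_notMem]
    intro z hz
    have hsub : ∀ w ∈ interior {z | cr a b z = 0}, cr a b w = 0 :=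
      fun w hw => (interior_subset hw : w ∈ {z | cr a b z = 0})
    obtain ⟨w, hw, hpos⟩ := exists_cr_pos_of_isOpen isOpen_interior hab hz (hsub z hz)
    exact hpos.ne' (hsub w hw)
  have := hconv.addHaar_frontier volume
  rwa [hclosed.frontier_eq, hint, Set.sdiff_empty] at this

lemma volume_skel_eq_zero (𝒯 : Finset (Affine.Triangle ℝ Plane)) : volume (skel 𝒯) = 0 := by
  rw [skel]
  refine (measure_biUnion_null_iff 𝒯.countable_toSet).2 fun T _ => ?_
  rw [measure_iUnion_null_iff]
  exact fun i => volume_line_eq_zero (points_ne T i)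

lemma mem_skel_of_mem_closure_tri {𝒯 : Finset (Affine.Triangle ℝ Plane)}
    {T : Affine.Triangle ℝ Plane} (hT' : T ∈ 𝒯) {z : Plane} (hz : z ∈ closure (tri T))
    (hz' : z ∉ tri T) : z ∈ skel 𝒯 := by
  have h := cr_points_ne_zero T 0
  have hcl : closure (tri T) = convexHull ℝ {T.points 0, T.points (0 + 1), T.points (0 + 2)} := by
    rw [closure_tri, hull_points_eq T 0]
  rw [hcl, mem_convexHull_iff_cr h] at hz
  rw [tri_eq_openTri T 0, mem_openTri_iff h] at hz'
  rw [mem_skel]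
  by_contra! hne
  have h0 := hne T hT' 0
  have h1 := hne T hT' 1
  have h2 := hne T hT' 2
  have r1 : cr (T.points 1) (T.points (1 + 1)) z = cr z (T.points (0 + 1)) (T.points (0 + 2)) :=
    cr_rotate _ _ _
  have r2 : cr (T.points 2) (T.points (2 + 1)) z = cr (T.points 0) z (T.points (0 + 2)) :=
    (cr_rotate _ _ _).symm
  rw [r1] at h1
  rw [r2] at h2
  obtain ⟨p1, p2, p3⟩ := hz
  exact hz' ⟨lt_of_le_of_ne p1 (div_ne_zero h1 h).symm, lt_of_le_of_ne p2 (div_ne_zero h2 h).symm,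
    lt_of_le_of_ne p3 (div_ne_zero h0 h).symm⟩

section Mesh

variable {Ω : Set Plane} {𝒯 : Finset (Affine.Triangle ℝ Plane)}

/-- Off the skeleton, a point lies in an element or outside the closed domain. -/
lemma IsTriangulation.cases_of_notMem_skel (h𝒯 : IsTriangulation Ω 𝒯) {z : Plane}
    (hz : z ∉ skel 𝒯) : (∃ T ∈ 𝒯, z ∈ tri T) ∨ z ∉ closure Ω := by
  by_cases hc : z ∈ closure Ω
  · left
    rw [← h𝒯.cover] at hc
    obtain ⟨T, hT', hzT⟩ := Set.mem_iUnion₂.1 hc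
    refine ⟨T, hT', ?_⟩
    by_contra h
    exact hz (mem_skel_of_mem_closure_tri hT' hzT h)
  · exact Or.inr hc

lemma IsTriangulation.frontier_subset_skel (h𝒯 : IsTriangulation Ω 𝒯) (hΩ : IsOpen Ω) :
    frontier Ω ⊆ skel 𝒯 := by
  intro z hz
  by_contra h
  rw [hΩ.frontier_eq] at hz
  rcases h𝒯.cases_of_notMem_skel h with ⟨T, hT', hzT⟩ | hc
  · exact hz.2 (h𝒯.subset T hT' hzT)
  · exact hc hz.1

lemma IsTriangulation.ae_eq (h𝒯 : IsTriangulation Ω 𝒯) :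
    (Ω : Set Plane) =ᵐ[volume] (⋃ T ∈ 𝒯, tri T : Set Plane) := by
  refine ae_eq_set.2 ⟨?_, ?_⟩
  · refine measure_mono_null ?_ (volume_skel_eq_zero 𝒯)
    rintro z ⟨hz, hz'⟩
    by_contra h
    rcases h𝒯.cases_of_notMem_skel h with ⟨T, hT', hzT⟩ | hc
    · exact hz' (Set.mem_iUnion₂.2 ⟨T, hT', hzT⟩)
    · exact hc (subset_closure hz)
  · rw [Set.sdiff_eq_empty.2 (Set.iUnion₂_subset h𝒯.subset)]
    exact measure_empty

lemma IsTriangulation.setIntegral_eq_sum (h𝒯 : IsTriangulation Ω 𝒯) {F : Plane → ℝ}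
    (hF : ∀ T ∈ 𝒯, IntegrableOn F (tri T)) : ∫ z in Ω, F z = ∑ T ∈ 𝒯, ∫ z in tri T, F z := by
  rw [setIntegral_congr_set h𝒯.ae_eq]
  exact integral_biUnion_finset 𝒯 (fun T _ => (isOpen_tri T).measurableSet) h𝒯.disjoint hF

/-! ### Functions in the finite element space -/

/-- The gradients of two functions that agree on an open set agree there. -/
lemma fderiv_eqOn {v w : Plane → ℝ} {U : Set Plane} (hU : IsOpen U) (h : Set.EqOn v w U) {z : Plane}
    (hz : z ∈ U) : fderiv ℝ v z = fderiv ℝ w z :=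
  (Filter.eventuallyEq_of_mem (hU.mem_nhds hz) h).fderiv_eq

lemma dx_eqOn {v w : Plane → ℝ} {U : Set Plane} (hU : IsOpen U) (h : Set.EqOn v w U) :
    Set.EqOn (dx v) (dx w) U := fun z hz => by rw [dx, dx, fderiv_eqOn hU h hz]

lemma dy_eqOn {v w : Plane → ℝ} {U : Set Plane} (hU : IsOpen U) (h : Set.EqOn v w U) :
    Set.EqOn (dy v) (dy w) U := fun z hz => by rw [dy, dy, fderiv_eqOn hU h hz]

lemma opL_eqOn {v w : Plane → ℝ} {U : Set Plane} (hU : IsOpen U) (h : Set.EqOn v w U) :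
    Set.EqOn (opL v) (opL w) U := fun z hz => by
  rw [opL, opL, xdy, xdy, dx_eqOn hU (dx_eqOn hU h) hz, dy_eqOn hU h hz]

lemma fderiv_apply_eq (v : Plane → ℝ) (z e : Plane) :
    fderiv ℝ v z e = e 0 * dx v z + e 1 * dy v z := by
  have he : e = e 0 • EuclideanSpace.single 0 1 + e 1 • EuclideanSpace.single 1 1 := by
    refine plane_ext ?_ ?_ <;> simp
  conv_lhs => rw [he]
  rw [map_add, map_smul, map_smul, smul_eq_mul, smul_eq_mul]; rfl

lemma measurable_dx (v : Plane → ℝ) : Measurable (dx v) := measurable_fderiv_apply_const ℝ v _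

lemma measurable_dy (v : Plane → ℝ) : Measurable (dy v) := measurable_fderiv_apply_const ℝ v _

variable {p : ℕ} {v : Plane → ℝ}

lemma measurable_of_mem_femSpace (hv : v ∈ femSpace Ω 𝒯 p) : Measurable v := by
  classical
  have : v = (closure Ω).piecewise v (fun _ => 0) := by
    funext z
    by_cases hz : z ∈ closure Ω
    · rw [Set.piecewise_eq_of_mem _ _ _ hz]
    · rw [Set.piecewise_eq_of_notMem _ _ _ hz, hv.2.1 z hz]
  rw [this]
  exact hv.1.measurable_piecewise continuousOn_const isClosed_closure.measurableSet

lemma exists_bound_of_mem_femSpace (hb : Bornology.IsBounded Ω) (hv : v ∈ femSpace Ω 𝒯 p) :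
    ∃ M, 0 ≤ M ∧ ∀ z, |v z| ≤ M := by
  have hK : IsCompact (closure Ω) := Metric.isCompact_of_isClosed_isBounded isClosed_closure hb.closure
  obtain ⟨M, hM⟩ := hK.exists_bound_of_continuousOn hv.1
  refine ⟨max M 0, le_max_right _ _, fun z => ?_⟩
  by_cases hz : z ∈ closure Ω
  · exact (hM z hz).trans (le_max_left _ _)
  · rw [hv.2.1 z hz, abs_zero]; exact le_max_right _ _

lemma differentiableAt_of_mem_femSpace (h𝒯 : IsTriangulation Ω 𝒯) (hv : v ∈ femSpace Ω 𝒯 p)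
    {z : Plane} (hz : z ∉ skel 𝒯) : DifferentiableAt ℝ v z := by
  rcases h𝒯.cases_of_notMem_skel hz with ⟨T, hT', hzT⟩ | hc
  · obtain ⟨P, -, hP⟩ := hv.2.2.1 T hT'
    have := (hasFDerivAt_polyFun P z).differentiableAt
    exact this.congr_of_eventuallyEq (eventuallyEq_of_mem ((isOpen_tri T).mem_nhds hzT) hP)
  · have : v =ᶠ[𝓝 z] fun _ => (0 : ℝ) :=
      eventuallyEq_of_mem (isClosed_closure.isOpen_compl.mem_nhds hc) fun w hw => hv.2.1 w hw
    exact (differentiableAt_const 0).congr_of_eventuallyEq this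

lemma dx_dy_eq_zero_of_notMem_closure (hv : v ∈ femSpace Ω 𝒯 p) {z : Plane} (hz : z ∉ closure Ω) :
    dx v z = 0 ∧ dy v z = 0 := by
  have : v =ᶠ[𝓝 z] fun _ => (0 : ℝ) :=
    eventuallyEq_of_mem (isClosed_closure.isOpen_compl.mem_nhds hz) fun w hw => hv.2.1 w hw
  rw [dx, dy, this.fderiv_eq]; simp

/-- On each element the gradient is that of a polynomial, and outside the closed domain it vanishes.
Points of the skeleton are left out, where `v` need not be differentiable. -/
lemma exists_bound_gradient (h𝒯 : IsTriangulation Ω 𝒯) (hv : v ∈ femSpace Ω 𝒯 p) :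
    ∃ M, 0 ≤ M ∧ ∀ z ∉ skel 𝒯, |dx v z| ≤ M ∧ |dy v z| ≤ M := by
  have h1 : ∀ T ∈ 𝒯, ∃ M, 0 ≤ M ∧ ∀ z ∈ tri T, |dx v z| ≤ M ∧ |dy v z| ≤ M := by
    intro T hT'
    obtain ⟨P, -, hP⟩ := hv.2.2.1 T hT'
    obtain ⟨M0, hM0⟩ := (isCompact_hull_points T).exists_bound_of_continuousOn
      (continuous_polyFun (pderiv 0 P)).continuousOn
    obtain ⟨M1, hM1⟩ := (isCompact_hull_points T).exists_bound_of_continuousOn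
      (continuous_polyFun (pderiv 1 P)).continuousOn
    refine ⟨max (max M0 M1) 0, le_max_right _ _, fun z hz => ?_⟩
    rw [dx_eqOn (isOpen_tri T) hP hz, dy_eqOn (isOpen_tri T) hP hz, dx_polyFun, dy_polyFun]
    exact ⟨(hM0 z (interior_subset hz)).trans ((le_max_left _ _).trans (le_max_left _ _)),
      (hM1 z (interior_subset hz)).trans ((le_max_right _ _).trans (le_max_left _ _))⟩
  choose! M hM using h1
  refine ⟨∑ T ∈ 𝒯, M T, Finset.sum_nonneg fun T hT' => (hM T hT').1, fun z hz => ?_⟩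
  rcases h𝒯.cases_of_notMem_skel hz with ⟨T, hT', hzT⟩ | hc
  · have hle := Finset.single_le_sum (f := M) (fun T hT' => (hM T hT').1) hT'
    exact ⟨((hM T hT').2 z hzT).1.trans hle, ((hM T hT').2 z hzT).2.trans hle⟩
  · rw [(dx_dy_eq_zero_of_notMem_closure hv hc).1, (dx_dy_eq_zero_of_notMem_closure hv hc).2]
    simp only [abs_zero, and_self]
    exact Finset.sum_nonneg fun T hT' => (hM T hT').1

/-- A line that is not contained in the line through an edge meets it at most once. -/
lemma countable_line_skel {z e : Plane}
    (hline : ∀ T ∈ 𝒯, ∀ i : Fin 3, ∃ r : ℝ, cr (T.points i) (T.points (i + 1)) (z + r • e) ≠ 0) :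
    {r : ℝ | z + r • e ∈ skel 𝒯}.Finite := by
  have : {r : ℝ | z + r • e ∈ skel 𝒯} = ⋃ T ∈ 𝒯, ⋃ i : Fin 3,
      {r : ℝ | cr (T.points i) (T.points (i + 1)) (z + r • e) = 0} := by
    ext r; simp [mem_skel]
  rw [this]
  refine 𝒯.finite_toSet.biUnion fun T hT' => Set.finite_iUnion fun i => ?_
  refine Set.Subsingleton.finite fun r hr s hs => ?_
  by_contra hne
  obtain ⟨t, ht⟩ := hline T hT' i
  apply ht
  rw [Set.mem_ofPred_eq] at hr hs
  have key : ∀ x : ℝ, cr (T.points i) (T.points (i + 1)) (z + x • e) =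
      cr (T.points i) (T.points (i + 1)) z + x * ((T.points (i + 1) 0 - T.points i 0) * e 1 -
        (T.points (i + 1) 1 - T.points i 1) * e 0) := by
    intro x; simp [cr]; ring
  rw [key] at hr hs ⊢
  set A := cr (T.points i) (T.points (i + 1)) z
  set B := (T.points (i + 1) 0 - T.points i 0) * e 1 - (T.points (i + 1) 1 - T.points i 1) * e 0
  have hB : B = 0 := by
    have : (r - s) * B = 0 := by linarith
    exact (mul_eq_zero.1 this).resolve_left (sub_ne_zero.2 hne)
  rw [hB] at hr ⊢
  linarith

/-- The fundamental theorem of calculus for finite element functions along generic lines. -/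
lemma integral_fderiv_line (h𝒯 : IsTriangulation Ω 𝒯) (hv : v ∈ femSpace Ω 𝒯 p) {z e : Plane}
    {a b : ℝ} (hab : a ≤ b) (hc : ContinuousOn (fun r : ℝ => v (z + r • e)) (Set.Icc a b))
    (hline : ∀ T ∈ 𝒯, ∀ i : Fin 3, ∃ r : ℝ, cr (T.points i) (T.points (i + 1)) (z + r • e) ≠ 0) :
    IntervalIntegrable (fun r : ℝ => fderiv ℝ v (z + r • e) e) volume a b ∧
    ∫ r in a..b, fderiv ℝ v (z + r • e) e = v (z + b • e) - v (z + a • e) := by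
  have hcount := (countable_line_skel hline).countable
  obtain ⟨M, hM0, hM⟩ := exists_bound_gradient h𝒯 hv
  have hint : IntervalIntegrable (fun r : ℝ => fderiv ℝ v (z + r • e) e) volume a b := by
    rw [intervalIntegrable_iff]
    refine Measure.integrableOn_of_bounded (M := |e 0| * M + |e 1| * M) ?_ ?_ ?_
    · simp
    · exact ((measurable_fderiv_apply_const ℝ v e).comp (by fun_prop)).aestronglyMeasurable
    · refine ae_restrict_of_ae ?_
      have : ∀ᵐ r : ℝ, r ∉ {r : ℝ | z + r • e ∈ skel 𝒯} := hcount.ae_notMem volume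
      filter_upwards [this] with r hr
      obtain ⟨h0, h1⟩ := hM _ hr
      rw [fderiv_apply_eq, Real.norm_eq_abs]
      refine (abs_add_le _ _).trans ?_
      rw [abs_mul, abs_mul]
      gcongr
  refine ⟨hint, ?_⟩
  -- Along the line `v` is continuous, and differentiable off the finitely many crossings with the
  -- skeleton; no matching of one-sided derivatives is needed.
  refine integral_eq_of_hasDerivAt_off_countable_of_le (fun r : ℝ => v (z + r • e)) _ hab
    hcount hc (fun r hr => ?_) hint
  have h1 : HasDerivAt (fun r : ℝ => z + r • e) e r := by
    have := ((hasDerivAt_id r).smul_const e).const_add z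
    rwa [one_smul] at this
  exact HasFDerivAt.comp_hasDerivAt (f := fun r : ℝ => z + r • e) r
    (differentiableAt_of_mem_femSpace h𝒯 hv hr.2).hasFDerivAt h1

end Mesh

end

section
open MvPolynomial

/-! ### Existence of outward normals -/

lemma cr_swap (a b z : Plane) : cr b a z = -cr a b z := by simp only [cr]; ring

/-- In graph coordinates, points vertically below a boundary point are exterior. This excludes
slits, where the domain would lie on both sides of its boundary. -/
lemma HasLipschitzBoundary.mem_closure_compl_closure {Ω : Set Plane}
    (hL : HasLipschitzBoundary Ω) (hΩ : IsOpen Ω) {z : Plane} (hz : z ∈ frontier Ω) :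
    z ∈ closure (closure Ω)ᶜ := by
  obtain ⟨e₁, e₂, K, φ, r, he₁, he₂, horth, hφ, hr, hball⟩ := hL z hz
  have hzΩ : z ∉ Ω := by rw [hΩ.frontier_eq] at hz; exact hz.2
  have hφ0 : 0 ≤ φ 0 := by
    have := hball z (Metric.mem_ball_self hr)
    rw [sub_self, inner_zero_left, inner_zero_left] at this
    by_contra! h
    exact hzΩ (this.2 h)
  have hopen : IsOpen {w : Plane | inner ℝ (w - z) e₂ < φ (inner ℝ (w - z) e₁)} :=
    isOpen_lt (by fun_prop) (hφ.continuous.comp (by fun_prop))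
  rw [Metric.mem_closure_iff]
  intro ε hε
  set s := min r ε / 2 with hs
  have hmin : 0 < min r ε := lt_min hr hε
  have hs0 : 0 < s := by positivity
  have hd : dist z (z - s • e₂) = s := by
    rw [dist_eq_norm, sub_sub_cancel, norm_smul, he₂, mul_one, Real.norm_of_nonneg hs0.le]
  have hin2 : inner ℝ (z - s • e₂ - z) e₂ = -s := by
    rw [sub_sub_cancel_left, inner_neg_left, real_inner_smul_left, real_inner_self_eq_norm_sq, he₂]
    ring
  have hin1 : inner ℝ (z - s • e₂ - z) e₁ = 0 := by
    rw [sub_sub_cancel_left, inner_neg_left, real_inner_smul_left, real_inner_comm, horth]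
    simp
  refine ⟨z - s • e₂, ?_, ?_⟩
  · intro hcl
    have hmem : z - s • e₂ ∈ Metric.ball z r ∩
        {w : Plane | inner ℝ (w - z) e₂ < φ (inner ℝ (w - z) e₁)} := by
      refine ⟨?_, ?_⟩
      · rw [Metric.mem_ball, dist_comm, hd]; linarith [min_le_left r ε]
      · rw [Set.mem_ofPred_eq, hin2, hin1]; linarith
    obtain ⟨w, ⟨hw1, hw2⟩, hwΩ⟩ := mem_closure_iff.1 hcl _ (Metric.isOpen_ball.inter hopen) hmem
    rw [hball w hw1] at hwΩ
    exact lt_asymm hwΩ hw2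
  · rw [hd]; linarith [min_le_right r ε]

/-- A connected set that misses the frontier lies on one side. -/
lemma subset_or_subset_compl_closure {Ω S : Set Plane} (hΩ : IsOpen Ω) (hS : IsPreconnected S)
    (hd : ∀ z ∈ S, z ∉ frontier Ω) : S ⊆ Ω ∨ S ⊆ (closure Ω)ᶜ := by
  refine isPreconnected_iff_subset_of_disjoint.1 hS Ω (closure Ω)ᶜ hΩ
    isClosed_closure.isOpen_compl (fun z hz => ?_) ?_
  · have := hd z hz
    rw [hΩ.frontier_eq] at this
    by_cases h : z ∈ Ω
    · exact Or.inl h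
    · exact Or.inr fun hc => this ⟨hc, h⟩
  · rw [Set.eq_empty_iff_forall_notMem]
    rintro z ⟨-, h1, h2⟩
    exact h2 (subset_closure h1)

lemma isOutwardNormal_of_halfDisc {Ω : Set Plane} (hΩ : IsOpen Ω) {a b z : Plane} (hab : a ≠ b)
    (hz : cr a b z = 0) {r : ℝ} (hr : 0 < r)
    (hpos : ∀ w ∈ Metric.ball z r, 0 < cr a b w → w ∈ Ω)
    (hneg : ∀ w ∈ Metric.ball z r, cr a b w < 0 → w ∉ closure Ω) :
    ∃ n, IsOutwardNormal Ω z n := by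
  have hd := dist_pos.2 hab
  refine ⟨!₂[(b 1 - a 1) / dist a b, -((b 0 - a 0) / dist a b)], ?_, r, hr, fun w hw => ?_⟩
  · have hsq : ‖(!₂[(b 1 - a 1) / dist a b, -((b 0 - a 0) / dist a b)] : Plane)‖ ^ 2 = 1 := by
      rw [← real_inner_self_eq_norm_sq, inner_plane]
      simp
      field_simp
      rw [dist_sq_eq]; ring
    have h0 := norm_nonneg (!₂[(b 1 - a 1) / dist a b, -((b 0 - a 0) / dist a b)] : Plane)
    nlinarith
  · have hin : inner ℝ (w - z) !₂[(b 1 - a 1) / dist a b, -((b 0 - a 0) / dist a b)] =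
        -(cr a b w / dist a b) := by
      have : cr a b w = cr a b w - cr a b z := by rw [hz, sub_zero]
      rw [inner_plane, this]
      simp [cr]
      field_simp
      ring
    rw [hin, neg_lt_zero, div_pos_iff_of_pos_right hd]
    constructor
    · intro hwΩ
      by_contra! hle
      rcases hle.lt_or_eq with h | h
      · exact hneg w hw h (subset_closure hwΩ)
      -- A point of the open set `Ω` on the line itself would have neighbours in `Ω` on the exterior
      -- side.
      · obtain ⟨w', ⟨hw1, hw2⟩, hw3⟩ := exists_cr_pos_of_isOpen (hΩ.inter Metric.isOpen_ball)
          hab.symm ⟨hwΩ, hw⟩ (by rw [cr_swap, h, neg_zero])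
        rw [cr_swap] at hw3
        exact hneg w' hw2 (by linarith) (subset_closure hw1)
    · exact hpos w hw

/-- Each open half disc is connected and misses the frontier, so it is inside or outside as a whole.
Both inside contradicts `mem_closure_compl_closure`; both outside contradicts that `z` is in the
closure of `Ω`. -/
lemma exists_isOutwardNormal {Ω : Set Plane} (hΩ : IsOpen Ω) (hL : HasLipschitzBoundary Ω)
    {a b z : Plane} (hab : a ≠ b) (hzf : z ∈ frontier Ω) (hz : cr a b z = 0) {r : ℝ} (hr : 0 < r)
    (hloc : ∀ w ∈ Metric.ball z r, w ∈ frontier Ω → cr a b w = 0) : ∃ n, IsOutwardNormal Ω z n := by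
  have hconv : ∀ a b : Plane, Convex ℝ {w : Plane | 0 < cr a b w} := by
    intro a b x hx y hy s t hs ht hst
    have ht' : t = 1 - s := by linarith
    have : cr a b (s • x + t • y) = s * cr a b x + t * cr a b y := by subst ht'; simp [cr]; ring
    rw [Set.mem_ofPred_eq] at hx hy ⊢
    rw [this]
    rcases hs.eq_or_lt with h | h
    · have : t = 1 := by linarith
      rw [← h, this]; linarith
    · nlinarith [mul_pos h hx, mul_nonneg ht hy.le]
  have hside : ∀ a b : Plane, (∀ w ∈ Metric.ball z r, w ∈ frontier Ω → cr a b w = 0) →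
      (Metric.ball z r ∩ {w : Plane | 0 < cr a b w} ⊆ Ω) ∨
      (Metric.ball z r ∩ {w : Plane | 0 < cr a b w} ⊆ (closure Ω)ᶜ) := fun a b hl =>
    subset_or_subset_compl_closure hΩ (((convex_ball z r).inter (hconv a b)).isPreconnected)
      fun w hw hf => hw.2.ne' (hl w hw.1 hf)
  -- both sides cannot be in the domain, nor both outside
  have hnot : ∀ O : Set Plane, IsOpen O → z ∈ closure O →
      (∃ w ∈ Metric.ball z r ∩ O, 0 < cr a b w) ∨ (∃ w ∈ Metric.ball z r ∩ O, 0 < cr b a w) := by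
    intro O hO hzO
    obtain ⟨w, hw1, hw2⟩ := mem_closure_iff.1 hzO _ Metric.isOpen_ball (Metric.mem_ball_self hr)
    rcases lt_trichotomy (cr a b w) 0 with h | h | h
    · exact Or.inr ⟨w, ⟨hw1, hw2⟩, by rw [cr_swap]; linarith⟩
    · exact Or.inl (exists_cr_pos_of_isOpen (Metric.isOpen_ball.inter hO) hab ⟨hw1, hw2⟩ h)
    · exact Or.inl ⟨w, ⟨hw1, hw2⟩, h⟩
  have hin := hnot Ω hΩ hzf.1
  have hout := hnot _ isClosed_closure.isOpen_compl (hL.mem_closure_compl_closure hΩ hzf)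
  have hloc' : ∀ w ∈ Metric.ball z r, w ∈ frontier Ω → cr b a w = 0 := fun w hw hf => by
    rw [cr_swap, hloc w hw hf, neg_zero]
  rcases hside a b hloc with h1 | h1 <;> rcases hside b a hloc' with h2 | h2
  · exfalso
    rcases hout with ⟨w, ⟨hw1, hw2⟩, hw3⟩ | ⟨w, ⟨hw1, hw2⟩, hw3⟩
    · exact hw2 (subset_closure (h1 ⟨hw1, hw3⟩))
    · exact hw2 (subset_closure (h2 ⟨hw1, hw3⟩))
  · refine isOutwardNormal_of_halfDisc hΩ hab hz hr (fun w hw h => h1 ⟨hw, h⟩) fun w hw h => ?_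
    exact h2 ⟨hw, by rw [Set.mem_ofPred_eq, cr_swap]; linarith⟩
  · refine isOutwardNormal_of_halfDisc hΩ hab.symm (by rw [cr_swap, hz, neg_zero]) hr
      (fun w hw h => h2 ⟨hw, h⟩) fun w hw h => ?_
    exact h1 ⟨hw, by rw [Set.mem_ofPred_eq, cr_swap]; linarith⟩
  · exfalso
    rcases hin with ⟨w, ⟨hw1, hw2⟩, hw3⟩ | ⟨w, ⟨hw1, hw2⟩, hw3⟩
    · exact h1 ⟨hw1, hw3⟩ (subset_closure hw2)
    · exact h2 ⟨hw1, hw3⟩ (subset_closure hw2)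

/-! ### Positivity of the advection term -/

/-- The point of the plane with given coordinates. -/
def pt (x y : ℝ) : Plane := planeEquiv.symm (x, y)

@[simp] lemma pt_zero (x y : ℝ) : pt x y 0 = x := rfl

@[simp] lemma pt_one (x y : ℝ) : pt x y 1 = y := rfl

lemma pt_eq (x y : ℝ) : pt x y = pt x 0 + y • EuclideanSpace.single 1 1 := by
  refine plane_ext ?_ ?_ <;> simp

lemma continuous_pt (x : ℝ) : Continuous (pt x) := by
  have : pt x = fun y : ℝ => pt x 0 + y • (EuclideanSpace.single 1 1 : Plane) := funext (pt_eq x)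
  rw [this]; fun_prop

/-- The exceptional abscissas: vertical edges, and intersections of lines through edges. -/
def badAbscissas (𝒯 : Finset (Affine.Triangle ℝ Plane)) : Set ℝ :=
  (⋃ T ∈ 𝒯, ⋃ i : Fin 3, {x | T.points (i + 1) 0 = T.points i 0 ∧
    ∃ y, cr (T.points i) (T.points (i + 1)) (pt x y) = 0}) ∪
  ⋃ T ∈ 𝒯, ⋃ i : Fin 3, ⋃ T' ∈ 𝒯, ⋃ j : Fin 3,
    {x | (T.points (i + 1) 0 - T.points i 0) * (T'.points (j + 1) 1 - T'.points j 1) ≠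
        (T.points (i + 1) 1 - T.points i 1) * (T'.points (j + 1) 0 - T'.points j 0) ∧
      ∃ y, cr (T.points i) (T.points (i + 1)) (pt x y) = 0 ∧
        cr (T'.points j) (T'.points (j + 1)) (pt x y) = 0}

lemma countable_badAbscissas (𝒯 : Finset (Affine.Triangle ℝ Plane)) :
    (badAbscissas 𝒯).Countable := by
  refine Set.Countable.union ?_ ?_
  · refine 𝒯.countable_toSet.biUnion fun T _ => Set.countable_iUnion fun i => ?_
    refine Set.Subsingleton.countable ?_
    rintro x ⟨h, y, hx⟩ x' ⟨-, y', hx'⟩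
    have hne : T.points (i + 1) 1 - T.points i 1 ≠ 0 := fun h1 =>
      points_ne T i (plane_ext h.symm (by linarith))
    simp only [cr, pt_zero, pt_one, h, sub_self, zero_mul, zero_sub, neg_eq_zero] at hx hx'
    have a1 := (mul_eq_zero.1 hx).resolve_left hne
    have a2 := (mul_eq_zero.1 hx').resolve_left hne
    linarith
  · refine 𝒯.countable_toSet.biUnion fun T _ => Set.countable_iUnion fun i =>
      𝒯.countable_toSet.biUnion fun T' _ => Set.countable_iUnion fun j => ?_
    refine Set.Subsingleton.countable ?_
    rintro x ⟨h, y, h1, h2⟩ x' ⟨-, y', h1', h2'⟩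
    simp only [cr, pt_zero, pt_one] at h1 h2 h1' h2'
    set u0 := T.points (i + 1) 0 - T.points i 0
    set u1 := T.points (i + 1) 1 - T.points i 1
    set w0 := T'.points (j + 1) 0 - T'.points j 0
    set w1 := T'.points (j + 1) 1 - T'.points j 1
    have : (u0 * w1 - u1 * w0) * (x - x') = 0 := by
      linear_combination w0 * (h1 - h1') - u0 * (h2 - h2')
    rcases mul_eq_zero.1 this with h' | h'
    · exact absurd (sub_eq_zero.1 h') h
    · linarith

/-- An inequality between increments and integrals that holds off a finite set holds everywhere. -/
lemma increment_le_of_finite {f g : ℝ → ℝ} {c : ℝ} {F : Set ℝ} (hF : F.Finite)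
    (hg : ∀ a b, IntervalIntegrable g volume a b)
    (h : ∀ a b, a < b → Disjoint (Set.Ioo a b) F → c * (f b - f a) ≤ c * ∫ y in a..b, g y)
    (a b : ℝ) (hab : a < b) : c * (f b - f a) ≤ c * ∫ y in a..b, g y := by
  -- Induction on the number of exceptional points inside the interval; splitting at one of them
  -- lowers the count on both sides.
  induction hn : (F ∩ Set.Ioo a b).ncard using Nat.strong_induction_on generalizing a b with
  | _ n ih =>
    by_cases hd : Disjoint (Set.Ioo a b) F
    · exact h a b hab hd
    · obtain ⟨m, hm, hmF⟩ := Set.not_disjoint_iff.1 hd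
      have hfin : (F ∩ Set.Ioo a b).Finite := hF.inter_of_left _
      have h1 := ih _ (by
        rw [← hn]
        refine Set.ncard_lt_ncard ⟨?_, fun hsub => ?_⟩ hfin
        · exact Set.inter_subset_inter_right _ (Set.Ioo_subset_Ioo_right hm.2.le)
        · exact lt_irrefl m (hsub ⟨hmF, hm⟩).2.2) a m hm.1 rfl
      have h2 := ih _ (by
        rw [← hn]
        refine Set.ncard_lt_ncard ⟨?_, fun hsub => ?_⟩ hfin
        · exact Set.inter_subset_inter_right _ (Set.Ioo_subset_Ioo_left hm.1.le)
        · exact lt_irrefl m (hsub ⟨hmF, hm⟩).2.1) m b hm.2 rfl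
      rw [← intervalIntegral.integral_add_adjacent_intervals (hg a m) (hg m b)]
      linarith

section Slices

variable {Ω : Set Plane} {𝒯 : Finset (Affine.Triangle ℝ Plane)} {p : ℕ} {w : Plane → ℝ}

lemma slice_line_ne {x : ℝ} (hx : x ∉ badAbscissas 𝒯) : ∀ T ∈ 𝒯, ∀ i : Fin 3, ∃ r : ℝ,
    cr (T.points i) (T.points (i + 1)) (pt x 0 + r • EuclideanSpace.single 1 1) ≠ 0 := by
  intro T hT' i
  by_contra! h
  simp only [← pt_eq] at h
  refine hx (Or.inl (Set.mem_iUnion₂.2 ⟨T, hT', Set.mem_iUnion.2 ⟨i, ?_, 0, h 0⟩⟩))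
  have h0 := h 0
  have h1 := h 1
  simp only [cr, pt_zero, pt_one] at h0 h1
  linarith

/-- At a good abscissa all edge lines through the point are parallel, hence equal. Nearby, the
skeleton is therefore a single line, and it contains the frontier. -/
lemma exists_normal_of_slice (h𝒯 : IsTriangulation Ω 𝒯) (hΩ : IsOpen Ω)
    (hL : HasLipschitzBoundary Ω) {x y : ℝ} (hx : x ∉ badAbscissas 𝒯) (hy : pt x y ∈ frontier Ω) :
    ∃ n, IsOutwardNormal Ω (pt x y) n := by
  obtain ⟨T, hT', i, hi⟩ := mem_skel.1 (h𝒯.frontier_subset_skel hΩ hy)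
  -- near the point, the skeleton is a single line
  have hK : IsClosed (⋃ T' ∈ 𝒯, ⋃ j ∈ {j : Fin 3 | cr (T'.points j) (T'.points (j + 1)) (pt x y) ≠ 0},
      {z | cr (T'.points j) (T'.points (j + 1)) z = 0}) := by
    refine 𝒯.finite_toSet.isClosed_biUnion fun T' _ =>
      (Set.toFinite _).isClosed_biUnion fun j _ => ?_
    exact isClosed_eq (continuous_cr continuous_const continuous_const continuous_id)
      continuous_const
  have hnot : pt x y ∈ (⋃ T' ∈ 𝒯,
      ⋃ j ∈ {j : Fin 3 | cr (T'.points j) (T'.points (j + 1)) (pt x y) ≠ 0},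
      {z | cr (T'.points j) (T'.points (j + 1)) z = 0})ᶜ := by
    intro h
    obtain ⟨T', -, h⟩ := Set.mem_iUnion₂.1 h
    obtain ⟨j, hj, h⟩ := Set.mem_iUnion₂.1 h
    exact hj h
  obtain ⟨r, hr, hball⟩ := Metric.mem_nhds_iff.1 (hK.isOpen_compl.mem_nhds hnot)
  refine exists_isOutwardNormal hΩ hL (points_ne T i) hy hi hr fun z hz hzf => ?_
  obtain ⟨T', hT'', j, hj⟩ := mem_skel.1 (h𝒯.frontier_subset_skel hΩ hzf)
  have hj' : cr (T'.points j) (T'.points (j + 1)) (pt x y) = 0 := by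
    by_contra hne
    exact hball hz (Set.mem_iUnion₂.2 ⟨T', hT'', Set.mem_iUnion₂.2 ⟨j, hne, hj⟩⟩)
  have hpar : (T.points (i + 1) 0 - T.points i 0) * (T'.points (j + 1) 1 - T'.points j 1) =
      (T.points (i + 1) 1 - T.points i 1) * (T'.points (j + 1) 0 - T'.points j 0) := by
    by_contra hne
    refine hx (Or.inr (Set.mem_iUnion₂.2 ⟨T, hT', Set.mem_iUnion.2 ⟨i,
      Set.mem_iUnion₂.2 ⟨T', hT'', Set.mem_iUnion.2 ⟨j, hne, y, hi, hj'⟩⟩⟩⟩))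
  have hv : T'.points (j + 1) 0 - T'.points j 0 ≠ 0 := fun h => hx (Or.inl
    (Set.mem_iUnion₂.2 ⟨T', hT'', Set.mem_iUnion.2 ⟨j, by linarith, y, hj'⟩⟩))
  simp only [cr, pt_zero, pt_one] at hi hj hj' ⊢
  refine mul_left_cancel₀ hv ?_
  set u0 := T.points (i + 1) 0 - T.points i 0
  set u1 := T.points (i + 1) 1 - T.points i 1
  set w0 := T'.points (j + 1) 0 - T'.points j 0
  set w1 := T'.points (j + 1) 1 - T'.points j 1
  linear_combination u0 * (hj - hj') + w0 * hi + (z 0 - x) * hpar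

lemma finite_slice_skel {x : ℝ} (hx : x ∉ badAbscissas 𝒯) : {y | pt x y ∈ skel 𝒯}.Finite := by
  have := countable_line_skel (slice_line_ne hx)
  simpa only [← pt_eq] using this

/-- Non-negativity of the advection term on a generic vertical slice. -/
lemma slice_nonneg (hΩ : IsOpen Ω) (hb : Bornology.IsBounded Ω) (hL : HasLipschitzBoundary Ω)
    (hbdry : ∀ z n, IsOutwardNormal Ω z n → n 0 ≠ 0 → 0 ≤ z 0 * n 1)
    (h𝒯 : IsTriangulation Ω 𝒯) (hw : w ∈ femSpace Ω 𝒯 p) (hw0 : ∀ z, 0 ≤ w z)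
    {x : ℝ} (hx : x ∉ badAbscissas 𝒯) :
    0 ≤ x * ∫ y, Ω.indicator (dy w) (pt x y) := by
  set f : ℝ → ℝ := fun y => Ω.indicator w (pt x y) with hf
  set g : ℝ → ℝ := fun y => Ω.indicator (dy w) (pt x y) with hg
  have hmeas : Measurable (pt x) := (continuous_pt x).measurable
  have hFfin := finite_slice_skel hx
  obtain ⟨M, hM0, hM⟩ := exists_bound_gradient h𝒯 hw
  have hgint : ∀ a b, IntervalIntegrable g volume a b := by
    intro a b
    rw [intervalIntegrable_iff]
    refine Measure.integrableOn_of_bounded (M := M) (by simp) ?_ (ae_restrict_of_ae ?_)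
    · exact (((measurable_dy w).indicator hΩ.measurableSet).comp hmeas).aestronglyMeasurable
    · filter_upwards [hFfin.countable.ae_notMem volume] with y hy
      rw [Real.norm_eq_abs, hg]
      by_cases h : pt x y ∈ Ω
      · simp only [Set.indicator_of_mem h]; exact (hM _ hy).2
      · simp only [Set.indicator_of_notMem h, abs_zero]; exact hM0
  -- vanishing at the inflow ends of the slice
  have hend : ∀ y s : ℝ, pt x y ∈ frontier Ω → x * s < 0 →
      (∃ᶠ ε in 𝓝[>] (0 : ℝ), pt x (y - ε * s) ∈ Ω) → w (pt x y) = 0 := by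
    intro y s hy hs hfreq
    obtain ⟨n, hn⟩ := exists_normal_of_slice h𝒯 hΩ hL hx hy
    obtain ⟨hn1, r, hr, hball⟩ := id hn
    have hev : ∀ᶠ ε in 𝓝[>] (0 : ℝ), 0 < ε ∧ pt x (y - ε * s) ∈ Metric.ball (pt x y) r := by
      refine (eventually_mem_nhdsWithin).and (Filter.Eventually.filter_mono nhdsWithin_le_nhds ?_)
      have hc : ContinuousAt (fun ε : ℝ => pt x (y - ε * s)) 0 :=
        ((continuous_pt x).comp (by fun_prop)).continuousAt
      exact hc.preimage_mem_nhds (by simpa using Metric.ball_mem_nhds _ hr)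
    obtain ⟨ε, hεΩ, hε0, hεb⟩ := (hfreq.and_eventually hev).exists
    rw [hball _ hεb, inner_plane] at hεΩ
    simp at hεΩ
    -- Here `s = 1` marks the upper end of a piece and `s = -1` the lower one. Points of `Ω` just
    -- before the end force `s n₂ > 0`; with `x s < 0` this gives `x n₂ < 0`, which `hbdry` permits
    -- only if `n₁ = 0`.
    have hsn : 0 < s * n 1 := by
      by_contra! hle
      nlinarith
    have hxn : x * n 1 < 0 := by
      by_contra! hle
      have h1 : 0 ≤ (x * n 1) * (s * n 1) := mul_nonneg hle hsn.le
      have h2 : (x * n 1) * (s * n 1) = (x * s) * n 1 ^ 2 := by ring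
      have h3 : n 1 ≠ 0 := fun h => by rw [h, mul_zero] at hsn; exact hsn.false
      have : 0 < n 1 ^ 2 := by positivity
      nlinarith
    refine hw.2.2.2 _ ⟨n, hn, ?_, hxn⟩
    by_contra hne
    exact absurd (hbdry _ n hn hne) (not_le.2 hxn)
  have hbase : ∀ a b, a < b → Disjoint (Set.Ioo a b) {y | pt x y ∈ skel 𝒯} →
      x * (f b - f a) ≤ x * ∫ y in a..b, g y := by
    intro a b hab hdisj
    have hpre : IsPreconnected (pt x '' Set.Ioo a b) :=
      isPreconnected_Ioo.image _ (continuous_pt x).continuousOn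
    rcases subset_or_subset_compl_closure hΩ hpre (by
      rintro _ ⟨y, hy, rfl⟩ hfr
      exact Set.disjoint_left.1 hdisj hy (h𝒯.frontier_subset_skel hΩ hfr)) with hin | hout
    · have hcl : ∀ y ∈ Set.Icc a b, pt x y ∈ closure Ω := by
        intro y hy
        rw [← closure_Ioo hab.ne] at hy
        exact closure_mono hin (image_closure_subset_closure_image (continuous_pt x) ⟨y, hy, rfl⟩)
      have hft := (integral_fderiv_line h𝒯 hw (z := pt x 0) (e := EuclideanSpace.single 1 1) hab.le
        (by
          simp only [← pt_eq]
          exact hw.1.comp (continuous_pt x).continuousOn hcl) (slice_line_ne hx)).2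
      simp only [← pt_eq] at hft
      have hgi : ∫ y in a..b, g y = w (pt x b) - w (pt x a) := by
        rw [← hft, intervalIntegral.integral_of_le hab.le, intervalIntegral.integral_of_le hab.le,
          integral_Ioc_eq_integral_Ioo, integral_Ioc_eq_integral_Ioo]
        refine setIntegral_congr_fun measurableSet_Ioo fun y hy => ?_
        rw [hg]
        simp only [Set.indicator_of_mem (hin ⟨y, hy, rfl⟩)]
        rfl
      rw [hgi]
      -- The function `f` is zero off `Ω`, so it may jump at an end. Where the sign of `x` makes the
      -- jump unfavourable, the end is an inflow point and `w` vanishes there.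
      have hbb : x * f b ≤ x * w (pt x b) := by
        by_cases h : pt x b ∈ Ω
        · rw [hf]; simp only [Set.indicator_of_mem h]; exact le_rfl
        · have hfb : f b = 0 := by rw [hf]; simp only [Set.indicator_of_notMem h]
          rw [hfb, mul_zero]
          rcases lt_or_ge x 0 with hx0 | hx0
          · rw [hend b 1 (by rw [hΩ.frontier_eq]; exact ⟨hcl b (Set.right_mem_Icc.2 hab.le), h⟩)
              (by linarith) ?_, mul_zero]
            refine Filter.Eventually.frequently ?_
            filter_upwards [Ioo_mem_nhdsGT (sub_pos.2 hab)] with ε hε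
            exact hin ⟨_, ⟨by linarith [hε.2], by linarith [hε.1]⟩, rfl⟩
          · exact mul_nonneg hx0 (hw0 _)
      have haa : x * w (pt x a) ≤ x * f a := by
        by_cases h : pt x a ∈ Ω
        · rw [hf]; simp only [Set.indicator_of_mem h]; exact le_rfl
        · have hfa : f a = 0 := by rw [hf]; simp only [Set.indicator_of_notMem h]
          rw [hfa, mul_zero]
          rcases lt_or_ge 0 x with hx0 | hx0
          · rw [hend a (-1) (by rw [hΩ.frontier_eq]; exact ⟨hcl a (Set.left_mem_Icc.2 hab.le), h⟩)
              (by linarith) ?_, mul_zero]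
            refine Filter.Eventually.frequently ?_
            filter_upwards [Ioo_mem_nhdsGT (sub_pos.2 hab)] with ε hε
            exact hin ⟨_, ⟨by linarith [hε.1], by linarith [hε.2]⟩, rfl⟩
          · exact mul_nonpos_of_nonpos_of_nonneg hx0 (hw0 _)
      linarith
    · -- outside the domain everything vanishes
      have hnot : ∀ y ∈ Set.Icc a b, pt x y ∉ Ω := by
        intro y hy hyΩ
        have hn : pt x ⁻¹' Ω ∈ 𝓝 y := (continuous_pt x).continuousAt.preimage_mem_nhds
          (hΩ.mem_nhds hyΩ)
        rw [← closure_Ioo hab.ne] at hy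
        obtain ⟨y', hy', hy''⟩ := mem_closure_iff_nhds.1 hy _ hn
        exact hout ⟨y', hy'', rfl⟩ (subset_closure hy')
      have hfa : f a = 0 := Set.indicator_of_notMem (hnot a (Set.left_mem_Icc.2 hab.le)) _
      have hfb : f b = 0 := Set.indicator_of_notMem (hnot b (Set.right_mem_Icc.2 hab.le)) _
      have hgi : ∫ y in a..b, g y = 0 := by
        refine (intervalIntegral.integral_congr (g := fun _ => (0 : ℝ)) fun y hy => ?_).trans (by simp)
        rw [Set.uIcc_of_le hab.le] at hy
        exact Set.indicator_of_notMem (hnot y hy) _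
      rw [hfa, hfb, hgi]; simp
  obtain ⟨R, hR⟩ := hb.exists_norm_le
  have hsupp : ∀ y, R < |y| → pt x y ∉ Ω := by
    intro y hy hyΩ
    have := (abs_apply_le_norm (pt x y) 1).trans (hR _ hyΩ)
    rw [pt_one] at this
    linarith
  have hR1 : R < |R| + 1 := by linarith [le_abs_self R]
  have habs : |(|R| + 1)| = |R| + 1 := abs_of_pos (by positivity)
  -- On an interval reaching beyond the bounded domain both end values of `f` vanish, and only the
  -- sign of the integral is left.
  have htot := increment_le_of_finite hFfin hgint hbase (-(|R| + 1)) (|R| + 1)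
    (by linarith [abs_nonneg R])
  have hfa : f (-(|R| + 1)) = 0 := Set.indicator_of_notMem
    (hsupp _ (by rw [abs_neg, habs]; exact hR1)) _
  have hfb : f (|R| + 1) = 0 := Set.indicator_of_notMem (hsupp _ (by rw [habs]; exact hR1)) _
  rw [hfa, hfb, sub_self, mul_zero, intervalIntegral.integral_eq_integral_of_support_subset] at htot
  · exact htot
  · intro y hy
    have hyΩ : pt x y ∈ Ω := by
      by_contra h
      exact hy (Set.indicator_of_notMem h _)
    by_contra hcon
    refine hsupp y ?_ hyΩ
    by_contra! hle
    refine hcon ⟨?_, ?_⟩ <;> linarith [neg_abs_le y, le_abs_self y, le_abs_self R]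

/-- Fubini over vertical slices, where the countably many bad abscissas are negligible. -/
lemma integral_x_dy_nonneg (hΩ : IsOpen Ω) (hb : Bornology.IsBounded Ω)
    (hL : HasLipschitzBoundary Ω)
    (hbdry : ∀ z n, IsOutwardNormal Ω z n → n 0 ≠ 0 → 0 ≤ z 0 * n 1)
    (h𝒯 : IsTriangulation Ω 𝒯) (hw : w ∈ femSpace Ω 𝒯 p) (hw0 : ∀ z, 0 ≤ w z) :
    0 ≤ ∫ z in Ω, z 0 * dy w z := by
  set G : Plane → ℝ := Ω.indicator fun z => z 0 * dy w z with hG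
  obtain ⟨M, hM0, hM⟩ := exists_bound_gradient h𝒯 hw
  obtain ⟨R, hR⟩ := hb.exists_norm_le
  have hx0 : Measurable fun z : Plane => z 0 :=
    ((EuclideanSpace.proj 0 : Plane →L[ℝ] ℝ).continuous).measurable
  have hGint : Integrable G := by
    rw [hG, integrable_indicator_iff hΩ.measurableSet]
    refine Measure.integrableOn_of_bounded (M := R * M) hb.measure_lt_top.ne
      (hx0.mul (measurable_dy w)).aestronglyMeasurable ?_
    have hsk : ∀ᵐ z : Plane, z ∉ skel 𝒯 := measure_eq_zero_iff_ae_notMem.1 (volume_skel_eq_zero 𝒯)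
    filter_upwards [ae_restrict_mem hΩ.measurableSet, ae_restrict_of_ae hsk] with z hz hzs
    rw [Real.norm_eq_abs, abs_mul]
    have h0 := (abs_apply_le_norm z 0).trans (hR z hz)
    exact mul_le_mul h0 (hM z hzs).2 (abs_nonneg _) ((abs_nonneg _).trans h0)
  rw [← integral_indicator hΩ.measurableSet, ← hG,
    ← measurePreserving_planeEquiv.symm.integral_comp planeEquiv.symm.measurableEmbedding,
    Measure.volume_eq_prod, integral_prod]
  · refine integral_nonneg_of_ae ?_
    filter_upwards [(countable_badAbscissas 𝒯).ae_notMem volume] with x hx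
    have := slice_nonneg hΩ hb hL hbdry h𝒯 hw hw0 hx
    rw [← integral_const_mul] at this
    refine this.trans (le_of_eq ?_)
    refine integral_congr_ae (Eventually.of_forall fun y => ?_)
    show x * Ω.indicator (dy w) (pt x y) = Ω.indicator (fun z => z 0 * dy w z) (pt x y)
    by_cases h : pt x y ∈ Ω
    · rw [Set.indicator_of_mem h, Set.indicator_of_mem h, pt_zero]
    · rw [Set.indicator_of_notMem h, Set.indicator_of_notMem h, mul_zero]
  · rw [← Measure.volume_eq_prod]
    exact (measurePreserving_planeEquiv.symm.integrable_comp_emb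
      planeEquiv.symm.measurableEmbedding).2 hGint

end Slices

end

section
open MvPolynomial

/-! ### A Friedrichs inequality for functions vanishing on the inflow boundary -/

section Friedrichs

variable {Ω : Set Plane} {𝒯 : Finset (Affine.Triangle ℝ Plane)} {p : ℕ} {v : Plane → ℝ}

/-- The Dirichlet energy. -/
def dirichlet (Ω : Set Plane) (v : Plane → ℝ) : ℝ := ∫ z in Ω, (dx v z ^ 2 + dy v z ^ 2)

/-- The `L₂(E)` norm of finite element functions is controlled by the Dirichlet energy. -/
def EnergyControlled (Ω E : Set Plane) : Prop :=
  ∃ C, 0 ≤ C ∧ ∀ (𝒯 : Finset (Affine.Triangle ℝ Plane)) (p : ℕ), IsTriangulation Ω 𝒯 →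
    ∀ v ∈ femSpace Ω 𝒯 p, ∫ z in E, v z ^ 2 ≤ C * dirichlet Ω v

lemma integrable_sq_of_mem_femSpace (hb : Bornology.IsBounded Ω) (hv : v ∈ femSpace Ω 𝒯 p) :
    Integrable fun z => v z ^ 2 := by
  obtain ⟨M, hM0, hM⟩ := exists_bound_of_mem_femSpace hb hv
  have hon : IntegrableOn (fun z => v z ^ 2) (closure Ω) := by
    refine Measure.integrableOn_of_bounded (M := M ^ 2) hb.closure.measure_lt_top.ne
      ((measurable_of_mem_femSpace hv).pow_const 2).aestronglyMeasurable
      (Eventually.of_forall fun z => ?_)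
    rw [Real.norm_eq_abs, abs_pow]
    gcongr
    exact hM z
  refine (integrableOn_iff_integrable_of_support_subset fun z hz => ?_).1 hon
  by_contra h
  exact hz (by simp [hv.2.1 z h])

/-- The squared gradient, made zero on the skeleton. -/
def gradSq (𝒯 : Finset (Affine.Triangle ℝ Plane)) (v : Plane → ℝ) : Plane → ℝ :=
  (skel 𝒯)ᶜ.indicator fun z => dx v z ^ 2 + dy v z ^ 2

lemma isClosed_skel (𝒯 : Finset (Affine.Triangle ℝ Plane)) : IsClosed (skel 𝒯) := by
  refine 𝒯.finite_toSet.isClosed_biUnion fun T' _ => isClosed_iUnion_of_finite fun j => ?_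
  exact isClosed_eq (continuous_cr continuous_const continuous_const continuous_id) continuous_const

lemma measurable_gradSq (𝒯 : Finset (Affine.Triangle ℝ Plane)) (v : Plane → ℝ) :
    Measurable (gradSq 𝒯 v) :=
  (((measurable_dx v).pow_const 2).add ((measurable_dy v).pow_const 2)).indicator
    (isClosed_skel 𝒯).measurableSet.compl

lemma gradSq_nonneg (𝒯 : Finset (Affine.Triangle ℝ Plane)) (v : Plane → ℝ) (z : Plane) :
    0 ≤ gradSq 𝒯 v z := Set.indicator_nonneg (fun _ _ => by positivity) z

lemma exists_bound_gradSq (h𝒯 : IsTriangulation Ω 𝒯) (hv : v ∈ femSpace Ω 𝒯 p) :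
    ∃ M, 0 ≤ M ∧ ∀ z, gradSq 𝒯 v z ≤ M := by
  obtain ⟨M, hM0, hM⟩ := exists_bound_gradient h𝒯 hv
  refine ⟨M ^ 2 + M ^ 2, by positivity, fun z => ?_⟩
  by_cases hz : z ∈ skel 𝒯
  · rw [gradSq, Set.indicator_of_notMem (by simpa using hz)]; positivity
  · rw [gradSq, Set.indicator_of_mem (by simpa using hz), ← sq_abs (dx v z), ← sq_abs (dy v z)]
    have := hM z hz
    gcongr
    · exact this.1
    · exact this.2

lemma ae_notMem_skel (𝒯 : Finset (Affine.Triangle ℝ Plane)) : ∀ᵐ z : Plane, z ∉ skel 𝒯 :=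
  measure_eq_zero_iff_ae_notMem.1 (volume_skel_eq_zero 𝒯)

lemma integral_gradSq (h𝒯 : IsTriangulation Ω 𝒯) (hΩ : IsOpen Ω) (hb : Bornology.IsBounded Ω)
    (hv : v ∈ femSpace Ω 𝒯 p) :
    Integrable (gradSq 𝒯 v) ∧ ∫ z, gradSq 𝒯 v z = dirichlet Ω v := by
  obtain ⟨M, hM0, hM⟩ := exists_bound_gradSq h𝒯 hv
  have hon : IntegrableOn (gradSq 𝒯 v) Ω := by
    refine Measure.integrableOn_of_bounded (M := M) hb.measure_lt_top.ne
      (measurable_gradSq 𝒯 v).aestronglyMeasurable (Eventually.of_forall fun z => ?_)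
    rw [Real.norm_eq_abs, abs_of_nonneg (gradSq_nonneg _ _ _)]
    exact hM z
  have hsupp : Function.support (gradSq 𝒯 v) ⊆ Ω := by
    intro z hz
    by_contra h
    have hzs : z ∉ skel 𝒯 := fun hs => hz (Set.indicator_of_notMem (by simpa using hs) _)
    rcases h𝒯.cases_of_notMem_skel hzs with ⟨T, hT', hzT⟩ | hc
    · exact h (h𝒯.subset T hT' hzT)
    · refine hz ?_
      rw [gradSq, Set.indicator_of_mem (by simpa using hzs)]
      simp [dx_dy_eq_zero_of_notMem_closure hv hc]
  refine ⟨(integrableOn_iff_integrable_of_support_subset hsupp).1 hon, ?_⟩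
  rw [← setIntegral_eq_integral_of_forall_compl_eq_zero (s := Ω) fun z hz => by
    by_contra h; exact hz (hsupp h)]
  refine setIntegral_congr_ae hΩ.measurableSet ?_
  filter_upwards [ae_notMem_skel 𝒯] with z hz _
  rw [gradSq, Set.indicator_of_mem (by simpa using hz)]

/-- The variance of `h` on the unit interval is non-negative. -/
lemma sq_integral_le {h : ℝ → ℝ} {M : ℝ} (hm : Measurable h) (hM : ∀ r, |h r| ≤ M) :
    (∫ r in (0 : ℝ)..1, h r) ^ 2 ≤ ∫ r in (0 : ℝ)..1, h r ^ 2 := by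
  have hint : ∀ g : ℝ → ℝ, Measurable g → (∃ K, ∀ r, |g r| ≤ K) →
      IntervalIntegrable g volume 0 1 := by
    rintro g hg ⟨K, hK⟩
    rw [intervalIntegrable_iff]
    exact Measure.integrableOn_of_bounded (M := K) (by simp) hg.aestronglyMeasurable
      (Eventually.of_forall hK)
  have h1 := hint h hm ⟨M, hM⟩
  have h2 := hint (fun r => h r ^ 2) (hm.pow_const 2) ⟨M ^ 2, fun r => by
    rw [abs_pow]; have := hM r; gcongr⟩
  set I := ∫ r in (0 : ℝ)..1, h r with hI
  have h0 : 0 ≤ ∫ r in (0 : ℝ)..1, (h r - I) ^ 2 :=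
    intervalIntegral.integral_nonneg zero_le_one fun r _ => sq_nonneg _
  have e : ∀ r, (h r - I) ^ 2 = h r ^ 2 - 2 * I * h r + I ^ 2 := fun r => by ring
  simp only [e] at h0
  rw [intervalIntegral.integral_add (h2.sub (h1.const_mul _)) (by simp),
    intervalIntegral.integral_sub h2 (h1.const_mul _), intervalIntegral.integral_const_mul,
    ← hI] at h0
  simp at h0
  nlinarith

/-- Control along a translation by a vector `e`. -/
lemma sq_le_translate (h𝒯 : IsTriangulation Ω 𝒯) (hv : v ∈ femSpace Ω 𝒯 p) {z e : Plane}
    (hz : z ∉ skel 𝒯) (hc : ContinuousOn (fun r : ℝ => v (z + r • e)) (Set.Icc 0 1)) :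
    v z ^ 2 ≤ 2 * v (z + e) ^ 2 +
      2 * ‖e‖ ^ 2 * ∫ r in (0 : ℝ)..1, gradSq 𝒯 v (z + r • e) := by
  -- As `z` is off the skeleton, no line through `z` is contained in an edge line.
  have hline : ∀ T ∈ 𝒯, ∀ i : Fin 3, ∃ r : ℝ, cr (T.points i) (T.points (i + 1)) (z + r • e) ≠ 0 :=
    fun T hT' i => ⟨0, fun h => hz (mem_skel.2 ⟨T, hT', i, by simpa using h⟩)⟩
  have hft := (integral_fderiv_line h𝒯 hv zero_le_one hc hline).2
  obtain ⟨M, hM0, hM⟩ := exists_bound_gradSq h𝒯 hv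
  set h : ℝ → ℝ := fun r => (skel 𝒯)ᶜ.indicator (fun w => fderiv ℝ v w e) (z + r • e) with hh
  have hmeas : Measurable h :=
    ((measurable_fderiv_apply_const ℝ v e).indicator (isClosed_skel 𝒯).measurableSet.compl).comp
      (by fun_prop)
  have hsq : ∀ r, h r ^ 2 ≤ ‖e‖ ^ 2 * gradSq 𝒯 v (z + r • e) := by
    intro r
    by_cases hs : z + r • e ∈ skel 𝒯
    · rw [hh]
      simp only [Set.indicator_of_notMem (show z + r • e ∉ (skel 𝒯)ᶜ by simpa using hs), gradSq]
      simp
    · rw [hh]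
      simp only [Set.indicator_of_mem (show z + r • e ∈ (skel 𝒯)ᶜ by simpa using hs), gradSq]
      rw [fderiv_apply_eq, ← real_inner_self_eq_norm_sq, inner_plane]
      nlinarith [sq_nonneg (e 0 * dy v (z + r • e) - e 1 * dx v (z + r • e))]
  have habs : ∀ r, |h r| ≤ ‖e‖ * √M := by
    intro r
    refine abs_le_of_sq_le_sq ?_ (by positivity)
    rw [mul_pow, Real.sq_sqrt hM0]
    exact (hsq r).trans (by gcongr; exact hM _)
  have heq : ∫ r in (0 : ℝ)..1, fderiv ℝ v (z + r • e) e = ∫ r in (0 : ℝ)..1, h r := by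
    refine intervalIntegral.integral_congr_ae ?_
    filter_upwards [(countable_line_skel hline).countable.ae_notMem volume] with r hr _
    rw [hh]
    simp only [Set.indicator_of_mem (show z + r • e ∈ (skel 𝒯)ᶜ by simpa using hr)]
  have hjen := sq_integral_le hmeas habs
  have hle : ∫ r in (0 : ℝ)..1, h r ^ 2 ≤
      ‖e‖ ^ 2 * ∫ r in (0 : ℝ)..1, gradSq 𝒯 v (z + r • e) := by
    rw [← intervalIntegral.integral_const_mul]
    refine intervalIntegral.integral_mono_on zero_le_one ?_ ?_ fun r _ => hsq r
    · rw [intervalIntegrable_iff]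
      refine Measure.integrableOn_of_bounded (M := (‖e‖ * √M) ^ 2) (by simp)
        (hmeas.pow_const 2).aestronglyMeasurable (Eventually.of_forall fun r => ?_)
      rw [Real.norm_eq_abs, abs_pow]
      have := habs r
      gcongr
    · refine IntervalIntegrable.const_mul ?_ _
      rw [intervalIntegrable_iff]
      refine Measure.integrableOn_of_bounded (M := M) (by simp)
        ((measurable_gradSq 𝒯 v).comp (by fun_prop)).aestronglyMeasurable
        (Eventually.of_forall fun r => ?_)
      rw [Real.norm_eq_abs, abs_of_nonneg (gradSq_nonneg _ _ _)]
      exact hM _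
  rw [heq] at hft
  simp only [one_smul, zero_smul, add_zero] at hft
  set I := ∫ r in (0 : ℝ)..1, h r
  have : v z = v (z + e) - I := by linarith
  rw [this]
  nlinarith [sq_nonneg (v (z + e) + I)]

/-- Integrate `sq_le_translate` over `E` and exchange the integrals: for each `r`, the translated
squared gradient has total integral equal to the Dirichlet energy. The segments have to stay in a
set `O` where `v` is continuous, which may reach outside `Ω`. -/
lemma EnergyControlled.translate (hΩ : IsOpen Ω) (hb : Bornology.IsBounded Ω) {E E' O : Set Plane}
    (hE' : EnergyControlled Ω E') (hEm : MeasurableSet E) (hEb : Bornology.IsBounded E)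
    (hE'm : MeasurableSet E') {e : Plane}
    (hO : ∀ (𝒯 : Finset (Affine.Triangle ℝ Plane)) (p : ℕ), ∀ v ∈ femSpace Ω 𝒯 p, ContinuousOn v O)
    (hseg : ∀ z ∈ E, ∀ r ∈ Set.Icc (0 : ℝ) 1, z + r • e ∈ O) (hmaps : ∀ z ∈ E, z + e ∈ E') :
    EnergyControlled Ω E := by
  obtain ⟨C, hC0, hC⟩ := hE'
  refine ⟨2 * C + 2 * ‖e‖ ^ 2, by positivity, fun 𝒯 p h𝒯 v hv => ?_⟩
  obtain ⟨M, hM0, hM⟩ := exists_bound_gradSq h𝒯 hv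
  obtain ⟨hGi, hG⟩ := integral_gradSq h𝒯 hΩ hb hv
  have hvi := integrable_sq_of_mem_femSpace hb hv
  have hvie : Integrable fun z => v (z + e) ^ 2 := hvi.comp_add_right e
  have hprod : Integrable (Function.uncurry fun (z : Plane) (r : ℝ) => gradSq 𝒯 v (z + r • e))
      ((volume.restrict E).prod (volume.restrict (Set.Ioc 0 1))) := by
    have : IsFiniteMeasure (volume.restrict E) := ⟨by simpa using hEb.measure_lt_top⟩
    refine Integrable.of_bound (C := M) ?_ (Eventually.of_forall fun q => ?_)
    · refine ((measurable_gradSq 𝒯 v).comp ?_).aestronglyMeasurable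
      exact measurable_fst.add (measurable_snd.smul_const e)
    · simp only [Function.uncurry]
      rw [Real.norm_eq_abs, abs_of_nonneg (gradSq_nonneg _ _ _)]
      exact hM _
  have hi2 : Integrable (fun z => ∫ r in Set.Ioc (0 : ℝ) 1, gradSq 𝒯 v (z + r • e))
      (volume.restrict E) := hprod.integral_prod_left
  have h1 : ∫ z in E, v z ^ 2 ≤ ∫ z in E, (2 * v (z + e) ^ 2 +
      2 * ‖e‖ ^ 2 * ∫ r in Set.Ioc (0 : ℝ) 1, gradSq 𝒯 v (z + r • e)) := by
    refine setIntegral_mono_on_ae hvi.integrableOn ?_ hEm ?_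
    · exact ((hvie.integrableOn).const_mul 2).add (hi2.const_mul _)
    · filter_upwards [ae_notMem_skel 𝒯] with z hz hzE
      rw [← intervalIntegral.integral_of_le zero_le_one]
      refine sq_le_translate h𝒯 hv hz ?_
      exact (hO 𝒯 p v hv).comp (by fun_prop) (hseg z hzE)
  rw [integral_add ((hvie.integrableOn).const_mul 2) (hi2.const_mul _),
    integral_const_mul, integral_const_mul, integral_integral_swap hprod] at h1
  have h2 : ∫ z in E, v (z + e) ^ 2 ≤ C * dirichlet Ω v := by
    refine le_trans ?_ (hC 𝒯 p h𝒯 v hv)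
    rw [← integral_indicator hEm, ← integral_indicator hE'm,
      ← integral_add_right_eq_self (E'.indicator fun z => v z ^ 2) e]
    refine integral_mono (hvie.indicator hEm) ((hvi.indicator hE'm).comp_add_right e) fun z => ?_
    by_cases hz : z ∈ E
    · rw [Set.indicator_of_mem hz, Set.indicator_of_mem (hmaps z hz)]
    · rw [Set.indicator_of_notMem hz]
      exact Set.indicator_nonneg (fun _ _ => sq_nonneg _) _
  have h3 : ∫ r in Set.Ioc (0 : ℝ) 1, ∫ z in E, gradSq 𝒯 v (z + r • e) ≤ dirichlet Ω v := by
    have h4 : ∀ r : ℝ, ∫ z in E, gradSq 𝒯 v (z + r • e) ≤ dirichlet Ω v := by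
      intro r
      rw [← hG, ← integral_add_right_eq_self (gradSq 𝒯 v) (r • e)]
      exact setIntegral_le_integral (hGi.comp_add_right _)
        (Eventually.of_forall fun z => gradSq_nonneg _ _ _)
    calc _ ≤ ∫ r in Set.Ioc (0 : ℝ) 1, dirichlet Ω v := by
          refine setIntegral_mono_on hprod.integral_prod_right ?_ measurableSet_Ioc fun r _ => h4 r
          simp
      _ = dirichlet Ω v := by simp
  nlinarith [sq_nonneg ‖e‖]

lemma EnergyControlled.mono (hb : Bornology.IsBounded Ω) {E E' : Set Plane} (hsub : E ⊆ E')
    (h : EnergyControlled Ω E') : EnergyControlled Ω E := by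
  obtain ⟨C, hC0, hC⟩ := h
  refine ⟨C, hC0, fun 𝒯 p h𝒯 v hv => le_trans ?_ (hC 𝒯 p h𝒯 v hv)⟩
  exact setIntegral_mono_set (integrable_sq_of_mem_femSpace hb hv).integrableOn
    (Eventually.of_forall fun z => sq_nonneg _) hsub.eventuallyLE

lemma EnergyControlled.union (hb : Bornology.IsBounded Ω) {E E' : Set Plane}
    (h : EnergyControlled Ω E) (h' : EnergyControlled Ω E') : EnergyControlled Ω (E ∪ E') := by
  obtain ⟨C, hC0, hC⟩ := h
  obtain ⟨C', hC0', hC'⟩ := h'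
  refine ⟨C + C', by positivity, fun 𝒯 p h𝒯 v hv => ?_⟩
  have hvi := integrable_sq_of_mem_femSpace hb hv
  have h1 := hC 𝒯 p h𝒯 v hv
  have h2 := hC' 𝒯 p h𝒯 v hv
  have h3 : ∫ z in E ∪ E', v z ^ 2 ≤ (∫ z in E, v z ^ 2) + ∫ z in E', v z ^ 2 := by
    rw [← integral_add_measure hvi.integrableOn hvi.integrableOn]
    exact integral_mono_measure (Measure.restrict_union_le _ _)
      (Eventually.of_forall fun z => sq_nonneg _)
      (Integrable.add_measure hvi.integrableOn hvi.integrableOn)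
  linarith

/-- `z` has a neighbourhood on which finite element functions are controlled. -/
def LocallyControlled (Ω : Set Plane) (z : Plane) : Prop :=
  ∃ r > 0, EnergyControlled Ω (Ω ∩ Metric.ball z r)

lemma isOpen_locallyControlled (hb : Bornology.IsBounded Ω) :
    IsOpen {z | LocallyControlled Ω z} := by
  rw [Metric.isOpen_iff]
  rintro z ⟨r, hr, h⟩
  refine ⟨r, hr, fun z' hz' => ⟨r - dist z' z, sub_pos.2 hz', h.mono hb ?_⟩⟩
  exact Set.inter_subset_inter_right _ (Metric.ball_subset_ball' (by linarith))

/-- Finite element functions are continuous near a point of the inflow boundary. -/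
lemma continuousOn_ball_inflow (hΩ : IsOpen Ω) {z n : Plane} {r : ℝ}
    (hn1 : ‖n‖ = 1) (hball : ∀ w ∈ Metric.ball z r, w ∈ Ω ↔ inner ℝ (w - z) n < 0)
    (hn0 : n 0 = 0) (hsgn : ∀ w ∈ Metric.ball z r, w 0 * n 1 < 0) :
    (∀ w ∈ Metric.ball z r, 0 < inner ℝ (w - z) n → w ∉ closure Ω) ∧
    ∀ (𝒯 : Finset (Affine.Triangle ℝ Plane)) (p : ℕ), ∀ v ∈ femSpace Ω 𝒯 p,
      ContinuousOn v (Metric.ball z r) := by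
  have hout : ∀ w ∈ Metric.ball z r, 0 < inner ℝ (w - z) n → w ∉ closure Ω := by
    intro w hw hpos hcl
    have hopen : IsOpen (Metric.ball z r ∩ {w : Plane | 0 < inner ℝ (w - z) n}) :=
      Metric.isOpen_ball.inter (isOpen_lt continuous_const (by fun_prop))
    obtain ⟨w', ⟨hw1, hw2⟩, hw3⟩ := mem_closure_iff.1 hcl _ hopen ⟨hw, hpos⟩
    exact lt_asymm hw2 ((hball w' hw1).1 hw3)
  refine ⟨hout, fun 𝒯 p v hv w hw => ContinuousAt.continuousWithinAt ?_⟩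
  by_cases hwΩ : w ∈ Ω
  · exact (hv.1.continuousAt (mem_of_superset (hΩ.mem_nhds hwΩ) subset_closure))
  by_cases hcl : w ∈ closure Ω
  · have hzero : v w = 0 := by
      have h0 : inner ℝ (w - z) n = 0 := by
        refine le_antisymm ?_ ?_
        · by_contra! h; exact hout w hw h hcl
        · by_contra! h; exact hwΩ ((hball w hw).2 h)
      refine hv.2.2.2 w ⟨n, ⟨hn1, r - dist w z, sub_pos.2 hw, fun w' hw' => ?_⟩, hn0, hsgn w hw⟩
      have hw'' : w' ∈ Metric.ball z r := by
        rw [Metric.mem_ball] at hw' ⊢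
        linarith [dist_triangle w' w z]
      have : inner ℝ (w' - w) n = inner ℝ (w' - z) n := by
        rw [← sub_sub_sub_cancel_right w' w z, inner_sub_left, h0, sub_zero]
      rw [hball w' hw'', this]
    have h1 : ContinuousWithinAt v (closure Ω) w := hv.1 w hcl
    have h2 : ContinuousWithinAt v (closure Ω)ᶜ w := by
      refine ContinuousWithinAt.congr (f := fun _ => (0 : ℝ)) continuousWithinAt_const
        (fun y hy => hv.2.1 y hy) hzero
    have := h1.union h2
    rwa [Set.union_compl_self, continuousWithinAt_univ] at this
  · have : v =ᶠ[𝓝 w] fun _ => (0 : ℝ) :=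
      eventuallyEq_of_mem (isClosed_closure.isOpen_compl.mem_nhds hcl) fun y hy => hv.2.1 y hy
    exact continuousAt_const.congr this.symm

lemma energyControlled_of_disjoint {E : Set Plane} (hE : ∀ z ∈ E, z ∉ closure Ω) (hEm : MeasurableSet E) :
    EnergyControlled Ω E := by
  refine ⟨0, le_rfl, fun 𝒯 p _ v hv => ?_⟩
  rw [setIntegral_congr_fun hEm (g := fun _ => (0 : ℝ)) fun z hz => by simp [hv.2.1 z (hE z hz)]]
  simp

/-- Translation along the outward normal leads into the exterior half disc, where `v` is zero. It is
allowed because `v`, extended by zero, is continuous across the inflow boundary. -/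
lemma locallyControlled_inflow (hΩ : IsOpen Ω) (hb : Bornology.IsBounded Ω) {z : Plane}
    (hz : z ∈ inflowBoundary Ω) : LocallyControlled Ω z := by
  obtain ⟨n, ⟨hn1, r₀, hr₀, hball₀⟩, hn0, hzn⟩ := hz
  obtain ⟨r, hr, hrsub⟩ : ∃ r > 0, Metric.ball z r ⊆ Metric.ball z r₀ ∩ {w | w 0 * n 1 < 0} := by
    refine Metric.mem_nhds_iff.1 (inter_mem (Metric.ball_mem_nhds z hr₀) ?_)
    refine (isOpen_lt ?_ continuous_const).mem_nhds hzn
    exact ((EuclideanSpace.proj 0 : Plane →L[ℝ] ℝ).continuous).mul continuous_const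
  obtain ⟨hout, hcont⟩ := continuousOn_ball_inflow hΩ hn1
    (fun w hw => hball₀ w (hrsub hw).1) hn0 (fun w hw => (hrsub hw).2)
  have hin : ∀ w ∈ Metric.ball z (r / 4), -(r / 4) < inner ℝ (w - z) n := by
    intro w hw
    have h1 := abs_real_inner_le_norm (w - z) n
    rw [hn1, mul_one, ← dist_eq_norm] at h1
    rw [Metric.mem_ball] at hw
    linarith [(abs_le.1 h1).1]
  have hmem : ∀ w ∈ Metric.ball z (r / 4), ∀ s ∈ Set.Icc (0 : ℝ) 1,
      w + s • ((r / 2) • n) ∈ Metric.ball z r := by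
    intro w hw s hs
    rw [Metric.mem_ball, dist_eq_norm] at hw ⊢
    have : w + s • ((r / 2) • n) - z = (w - z) + s • ((r / 2) • n) := by abel
    rw [this]
    refine (norm_add_le _ _).trans_lt ?_
    rw [norm_smul, norm_smul, hn1, Real.norm_of_nonneg hs.1, Real.norm_of_nonneg (by positivity)]
    nlinarith [hs.2]
  refine ⟨r / 4, by positivity, ?_⟩
  refine EnergyControlled.translate hΩ hb (E' := Metric.ball z r ∩ {w | 0 < inner ℝ (w - z) n})
    (O := Metric.ball z r) (e := (r / 2) • n) ?_
    (hΩ.inter Metric.isOpen_ball).measurableSet (hb.subset Set.inter_subset_left) ?_ hcont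
    (fun w hw => hmem w hw.2) fun w hw => ⟨?_, ?_⟩
  · refine energyControlled_of_disjoint (fun w hw => hout w hw.1 hw.2) ?_
    exact (Metric.isOpen_ball.inter (isOpen_lt continuous_const (by fun_prop))).measurableSet
  · exact (Metric.isOpen_ball.inter (isOpen_lt continuous_const (by fun_prop))).measurableSet
  · simpa using hmem w hw.2 1 (by simp)
  · have := hin w hw.2
    have e : w + (r / 2) • n - z = (w - z) + (r / 2) • n := by abel
    rw [Set.mem_ofPred_eq, e, inner_add_left, real_inner_smul_left, real_inner_self_eq_norm_sq, hn1]
    linarith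

lemma continuousOn_of_mem_femSpace : ∀ (𝒯 : Finset (Affine.Triangle ℝ Plane)) (p : ℕ),
    ∀ v ∈ femSpace Ω 𝒯 p, ContinuousOn v Ω := fun _ _ _ hv => hv.1.mono subset_closure

/-- The controlled points form an open set meeting `Ω`. Inside a disc contained in `Ω`, translation
carries control from a nearby controlled point to a limit point, so the set is also closed in `Ω`,
and `Ω` is connected. -/
lemma locallyControlled_interior (hΩ : IsOpen Ω) (hc : IsConnected Ω) (hb : Bornology.IsBounded Ω)
    (hin : (inflowBoundary Ω).Nonempty) : Ω ⊆ {z | LocallyControlled Ω z} := by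
  refine hc.isPreconnected.subset_of_closure_inter_subset (isOpen_locallyControlled hb) ?_ ?_
  · obtain ⟨z, hz⟩ := hin
    have h1 := locallyControlled_inflow hΩ hb hz
    obtain ⟨n, hn, -⟩ := hz
    obtain ⟨w, hw1, hw2⟩ := mem_closure_iff.1 hn.mem_closure _ (isOpen_locallyControlled hb) h1
    exact ⟨w, hw2, hw1⟩
  · rintro z ⟨hz, hzΩ⟩
    obtain ⟨ρ, hρ, hball⟩ := Metric.isOpen_iff.1 hΩ z hzΩ
    obtain ⟨z', ⟨r, hr, hz'⟩, hd⟩ := Metric.mem_closure_iff.1 hz (ρ / 2) (by positivity)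
    set ε := min r (ρ / 2) with hε
    have hε0 : 0 < ε := lt_min hr (by positivity)
    refine ⟨ε, hε0, ?_⟩
    have hd' : ‖z' - z‖ < ρ / 2 := by rwa [← dist_eq_norm, dist_comm]
    refine EnergyControlled.translate hΩ hb (e := z' - z) hz'
      (hΩ.inter Metric.isOpen_ball).measurableSet (hb.subset Set.inter_subset_left)
      (hΩ.inter Metric.isOpen_ball).measurableSet continuousOn_of_mem_femSpace ?_ ?_
    · rintro w ⟨-, hw⟩ s hs
      refine hball ?_
      rw [Metric.mem_ball, dist_eq_norm] at hw ⊢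
      have : w + s • (z' - z) - z = (w - z) + s • (z' - z) := by abel
      rw [this]
      refine (norm_add_le _ _).trans_lt ?_
      rw [norm_smul, Real.norm_of_nonneg hs.1]
      have h1 : s * ‖z' - z‖ ≤ ‖z' - z‖ := mul_le_of_le_one_left (norm_nonneg _) hs.2
      linarith [min_le_right r (ρ / 2)]
    · rintro w ⟨-, hw⟩
      rw [Metric.mem_ball, dist_eq_norm] at hw
      refine ⟨hball ?_, ?_⟩
      · rw [Metric.mem_ball, dist_eq_norm]
        have : w + (z' - z) - z = (w - z) + (z' - z) := by abel
        rw [this]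
        refine (norm_add_le _ _).trans_lt ?_
        linarith [min_le_right r (ρ / 2)]
      · rw [Metric.mem_ball, dist_eq_norm]
        have : w + (z' - z) - z' = w - z := by abel
        rw [this]
        linarith [min_le_left r (ρ / 2)]

/-- In graph coordinates, moving upwards stays in `Ω`, so a neighbourhood of the boundary point is
translated into a controlled neighbourhood of an interior point. -/
lemma locallyControlled_frontier (hΩ : IsOpen Ω) (hb : Bornology.IsBounded Ω)
    (hL : HasLipschitzBoundary Ω) (hint : Ω ⊆ {z | LocallyControlled Ω z}) {z : Plane}
    (hz : z ∈ frontier Ω) : LocallyControlled Ω z := by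
  obtain ⟨e₁, e₂, K, φ, r, he₁, he₂, horth, hφ, hr, hball⟩ := hL z hz
  have horth' : inner ℝ e₂ e₁ = 0 := by rw [real_inner_comm]; exact horth
  have hφ0 : φ 0 ≤ 0 := by
    have hclosed : IsClosed {w : Plane | φ (inner ℝ (w - z) e₁) ≤ inner ℝ (w - z) e₂} :=
      isClosed_le (hφ.continuous.comp (by fun_prop)) (by fun_prop)
    have hmem : z ∈ closure (Metric.ball z r ∩ Ω) :=
      Metric.isOpen_ball.inter_closure ⟨Metric.mem_ball_self hr, hz.1⟩
    have hsub : Metric.ball z r ∩ Ω ⊆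
        {w : Plane | φ (inner ℝ (w - z) e₁) ≤ inner ℝ (w - z) e₂} :=
      fun w hw => ((hball w hw.1).1 hw.2).le
    have h3 := closure_minimal hsub hclosed hmem
    rw [Set.mem_ofPred_eq, sub_self, inner_zero_left, inner_zero_left] at h3
    exact h3
  -- translation in the direction of the graph stays in the domain
  have hup : ∀ w ∈ Metric.ball z r, ∀ s : ℝ, 0 < s → φ (inner ℝ (w - z) e₁) ≤ inner ℝ (w - z) e₂ →
      w + s • e₂ ∈ Metric.ball z r → w + s • e₂ ∈ Ω := by
    intro w hw s hs hle hmem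
    rw [hball _ hmem]
    have e : w + s • e₂ - z = (w - z) + s • e₂ := by abel
    rw [e, inner_add_left, inner_add_left, real_inner_smul_left, real_inner_smul_left, horth',
      real_inner_self_eq_norm_sq, he₂, mul_zero, add_zero]
    linarith
  have hdist : ∀ (w : Plane) (s : ℝ), 0 ≤ s → dist (w + s • e₂) z ≤ dist w z + s := by
    intro w s hs
    rw [dist_eq_norm, dist_eq_norm, show w + s • e₂ - z = (w - z) + s • e₂ by abel]
    refine (norm_add_le _ _).trans ?_
    rw [norm_smul, he₂, mul_one, Real.norm_of_nonneg hs]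
  set s := r / 2 with hs
  have hs0 : 0 < s := by positivity
  have hyΩ : z + s • e₂ ∈ Ω := by
    refine hup z (Metric.mem_ball_self hr) s hs0 (by simpa using hφ0) ?_
    have := hdist z s hs0.le
    rw [dist_self] at this
    rw [Metric.mem_ball]; linarith
  obtain ⟨r', hr', hy⟩ := hint hyΩ
  set ρ := min r' (r / 2) with hρ
  have hρ0 : 0 < ρ := lt_min hr' (by positivity)
  refine ⟨ρ, hρ0, ?_⟩
  have hstay : ∀ w ∈ Ω ∩ Metric.ball z ρ, ∀ q ∈ Set.Icc (0 : ℝ) 1, w + q • (s • e₂) ∈ Ω := by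
    rintro w ⟨hwΩ, hw⟩ q hq
    rcases hq.1.eq_or_lt with h | h
    · rw [← h, zero_smul, add_zero]; exact hwΩ
    rw [Metric.mem_ball] at hw
    have hwr : w ∈ Metric.ball z r := by
      rw [Metric.mem_ball]; linarith [min_le_right r' (r / 2)]
    rw [smul_smul]
    refine hup w hwr _ (by positivity) ((hball w hwr).1 hwΩ).le ?_
    rw [Metric.mem_ball]
    have h1 := hdist w (q * s) (by positivity)
    have h2 : q * s ≤ s := mul_le_of_le_one_left hs0.le hq.2
    linarith [min_le_right r' (r / 2)]
  refine EnergyControlled.translate hΩ hb (e := s • e₂) hy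
    (hΩ.inter Metric.isOpen_ball).measurableSet (hb.subset Set.inter_subset_left)
    (hΩ.inter Metric.isOpen_ball).measurableSet continuousOn_of_mem_femSpace hstay ?_
  intro w hw
  refine ⟨by simpa using hstay w hw 1 (by simp), ?_⟩
  have hw2 := hw.2
  rw [Metric.mem_ball] at hw2 ⊢
  rw [dist_add_right]
  linarith [min_le_left r' (r / 2)]

/-- The Friedrichs inequality, with a constant that depends on the domain only. -/
lemma exists_friedrichs_constant (hΩ : IsPolygonalDomain Ω) (hin : (inflowBoundary Ω).Nonempty) :
    ∃ C, 0 ≤ C ∧ ∀ (𝒯 : Finset (Affine.Triangle ℝ Plane)) (p : ℕ), IsTriangulation Ω 𝒯 →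
      ∀ v ∈ femSpace Ω 𝒯 p, ∫ z in Ω, v z ^ 2 ≤ C * dirichlet Ω v := by
  have hb := hΩ.isBounded
  have hint := locallyControlled_interior hΩ.isOpen hΩ.isConnected hb hin
  have hK : IsCompact (closure Ω) :=
    Metric.isCompact_of_isClosed_isBounded isClosed_closure hb.closure
  have key : EnergyControlled Ω (Ω ∩ closure Ω) := by
    -- Control passes to subsets and to finite unions and holds locally, so compactness makes it
    -- global with a single constant.
    refine hK.induction_on (p := fun s => EnergyControlled Ω (Ω ∩ s)) ?_ ?_ ?_ ?_
    · rw [Set.inter_empty]; exact energyControlled_of_disjoint (by simp) MeasurableSet.empty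
    · exact fun s t hst h => h.mono hb (Set.inter_subset_inter_right _ hst)
    · intro s t hs ht; rw [Set.inter_union_distrib_left]; exact hs.union hb ht
    · intro z hz
      have hloc : LocallyControlled Ω z := by
        by_cases h : z ∈ Ω
        · exact hint h
        · refine locallyControlled_frontier hΩ.isOpen hb hΩ.lipschitz hint ?_
          rw [hΩ.isOpen.frontier_eq]; exact ⟨hz, h⟩
      obtain ⟨r, hr, h⟩ := hloc
      exact ⟨Metric.ball z r, mem_nhdsWithin_of_mem_nhds (Metric.ball_mem_nhds z hr), h⟩
  rwa [Set.inter_eq_left.2 subset_closure] at key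

end Friedrichs

end

section

open MvPolynomial

/-! ### The forms as sums of bilinear forms on the elements -/

section forms

variable {M : Type*} [AddCommGroup M] [Module ℝ M]

/-- The bilinear form `(u, v) ↦ (A u, B v)_T`. -/
def triForm (T : Affine.Triangle ℝ Plane) (A B : M →ₗ[ℝ] MvPolynomial (Fin 2) ℝ) :
    M →ₗ[ℝ] M →ₗ[ℝ] ℝ :=
  ((LinearMap.mul ℝ (MvPolynomial (Fin 2) ℝ)).compr₂ (triInt T)).compl₁₂ A B

@[simp] lemma triForm_apply (T : Affine.Triangle ℝ Plane)
    (A B : M →ₗ[ℝ] MvPolynomial (Fin 2) ℝ) (u v : M) : triForm T A B u v = triInt T (A u * B v) :=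
  rfl

end forms

/-- A partial derivative, as a linear map. -/
def pd (i : Fin 2) : MvPolynomial (Fin 2) ℝ →ₗ[ℝ] MvPolynomial (Fin 2) ℝ :=
  (pderiv i).toLinearMap

@[simp] lemma pd_apply (i : Fin 2) (P : MvPolynomial (Fin 2) ℝ) : pd i P = pderiv i P := rfl

/-- Multiplication by `x` after differentiation with respect to `y`. -/
def xpd : MvPolynomial (Fin 2) ℝ →ₗ[ℝ] MvPolynomial (Fin 2) ℝ :=
  (LinearMap.mul ℝ (MvPolynomial (Fin 2) ℝ) (X 0)).comp (pd 1)

@[simp] lemma xpd_apply (P : MvPolynomial (Fin 2) ℝ) : xpd P = X 0 * pderiv 1 P := rfl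

/-- The operator `L` on polynomials, as a linear map. -/
def opLl : MvPolynomial (Fin 2) ℝ →ₗ[ℝ] MvPolynomial (Fin 2) ℝ := -((pd 0).comp (pd 0)) + xpd

@[simp] lemma opLl_apply (P : MvPolynomial (Fin 2) ℝ) : opLl P = opLp P := rfl

/-- The contribution of an element to `(v, w)_A`. -/
def elemInner (C : ℝ) (p : ℕ) (T : Affine.Triangle ℝ Plane) :
    MvPolynomial (Fin 2) ℝ →ₗ[ℝ] MvPolynomial (Fin 2) ℝ →ₗ[ℝ] ℝ :=
  triForm T LinearMap.id LinearMap.id + (alpha C p T • triForm T (pd 0) (pd 0) +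
    beta C p T • (triForm T (pd 0) (pd 1) + triForm T (pd 1) (pd 0)) +
    gamma C p T • triForm T (pd 1) (pd 1))

/-- The contribution of an element to the form `a_h`, on pairs `(u, u_t)`. -/
def elemForm (C C' : ℝ) (p : ℕ) (T : Affine.Triangle ℝ Plane) :
    (MvPolynomial (Fin 2) ℝ × MvPolynomial (Fin 2) ℝ) →ₗ[ℝ]
      (MvPolynomial (Fin 2) ℝ × MvPolynomial (Fin 2) ℝ) →ₗ[ℝ] ℝ :=
  let f := LinearMap.fst ℝ (MvPolynomial (Fin 2) ℝ) (MvPolynomial (Fin 2) ℝ)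
  let g := LinearMap.snd ℝ (MvPolynomial (Fin 2) ℝ) (MvPolynomial (Fin 2) ℝ)
  triForm T (pd 0 ∘ₗ f) (pd 0 ∘ₗ f) + triForm T (xpd ∘ₗ f) f +
    tau C' p T • triForm T (g + opLl ∘ₗ f) (g + xpd ∘ₗ f) +
    (alpha C p T • triForm T (pd 0 ∘ₗ opLl ∘ₗ f) (pd 0 ∘ₗ f) +
      beta C p T • (triForm T (pd 0 ∘ₗ opLl ∘ₗ f) (pd 1 ∘ₗ f) +
        triForm T (pd 1 ∘ₗ opLl ∘ₗ f) (pd 0 ∘ₗ f)) +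
      gamma C p T • triForm T (pd 1 ∘ₗ opLl ∘ₗ f) (pd 1 ∘ₗ f))

/-- `v` is given on the elements by the polynomials `P T`. -/
def IsRep (𝒯 : Finset (Affine.Triangle ℝ Plane)) (v : Plane → ℝ)
    (P : Affine.Triangle ℝ Plane → MvPolynomial (Fin 2) ℝ) : Prop :=
  ∀ T ∈ 𝒯, Set.EqOn v (polyFun (P T)) (tri T)

variable {Ω : Set Plane} {𝒯 : Finset (Affine.Triangle ℝ Plane)} {p : ℕ} {C C' : ℝ}

lemma exists_isRep {v : Plane → ℝ} (hv : v ∈ femSpace Ω 𝒯 p) :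
    ∃ P, (∀ T ∈ 𝒯, (P T).totalDegree ≤ p) ∧ IsRep 𝒯 v P := by
  classical
  choose! P hP using hv.2.2.1
  exact ⟨P, fun T hT => (hP T hT).1, fun T hT => (hP T hT).2⟩

lemma IsRep.add {v w : Plane → ℝ} {P Q : Affine.Triangle ℝ Plane → MvPolynomial (Fin 2) ℝ}
    (hv : IsRep 𝒯 v P) (hw : IsRep 𝒯 w Q) : IsRep 𝒯 (v + w) (P + Q) := fun T hT z hz => by
  simp [hv T hT hz, hw T hT hz]

lemma IsRep.smul {v : Plane → ℝ} {P : Affine.Triangle ℝ Plane → MvPolynomial (Fin 2) ℝ} (c : ℝ)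
    (hv : IsRep 𝒯 v P) : IsRep 𝒯 (c • v) (c • P) := fun T hT z hz => by
  simp [hv T hT hz]

lemma ip_congr {S : Set Plane} (hS : MeasurableSet S) {v v' w w' : Plane → ℝ}
    (hv : Set.EqOn v v' S) (hw : Set.EqOn w w' S) : ip S v w = ip S v' w' :=
  setIntegral_congr_fun hS fun z hz => by simp only [hv hz, hw hz]

lemma ipA_congr {T : Affine.Triangle ℝ Plane} {a b c d a' b' c' d' : Plane → ℝ}
    (ha : Set.EqOn a a' (tri T)) (hb : Set.EqOn b b' (tri T)) (hc : Set.EqOn c c' (tri T))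
    (hd : Set.EqOn d d' (tri T)) : ipA C p T a b c d = ipA C p T a' b' c' d' := by
  have hm := (isOpen_tri T).measurableSet
  refine congrArg₂ (· + ·) (ip_congr hm ha fun z hz => ?_) (ip_congr hm hb fun z hz => ?_) <;>
    simp only [hc hz, hd hz]

/-- Passing to the representing polynomials makes every form a finite sum of polynomial integrals,
where integrability and bilinearity come for free. -/
lemma ip_eq_sum (h𝒯 : IsTriangulation Ω 𝒯) {v w : Plane → ℝ}
    {P Q : Affine.Triangle ℝ Plane → MvPolynomial (Fin 2) ℝ} (hv : IsRep 𝒯 v P)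
    (hw : IsRep 𝒯 w Q) : ip Ω v w = ∑ T ∈ 𝒯, triInt T (P T * Q T) := by
  rw [ip, h𝒯.setIntegral_eq_sum]
  · refine Finset.sum_congr rfl fun T hT => ?_
    rw [← ip_polyFun]
    exact ip_congr (isOpen_tri T).measurableSet (hv T hT) (hw T hT)
  · intro T hT
    refine (Continuous.integrableOn_tri (continuous_polyFun (P T * Q T)) T).congr_fun
      (fun z hz => ?_) (isOpen_tri T).measurableSet
    simp only [polyFun_mul, hv T hT hz, hw T hT hz]

lemma IsRep.dx {v : Plane → ℝ} {P : Affine.Triangle ℝ Plane → MvPolynomial (Fin 2) ℝ}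
    (hv : IsRep 𝒯 v P) : IsRep 𝒯 (dx v) fun T => pderiv 0 (P T) := fun T hT => by
  rw [← dx_polyFun]; exact dx_eqOn (isOpen_tri T) (hv T hT)

lemma IsRep.dy {v : Plane → ℝ} {P : Affine.Triangle ℝ Plane → MvPolynomial (Fin 2) ℝ}
    (hv : IsRep 𝒯 v P) : IsRep 𝒯 (dy v) fun T => pderiv 1 (P T) := fun T hT => by
  rw [← dy_polyFun]; exact dy_eqOn (isOpen_tri T) (hv T hT)

lemma IsRep.xdy {v : Plane → ℝ} {P : Affine.Triangle ℝ Plane → MvPolynomial (Fin 2) ℝ}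
    (hv : IsRep 𝒯 v P) : IsRep 𝒯 (xdy v) fun T => X 0 * pderiv 1 (P T) := fun T hT z hz => by
  simp [Kolmogorov.xdy, hv.dy T hT hz]

lemma IsRep.opL {v : Plane → ℝ} {P : Affine.Triangle ℝ Plane → MvPolynomial (Fin 2) ℝ}
    (hv : IsRep 𝒯 v P) : IsRep 𝒯 (opL v) fun T => opLp (P T) := fun T hT => by
  rw [← opL_polyFun]; exact opL_eqOn (isOpen_tri T) (hv T hT)

lemma innerA_eq_sum (h𝒯 : IsTriangulation Ω 𝒯) {v w : Plane → ℝ}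
    {P Q : Affine.Triangle ℝ Plane → MvPolynomial (Fin 2) ℝ} (hv : IsRep 𝒯 v P)
    (hw : IsRep 𝒯 w Q) : innerA Ω 𝒯 p C v w = ∑ T ∈ 𝒯, elemInner C p T (P T) (Q T) := by
  rw [innerA, ip_eq_sum h𝒯 hv hw, ← Finset.sum_add_distrib]
  refine Finset.sum_congr rfl fun T hT => ?_
  rw [ipA_congr (hv.dx T hT) (hv.dy T hT) (hw.dx T hT) (hw.dy T hT), ipA_polyFun]
  simp [elemInner, mul_add]

lemma formA_eq_sum (h𝒯 : IsTriangulation Ω 𝒯) {u ut v vt : Plane → ℝ}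
    {P P' Q Q' : Affine.Triangle ℝ Plane → MvPolynomial (Fin 2) ℝ} (hu : IsRep 𝒯 u P)
    (hut : IsRep 𝒯 ut P') (hv : IsRep 𝒯 v Q) (hvt : IsRep 𝒯 vt Q') :
    formA Ω 𝒯 p C C' u ut v vt = ∑ T ∈ 𝒯, elemForm C C' p T (P T, P' T) (Q T, Q' T) := by
  rw [formA, formSUPG, ip_eq_sum h𝒯 hu.dx hv.dx, ip_eq_sum h𝒯 hu.xdy hv,
    ← Finset.sum_add_distrib, ← Finset.sum_add_distrib, ← Finset.sum_add_distrib]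
  refine Finset.sum_congr rfl fun T hT => ?_
  rw [ipA_congr (hu.opL.dx T hT) (hu.opL.dy T hT) (hv.dx T hT) (hv.dy T hT), ipA_polyFun]
  have h1 : ip (tri T) (fun z => ut z + opL u z)
      (fun z => tau C' p T * (vt z + xdy v z)) =
      tau C' p T * triInt T ((P' T + opLp (P T)) * (Q' T + X 0 * pderiv 1 (Q T))) := by
    rw [← smul_eq_mul (tau C' p T), ← map_smul, ← mul_smul_comm, ← ip_polyFun]
    refine ip_congr (isOpen_tri T).measurableSet (fun z hz => ?_) fun z hz => ?_
    · simp [hut T hT hz, hu.opL T hT hz]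
    · simp [hvt T hT hz, hv.xdy T hT hz, mul_add]
  rw [h1]
  simp [elemForm, mul_add]

lemma elemInner_symm (T : Affine.Triangle ℝ Plane) (P Q : MvPolynomial (Fin 2) ℝ) :
    elemInner C p T P Q = elemInner C p T Q P := by
  simp only [elemInner, LinearMap.add_apply, LinearMap.smul_apply, triForm_apply, pd_apply,
    LinearMap.id_apply, smul_eq_mul]
  rw [mul_comm P, mul_comm (pderiv 0 P), mul_comm (pderiv 0 P), mul_comm (pderiv 1 P),
    mul_comm (pderiv 1 P), add_comm (triInt T (pderiv 1 Q * pderiv 0 P))]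

lemma triInt_add_smul_sq (T : Affine.Triangle ℝ Plane) (P Q : MvPolynomial (Fin 2) ℝ) (s : ℝ) :
    0 ≤ triInt T (P ^ 2) + 2 * s * triInt T (P * Q) + s ^ 2 * triInt T (Q ^ 2) := by
  have he : (P + s • Q) ^ 2 = P ^ 2 + (2 * s) • (P * Q) + s ^ 2 • Q ^ 2 := by
    simp only [smul_eq_C_mul, map_mul, map_pow, map_ofNat]; ring
  have h := triInt_sq_nonneg T (P + s • Q)
  rw [he] at h
  simpa using h

/-- The squares of `P_x ± P_y/(3δ)` bound the mixed term by the diagonal ones, since `1/(72 δ³) ≤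
γ`. With one sign this is positivity, with the other the doubling of `α` and `γ`. -/
lemma elemInner_bounds {T : Affine.Triangle ℝ Plane} (hδ : 0 < delta C p T)
    (P : MvPolynomial (Fin 2) ℝ) :
    0 ≤ elemInner C p T P P ∧ elemInner C p T P P ≤ triInt T (P ^ 2) +
      (4 * delta C p T)⁻¹ * triInt T (pderiv 0 P ^ 2) +
      (32 * delta C p T ^ 3)⁻¹ * triInt T (pderiv 1 P ^ 2) := by
  have h0 := triInt_sq_nonneg T P
  have hx := triInt_sq_nonneg T (pderiv 0 P)
  have hy := triInt_sq_nonneg T (pderiv 1 P)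
  set δ := delta C p T with hd
  have h1 := triInt_add_smul_sq T (pderiv 0 P) (pderiv 1 P) ((3 * δ)⁻¹)
  have h2 := triInt_add_smul_sq T (pderiv 0 P) (pderiv 1 P) (-(3 * δ)⁻¹)
  have he : elemInner C p T P P = triInt T (P ^ 2) + ((8 * δ)⁻¹ * triInt T (pderiv 0 P ^ 2) +
      2 * (24 * δ ^ 2)⁻¹ * triInt T (pderiv 0 P * pderiv 1 P) +
      (64 * δ ^ 3)⁻¹ * triInt T (pderiv 1 P ^ 2)) := by
    simp only [elemInner, LinearMap.add_apply, LinearMap.smul_apply, triForm_apply, pd_apply,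
      LinearMap.id_apply, smul_eq_mul, alpha, beta, gamma, ← hd, ← pow_two]
    rw [mul_comm (pderiv 1 P)]
    ring
  rw [he]
  have hg : (72 * δ ^ 3)⁻¹ ≤ (64 * δ ^ 3)⁻¹ := by gcongr; norm_num
  have hgy := mul_le_mul_of_nonneg_right hg hy
  have r1 : (8 * δ)⁻¹ * (3 * δ)⁻¹ = (24 * δ ^ 2)⁻¹ := by rw [← mul_inv]; congr 1; ring
  have r2 : (8 * δ)⁻¹ * (3 * δ)⁻¹ ^ 2 = (72 * δ ^ 3)⁻¹ := by
    rw [inv_pow, ← mul_inv]; congr 1; ring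
  have r3 : (4 * δ)⁻¹ = 2 * (8 * δ)⁻¹ := by field_simp; norm_num
  have r4 : (32 * δ ^ 3)⁻¹ = 2 * (64 * δ ^ 3)⁻¹ := by field_simp; norm_num
  have hα : 0 ≤ (8 * δ)⁻¹ := by positivity
  have e1 := mul_nonneg hα h1
  have e2 := mul_nonneg hα h2
  rw [show (8 * δ)⁻¹ * (triInt T (pderiv 0 P ^ 2) +
      2 * (3 * δ)⁻¹ * triInt T (pderiv 0 P * pderiv 1 P) +
      (3 * δ)⁻¹ ^ 2 * triInt T (pderiv 1 P ^ 2)) = (8 * δ)⁻¹ * triInt T (pderiv 0 P ^ 2) +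
      2 * (24 * δ ^ 2)⁻¹ * triInt T (pderiv 0 P * pderiv 1 P) +
      (72 * δ ^ 3)⁻¹ * triInt T (pderiv 1 P ^ 2) by rw [← r1, ← r2]; ring] at e1
  rw [show (8 * δ)⁻¹ * (triInt T (pderiv 0 P ^ 2) +
      2 * -(3 * δ)⁻¹ * triInt T (pderiv 0 P * pderiv 1 P) +
      (-(3 * δ)⁻¹) ^ 2 * triInt T (pderiv 1 P ^ 2)) = (8 * δ)⁻¹ * triInt T (pderiv 0 P ^ 2) -
      2 * (24 * δ ^ 2)⁻¹ * triInt T (pderiv 0 P * pderiv 1 P) +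
      (72 * δ ^ 3)⁻¹ * triInt T (pderiv 1 P ^ 2) by rw [← r1, ← r2]; ring] at e2
  rw [r3, r4]
  constructor <;> linarith

/-- Local coercivity. -/
lemma elemForm_ge {T : Affine.Triangle ℝ Plane} (h : TraceInverse C p T) (hC' : 0 < C')
    (hg : GradInverse C' p T) (hp : 1 ≤ p) (hh : hT T < 1) (hδ : 0 < delta C p T)
    {P : MvPolynomial (Fin 2) ℝ} (hP : P.totalDegree ≤ p) (P' : MvPolynomial (Fin 2) ℝ) :
    3 / 4 * triInt T (pderiv 0 P ^ 2) + 7 / 384 / delta C p T ^ 2 * triInt T (pderiv 1 P ^ 2) +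
      triInt T (X 0 * pderiv 1 P * P) ≤ elemForm C C' p T (P, P') (P, P') := by
  have h1 := ipA_opLp_ge h hh hδ hP
  have h2 := ip_streamline_ge hC' hp hg hP P'
  rw [ipA_polyFun] at h1
  simp only [elemForm, LinearMap.add_apply, LinearMap.smul_apply, triForm_apply, pd_apply,
    LinearMap.comp_apply, LinearMap.fst_apply, LinearMap.snd_apply, opLl_apply, xpd_apply,
    smul_eq_mul]
  rw [← pow_two (pderiv 0 P)]
  linarith

end

/-! ### Coercivity on the whole domain -/

section

open MvPolynomial

variable {Ω : Set Plane} {𝒯 : Finset (Affine.Triangle ℝ Plane)} {p : ℕ} {C C' : ℝ}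

/-- The sign of the advection term is read off from `v²`, since `(v²)_y = 2 v v_y`; the doubled
degree is harmless, as the results on slices hold for every degree. -/
lemma sq_mem_femSpace {v : Plane → ℝ} (hv : v ∈ femSpace Ω 𝒯 p) :
    (fun z => v z ^ 2) ∈ femSpace Ω 𝒯 (2 * p) := by
  refine ⟨hv.1.pow 2, fun z hz => by simp [hv.2.1 z hz], fun T hT => ?_,
    fun z hz => by simp [hv.2.2.2 z hz]⟩
  obtain ⟨P, hP, hPv⟩ := hv.2.2.1 T hT
  refine ⟨P * P, ?_, fun z hz => by simp [hPv hz, pow_two]⟩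
  have := totalDegree_mul P P
  omega

/-- The advection term is nonnegative. -/
lemma sum_advection_nonneg (hΩ : IsPolygonalDomain Ω)
    (hbdry : ∀ z n, IsOutwardNormal Ω z n → n 0 ≠ 0 → 0 ≤ z 0 * n 1)
    (h𝒯 : IsTriangulation Ω 𝒯) {v : Plane → ℝ} (hv : v ∈ femSpace Ω 𝒯 p)
    {P : Affine.Triangle ℝ Plane → MvPolynomial (Fin 2) ℝ} (hP : IsRep 𝒯 v P) :
    0 ≤ ∑ T ∈ 𝒯, triInt T (X 0 * pderiv 1 (P T) * P T) := by
  have h := integral_x_dy_nonneg hΩ.isOpen hΩ.isBounded hΩ.lipschitz hbdry h𝒯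
    (sq_mem_femSpace hv) (fun z => sq_nonneg _)
  have hrep : IsRep 𝒯 (fun z => v z ^ 2) fun T => P T * P T := fun T hT z hz => by
    simp [hP T hT hz, pow_two]
  have hone : IsRep 𝒯 (fun _ => 1) fun _ => 1 := fun T hT z hz => by simp
  have he := ip_eq_sum h𝒯 hrep.xdy hone
  simp only [ip, mul_one, xdy] at he
  rw [he] at h
  have h2 : ∑ T ∈ 𝒯, triInt T (X 0 * pderiv 1 (P T * P T)) =
      2 * ∑ T ∈ 𝒯, triInt T (X 0 * pderiv 1 (P T) * P T) := by
    rw [Finset.mul_sum]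
    refine Finset.sum_congr rfl fun T _ => ?_
    have : X 0 * pderiv 1 (P T * P T) = (2 : ℝ) • (X 0 * pderiv 1 (P T) * P T) := by
      simp only [smul_eq_C_mul, Derivation.leibniz, smul_eq_mul, map_ofNat]
      ring
    rw [this, map_smul, smul_eq_mul]
  linarith

lemma dirichlet_eq_sum (h𝒯 : IsTriangulation Ω 𝒯) {v : Plane → ℝ}
    {P : Affine.Triangle ℝ Plane → MvPolynomial (Fin 2) ℝ} (hP : IsRep 𝒯 v P) :
    dirichlet Ω v = ∑ T ∈ 𝒯, (triInt T (pderiv 0 (P T) ^ 2) + triInt T (pderiv 1 (P T) ^ 2)) := by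
  have hrep : IsRep 𝒯 (fun z => dx v z ^ 2 + dy v z ^ 2)
      fun T => pderiv 0 (P T) ^ 2 + pderiv 1 (P T) ^ 2 := fun T hT z hz => by
    simp [hP.dx T hT hz, hP.dy T hT hz, pow_two]
  have hone : IsRep 𝒯 (fun _ => 1) fun _ => 1 := fun T hT z hz => by simp
  have := ip_eq_sum h𝒯 hrep hone
  simpa [ip, dirichlet] using this

lemma integral_sq_eq_sum (h𝒯 : IsTriangulation Ω 𝒯) {v : Plane → ℝ}
    {P : Affine.Triangle ℝ Plane → MvPolynomial (Fin 2) ℝ} (hP : IsRep 𝒯 v P) :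
    ∫ z in Ω, v z ^ 2 = ∑ T ∈ 𝒯, triInt T (P T ^ 2) := by
  simpa [ip, ← pow_two] using ip_eq_sum h𝒯 hP hP

lemma hmin_le {T : Affine.Triangle ℝ Plane} (hT' : T ∈ 𝒯) : hmin 𝒯 ≤ hT T :=
  csInf_le (𝒯.finite_toSet.image hT).bddBelow ⟨T, hT', rfl⟩

lemma hmin_pos (h : 𝒯.Nonempty) : 0 < hmin 𝒯 := by
  have hne : (hT '' (𝒯 : Set (Affine.Triangle ℝ Plane))).Nonempty := h.to_set.image _
  obtain ⟨T, -, hT'⟩ := hne.csInf_mem (𝒯.finite_toSet.image hT)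
  rw [hmin, ← hT']
  exact hT_pos T

lemma IsTriangulation.nonempty (h𝒯 : IsTriangulation Ω 𝒯) (hΩ : Ω.Nonempty) : 𝒯.Nonempty := by
  obtain ⟨z, hz⟩ := hΩ
  have : z ∈ ⋃ T ∈ 𝒯, closure (tri T) := h𝒯.cover ▸ subset_closure hz
  simp only [Set.mem_iUnion] at this
  obtain ⟨T, hT, -⟩ := this
  exact ⟨T, hT⟩

/-- Lower bound for `δ_T`, uniform with respect to the mesh and the degree. -/
lemma le_delta {σ : ℝ} (hσ : 0 < σ) {T : Affine.Triangle ℝ Plane} (hs : ShapeRegular σ T)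
    (hh : hT T < 1) (hp : 1 ≤ p) : C ^ 2 * σ ^ 2 / 3 ≤ delta C p T := by
  have h1 := le_supNormalX hσ hs
  have h2 := supInflow_nonneg T
  have h3 := hT_pos T
  have hp' : (1 : ℝ) ≤ p := by exact_mod_cast hp
  have h4 : (1 : ℝ) ≤ p ^ 4 := one_le_pow₀ hp'
  have h5 : hT T ^ 2 ≤ 1 := pow_le_one₀ h3.le hh.le
  have h6 : σ ^ 2 ≤ supNormalX T ^ 2 := by gcongr
  rw [delta, le_div_iff₀ (by positivity)]
  calc C ^ 2 * σ ^ 2 / 3 * hT T ^ 2 ≤ C ^ 2 * σ ^ 2 / 3 * 1 := by gcongr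
    _ = C ^ 2 / 6 * (3 * 0 + 2 * σ ^ 2) * 1 := by ring
    _ ≤ _ := by gcongr

/-- Upper bound for `δ_T`. -/
lemma delta_le {R : ℝ} (hR0 : 0 ≤ R) {T : Affine.Triangle ℝ Plane}
    (hR : ∀ z ∈ closure (tri T), |z 0| ≤ R) :
    delta C p T ≤ C ^ 2 / 6 * (3 * R + 2) * p ^ 4 / hT T ^ 2 := by
  have h1 := supInflow_le hR0 hR
  have h2 := supNormalX_le_one T
  have h3 := supNormalX_nonneg T
  have h4 := hT_pos T
  have h5 : supNormalX T ^ 2 ≤ 1 := pow_le_one₀ h3 h2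
  rw [delta]
  gcongr
  linarith

/-- Coercivity of `a_h` with respect to `‖·‖_A`. -/
theorem exists_hypocoercivity_constant (hΩ : IsPolygonalDomain Ω)
    (hin : (inflowBoundary Ω).Nonempty)
    (hbdry : ∀ z n, IsOutwardNormal Ω z n → n 0 ≠ 0 → 0 ≤ z 0 * n 1)
    {σ : ℝ} (hσ : 0 < σ) (hC : 0 < C) :
    ∃ c : ℝ, 0 < c ∧ c < 1 ∧ ∀ C' > 0, ∀ (𝒯 : Finset (Affine.Triangle ℝ Plane)) (p : ℕ),
      IsTriangulation Ω 𝒯 → (∀ T ∈ 𝒯, ShapeRegular σ T) → (∀ T ∈ 𝒯, hT T < 1) → 1 ≤ p →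
      (∀ T ∈ 𝒯, TraceInverse C p T ∧ GradInverse C' p T) →
      ∀ u ∈ femSpace Ω 𝒯 p, ∀ ut ∈ femSpace Ω 𝒯 p,
        c * hmin 𝒯 ^ 4 / p ^ 8 / 4 * innerA Ω 𝒯 p C u u ≤ formA Ω 𝒯 p C C' u ut u ut := by
  obtain ⟨F, hF0, hF⟩ := exists_friedrichs_constant hΩ hin
  obtain ⟨R, hR⟩ := hΩ.isBounded.closure.exists_norm_le
  obtain ⟨z₀, hz₀⟩ := hΩ.isConnected.nonempty
  have hR0 : 0 ≤ R := (norm_nonneg _).trans (hR z₀ (subset_closure hz₀))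
  set M := C ^ 2 / 6 * (3 * R + 2) with hM
  have hM0 : 0 ≤ M := by positivity
  set m := C ^ 2 * σ ^ 2 / 3 with hm
  have hm0 : 0 < m := by positivity
  -- Here `m ≤ δ_T` and `δ_T ≤ M p⁴/h_T²`. The sum `S` majorizes `F + (4m)⁻¹` and `M² F + (32m)⁻¹`,
  -- the quantities needed for `u_x` and `u_y`; the summand `1` keeps the constant below one.
  set S := 1 + F + (4 * m)⁻¹ + M ^ 2 * F + (32 * m)⁻¹ with hS
  have i1 : 0 < (4 * m)⁻¹ := by positivity
  have i2 : 0 < (32 * m)⁻¹ := by positivity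
  have i3 : 0 ≤ M ^ 2 * F := by positivity
  have hS1 : 1 ≤ S := by linarith
  -- The factor `14` works because `1/(4 · 14) = 1/56` is below both `7/384` and `3/4`.
  refine ⟨(14 * S)⁻¹, by positivity, inv_lt_one_of_one_lt₀ (by linarith),
    fun C' hC' 𝒯 p h𝒯 hsr hh hp hinv u hu ut hut => ?_⟩
  have hp' : (1 : ℝ) ≤ p := by exact_mod_cast hp
  obtain ⟨P, hPd, hP⟩ := exists_isRep hu
  obtain ⟨P', -, hP'⟩ := exists_isRep hut
  have hδ : ∀ T ∈ 𝒯, m ≤ delta C p T := fun T hT => le_delta hσ (hsr T hT) (hh T hT) hp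
  have hadv := sum_advection_nonneg hΩ hbdry h𝒯 hu hP
  have hfr := hF 𝒯 p h𝒯 u hu
  rw [integral_sq_eq_sum h𝒯 hP, dirichlet_eq_sum h𝒯 hP] at hfr
  have hmin0 := hmin_pos (h𝒯.nonempty ⟨z₀, hz₀⟩)
  rw [innerA_eq_sum h𝒯 hP hP, formA_eq_sum h𝒯 hP hP' hP hP']
  set μ := hmin 𝒯 ^ 4 / (p : ℝ) ^ 8 with hμ
  have hμ0 : 0 ≤ μ := by positivity
  rw [mul_div_assoc, ← hμ]
  have hinner : ∑ T ∈ 𝒯, elemInner C p T (P T) (P T) ≤ ∑ T ∈ 𝒯,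
      ((F + (4 * delta C p T)⁻¹) * triInt T (pderiv 0 (P T) ^ 2) +
        (F + (32 * delta C p T ^ 3)⁻¹) * triInt T (pderiv 1 (P T) ^ 2)) := by
    rw [Finset.mul_sum] at hfr
    calc _ ≤ ∑ T ∈ 𝒯, (triInt T (P T ^ 2) +
          ((4 * delta C p T)⁻¹ * triInt T (pderiv 0 (P T) ^ 2) +
          (32 * delta C p T ^ 3)⁻¹ * triInt T (pderiv 1 (P T) ^ 2))) := by
          refine Finset.sum_le_sum fun T hT => ?_
          rw [← add_assoc]
          exact (elemInner_bounds (hm0.trans_le (hδ T hT)) (P T)).2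
      _ ≤ ∑ T ∈ 𝒯, F * (triInt T (pderiv 0 (P T) ^ 2) + triInt T (pderiv 1 (P T) ^ 2)) +
          ∑ T ∈ 𝒯, ((4 * delta C p T)⁻¹ * triInt T (pderiv 0 (P T) ^ 2) +
          (32 * delta C p T ^ 3)⁻¹ * triInt T (pderiv 1 (P T) ^ 2)) := by
          rw [Finset.sum_add_distrib]; gcongr
      _ = _ := by
          rw [← Finset.sum_add_distrib]
          exact Finset.sum_congr rfl fun T _ => by ring
  refine (mul_le_mul_of_nonneg_left hinner (by positivity)).trans ?_
  rw [Finset.mul_sum]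
  refine le_trans ?_ (Finset.sum_le_sum fun T hT => elemForm_ge (hinv T hT).1 hC' (hinv T hT).2 hp
    (hh T hT) (hm0.trans_le (hδ T hT)) (hPd T hT) (P' T))
  rw [Finset.sum_add_distrib]
  refine le_add_of_le_of_nonneg (Finset.sum_le_sum fun T hT => ?_) hadv
  have hx := triInt_sq_nonneg T (pderiv 0 (P T))
  have hy := triInt_sq_nonneg T (pderiv 1 (P T))
  have hd := hδ T hT
  have hd0 : 0 < delta C p T := hm0.trans_le hd
  have hTpos := hT_pos T
  -- Here the powers of `κ` are decided: `h⁴ p⁻⁸` compensates `δ² ≤ M² p⁸/h⁴`.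
  have hμδ : μ * delta C p T ^ 2 ≤ M ^ 2 := by
    have h1 : delta C p T ≤ M * p ^ 4 / Kolmogorov.hT T ^ 2 := delta_le hR0 fun z hz =>
      (abs_apply_le_norm z 0).trans (hR z (closure_mono (h𝒯.subset T hT) hz))
    have h2 := hmin_le hT
    calc μ * delta C p T ^ 2 ≤ Kolmogorov.hT T ^ 4 / (p : ℝ) ^ 8 *
          (M * p ^ 4 / Kolmogorov.hT T ^ 2) ^ 2 := by rw [hμ]; gcongr
      _ = M ^ 2 := by field_simp
  have hμ1 : μ ≤ 1 := by
    have h2 : hmin 𝒯 ≤ 1 := (hmin_le hT).trans (hh T hT).le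
    rw [hμ, div_le_one (by positivity)]
    exact (pow_le_one₀ hmin0.le h2).trans (one_le_pow₀ hp')
  set δ := delta C p T
  have j1 : (4 * δ)⁻¹ ≤ (4 * m)⁻¹ := by gcongr
  have j2 : (32 * δ)⁻¹ ≤ (32 * m)⁻¹ := by gcongr
  have hc : (14 * S)⁻¹ * S = 1 / 14 := by field_simp
  have hc0 : 0 < (14 * S)⁻¹ := by positivity
  have k1 : (14 * S)⁻¹ * μ / 4 * (F + (4 * δ)⁻¹) ≤ 3 / 4 := by
    calc _ ≤ (14 * S)⁻¹ * 1 / 4 * S := by gcongr; linarith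
      _ ≤ _ := by linarith
  -- After multiplication by `δ²`, the Friedrichs part needs `μ δ² ≤ M²`, and the part from `γ`
  -- needs only `μ ≤ 1` and `δ ≥ m`.
  have k2 : (14 * S)⁻¹ * μ / 4 * (F + (32 * δ ^ 3)⁻¹) ≤ 7 / 384 / δ ^ 2 := by
    rw [le_div_iff₀ (by positivity)]
    have : (32 * δ ^ 3)⁻¹ * δ ^ 2 = (32 * δ)⁻¹ := by field_simp
    calc (14 * S)⁻¹ * μ / 4 * (F + (32 * δ ^ 3)⁻¹) * δ ^ 2 =
          (14 * S)⁻¹ / 4 * (μ * δ ^ 2 * F + μ * (32 * δ)⁻¹) := by rw [← this]; ring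
      _ ≤ (14 * S)⁻¹ / 4 * (M ^ 2 * F + 1 * (32 * m)⁻¹) := by gcongr
      _ ≤ (14 * S)⁻¹ / 4 * S := by gcongr; linarith
      _ ≤ _ := by linarith
  calc _ = (14 * S)⁻¹ * μ / 4 * (F + (4 * δ)⁻¹) * triInt T (pderiv 0 (P T) ^ 2) +
        (14 * S)⁻¹ * μ / 4 * (F + (32 * δ ^ 3)⁻¹) * triInt T (pderiv 1 (P T) ^ 2) := by ring
    _ ≤ _ := by gcongr

/-! ### The forms on the finite element space -/

/-- The inner product `(·, ·)_A` on the finite element space. -/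
def innerForm (C : ℝ) (h𝒯 : IsTriangulation Ω 𝒯) :
    femSpace Ω 𝒯 p →ₗ[ℝ] femSpace Ω 𝒯 p →ₗ[ℝ] ℝ :=
  LinearMap.mk₂ ℝ (fun v w => innerA Ω 𝒯 p C v w)
    (fun v v' w => by
      obtain ⟨P, -, hP⟩ := exists_isRep v.2
      obtain ⟨P', -, hP'⟩ := exists_isRep v'.2
      obtain ⟨Q, -, hQ⟩ := exists_isRep w.2
      rw [Submodule.coe_add, innerA_eq_sum h𝒯 (hP.add hP') hQ, innerA_eq_sum h𝒯 hP hQ,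
        innerA_eq_sum h𝒯 hP' hQ, ← Finset.sum_add_distrib]
      simp)
    (fun c v w => by
      obtain ⟨P, -, hP⟩ := exists_isRep v.2
      obtain ⟨Q, -, hQ⟩ := exists_isRep w.2
      rw [Submodule.coe_smul, innerA_eq_sum h𝒯 (hP.smul c) hQ, innerA_eq_sum h𝒯 hP hQ,
        Finset.smul_sum]
      simp)
    (fun v w w' => by
      obtain ⟨P, -, hP⟩ := exists_isRep v.2
      obtain ⟨Q', -, hQ'⟩ := exists_isRep w'.2
      obtain ⟨Q, -, hQ⟩ := exists_isRep w.2
      rw [Submodule.coe_add, innerA_eq_sum h𝒯 hP (hQ.add hQ'), innerA_eq_sum h𝒯 hP hQ,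
        innerA_eq_sum h𝒯 hP hQ', ← Finset.sum_add_distrib]
      simp)
    (fun c v w => by
      obtain ⟨P, -, hP⟩ := exists_isRep v.2
      obtain ⟨Q, -, hQ⟩ := exists_isRep w.2
      rw [Submodule.coe_smul, innerA_eq_sum h𝒯 hP (hQ.smul c), innerA_eq_sum h𝒯 hP hQ,
        Finset.smul_sum]
      simp)

@[simp] lemma innerForm_apply (h𝒯 : IsTriangulation Ω 𝒯) (v w : femSpace Ω 𝒯 p) :
    innerForm C h𝒯 v w = innerA Ω 𝒯 p C v w := rfl

lemma innerForm_symm (h𝒯 : IsTriangulation Ω 𝒯) (v w : femSpace Ω 𝒯 p) :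
    innerForm C h𝒯 v w = innerForm C h𝒯 w v := by
  obtain ⟨P, -, hP⟩ := exists_isRep v.2
  obtain ⟨Q, -, hQ⟩ := exists_isRep w.2
  rw [innerForm_apply, innerForm_apply, innerA_eq_sum h𝒯 hP hQ, innerA_eq_sum h𝒯 hQ hP]
  exact Finset.sum_congr rfl fun T _ => elemInner_symm T _ _

lemma innerForm_nonneg (h𝒯 : IsTriangulation Ω 𝒯) (hδ : ∀ T ∈ 𝒯, 0 < delta C p T)
    (v : femSpace Ω 𝒯 p) : 0 ≤ innerForm C h𝒯 v v := by
  obtain ⟨P, -, hP⟩ := exists_isRep v.2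
  rw [innerForm_apply, innerA_eq_sum h𝒯 hP hP]
  exact Finset.sum_nonneg fun T hT => (elemInner_bounds (hδ T hT) _).1

/-- The form `a_h` on pairs `(u, u_t)` of finite element functions. -/
def coerciveForm (C C' : ℝ) (h𝒯 : IsTriangulation Ω 𝒯) :
    (femSpace Ω 𝒯 p × femSpace Ω 𝒯 p) →ₗ[ℝ] (femSpace Ω 𝒯 p × femSpace Ω 𝒯 p) →ₗ[ℝ] ℝ :=
  LinearMap.mk₂ ℝ (fun v w => formA Ω 𝒯 p C C' v.1 v.2 w.1 w.2)
    (fun v v' w => by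
      obtain ⟨P₁, -, h₁⟩ := exists_isRep v.1.2
      obtain ⟨P₂, -, h₂⟩ := exists_isRep v.2.2
      obtain ⟨Q₁, -, k₁⟩ := exists_isRep v'.1.2
      obtain ⟨Q₂, -, k₂⟩ := exists_isRep v'.2.2
      obtain ⟨R₁, -, l₁⟩ := exists_isRep w.1.2
      obtain ⟨R₂, -, l₂⟩ := exists_isRep w.2.2
      rw [Prod.fst_add, Prod.snd_add, Submodule.coe_add, Submodule.coe_add,
        formA_eq_sum h𝒯 (h₁.add k₁) (h₂.add k₂) l₁ l₂, formA_eq_sum h𝒯 h₁ h₂ l₁ l₂,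
        formA_eq_sum h𝒯 k₁ k₂ l₁ l₂, ← Finset.sum_add_distrib]
      simp only [← LinearMap.add_apply, ← map_add, Prod.mk_add_mk, Pi.add_apply])
    (fun c v w => by
      obtain ⟨P₁, -, h₁⟩ := exists_isRep v.1.2
      obtain ⟨P₂, -, h₂⟩ := exists_isRep v.2.2
      obtain ⟨R₁, -, l₁⟩ := exists_isRep w.1.2
      obtain ⟨R₂, -, l₂⟩ := exists_isRep w.2.2
      rw [Prod.smul_fst, Prod.smul_snd, Submodule.coe_smul, Submodule.coe_smul,
        formA_eq_sum h𝒯 (h₁.smul c) (h₂.smul c) l₁ l₂, formA_eq_sum h𝒯 h₁ h₂ l₁ l₂,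
        Finset.smul_sum]
      refine Finset.sum_congr rfl fun T _ => ?_
      rw [Pi.smul_apply, Pi.smul_apply, ← Prod.smul_mk, LinearMap.map_smul, LinearMap.smul_apply])
    (fun w v v' => by
      obtain ⟨P₁, -, h₁⟩ := exists_isRep v.1.2
      obtain ⟨P₂, -, h₂⟩ := exists_isRep v.2.2
      obtain ⟨Q₁, -, k₁⟩ := exists_isRep v'.1.2
      obtain ⟨Q₂, -, k₂⟩ := exists_isRep v'.2.2
      obtain ⟨R₁, -, l₁⟩ := exists_isRep w.1.2
      obtain ⟨R₂, -, l₂⟩ := exists_isRep w.2.2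
      rw [Prod.fst_add, Prod.snd_add, Submodule.coe_add, Submodule.coe_add,
        formA_eq_sum h𝒯 l₁ l₂ (h₁.add k₁) (h₂.add k₂), formA_eq_sum h𝒯 l₁ l₂ h₁ h₂,
        formA_eq_sum h𝒯 l₁ l₂ k₁ k₂, ← Finset.sum_add_distrib]
      simp only [← map_add, Prod.mk_add_mk, Pi.add_apply])
    (fun c w v => by
      obtain ⟨P₁, -, h₁⟩ := exists_isRep v.1.2
      obtain ⟨P₂, -, h₂⟩ := exists_isRep v.2.2
      obtain ⟨R₁, -, l₁⟩ := exists_isRep w.1.2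
      obtain ⟨R₂, -, l₂⟩ := exists_isRep w.2.2
      rw [Prod.smul_fst, Prod.smul_snd, Submodule.coe_smul, Submodule.coe_smul,
        formA_eq_sum h𝒯 l₁ l₂ (h₁.smul c) (h₂.smul c), formA_eq_sum h𝒯 l₁ l₂ h₁ h₂,
        Finset.smul_sum]
      simp only [← map_smul, Prod.smul_mk, Pi.smul_apply])

@[simp] lemma coerciveForm_apply (h𝒯 : IsTriangulation Ω 𝒯)
    (v w : femSpace Ω 𝒯 p × femSpace Ω 𝒯 p) :
    coerciveForm C C' h𝒯 v w = formA Ω 𝒯 p C C' v.1 v.2 w.1 w.2 := rfl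

end

section

/-! ### Polynomials in time with values in a space with a semi-inner product -/

section curves

variable {E : Type*} [AddCommGroup E] [Module ℝ E]

/-- The polynomial curve with coefficients `c 0, …, c q`. -/
def polyCurve (q : ℕ) (c : ℕ → E) (s : ℝ) : E := ∑ j ∈ Finset.range (q + 1), s ^ j • c j

/-- The coefficients of the derivative of a polynomial curve. -/
def derivCoeff (q : ℕ) (c : ℕ → E) (j : ℕ) : E := if j < q then ((j : ℝ) + 1) • c (j + 1) else 0

lemma polyCurve_derivCoeff (q : ℕ) (c : ℕ → E) (s : ℝ) :
    polyCurve q (derivCoeff q c) s = ∑ j ∈ Finset.range (q + 1), ((j : ℝ) * s ^ (j - 1)) • c j := by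
  rw [polyCurve, Finset.sum_range_succ, Finset.sum_range_succ']
  simp only [derivCoeff, lt_irrefl, if_false, smul_zero, add_zero, CharP.cast_eq_zero, zero_mul,
    zero_smul, Nat.add_sub_cancel]
  refine Finset.sum_congr rfl fun j hj => ?_
  rw [if_pos (Finset.mem_range.1 hj), smul_smul, mul_comm]
  push_cast
  rfl

/-- It makes `(U, U_t)` a single polynomial curve, so that `a_h` is one bilinear form evaluated
along it. -/
lemma polyCurve_prod {E' : Type*} [AddCommGroup E'] [Module ℝ E'] (q : ℕ) (c : ℕ → E)
    (d : ℕ → E') (s : ℝ) :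
    polyCurve q (fun j => (c j, d j)) s = (polyCurve q c s, polyCurve q d s) := by
  simp [polyCurve, Prod.ext_iff, Prod.fst_sum, Prod.snd_sum]

variable (B : E →ₗ[ℝ] E →ₗ[ℝ] ℝ)

lemma form_polyCurve (q : ℕ) (c d : ℕ → E) (s r : ℝ) :
    B (polyCurve q c s) (polyCurve q d r) =
      ∑ i ∈ Finset.range (q + 1), ∑ j ∈ Finset.range (q + 1), s ^ i * r ^ j * B (c i) (d j) := by
  simp only [polyCurve, map_sum, LinearMap.sum_apply, map_smul, LinearMap.smul_apply, smul_eq_mul,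
    Finset.mul_sum]
  rw [Finset.sum_comm]
  exact Finset.sum_congr rfl fun i _ => Finset.sum_congr rfl fun j _ => by ring

lemma continuous_form_polyCurve (q : ℕ) (c d : ℕ → E) :
    Continuous fun s => B (polyCurve q c s) (polyCurve q d s) := by
  simp only [form_polyCurve]
  fun_prop

lemma hasDerivAt_form_polyCurve (hB : ∀ v w, B v w = B w v) (q : ℕ) (c : ℕ → E) (s : ℝ) :
    HasDerivAt (fun s => B (polyCurve q c s) (polyCurve q c s))
      (2 * B (polyCurve q (derivCoeff q c) s) (polyCurve q c s)) s := by
  have h1 : ∀ i j : ℕ, HasDerivAt (fun s : ℝ => s ^ i * s ^ j * B (c i) (c j))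
      ((i * s ^ (i - 1) * s ^ j + s ^ i * (j * s ^ (j - 1))) * B (c i) (c j)) s := fun i j =>
    ((hasDerivAt_pow i s).mul (hasDerivAt_pow j s)).mul_const _
  have h2 := HasDerivAt.fun_sum (u := Finset.range (q + 1)) fun i _ =>
    HasDerivAt.fun_sum (u := Finset.range (q + 1)) fun j _ => h1 i j
  simp only [form_polyCurve]
  refine h2.congr_deriv ?_
  rw [← form_polyCurve]
  have h3 : 2 * B (polyCurve q (derivCoeff q c) s) (polyCurve q c s) =
      B (polyCurve q c s) (polyCurve q (derivCoeff q c) s) +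
        B (polyCurve q (derivCoeff q c) s) (polyCurve q c s) := by
    rw [hB (polyCurve q c s), two_mul]
  rw [h3, polyCurve_derivCoeff]
  simp only [polyCurve, map_sum, LinearMap.sum_apply, map_smul, LinearMap.smul_apply, smul_eq_mul,
    Finset.mul_sum, add_mul, Finset.sum_add_distrib]
  rw [add_comm]
  congr 1 <;> rw [Finset.sum_comm] <;>
  exact Finset.sum_congr rfl fun i _ => Finset.sum_congr rfl fun j _ => by ring

/-- The end value of a polynomial curve is controlled by its mean square. -/
lemma form_endpoint_le (hB : ∀ v w, B v w = B w v) (hB0 : ∀ v, 0 ≤ B v v) (q : ℕ) (c : ℕ → E)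
    {a b : ℝ} (hab : a < b) :
    (b - a) / ((q : ℝ) + 1) ^ 2 * B (polyCurve q c b) (polyCurve q c b) ≤
      ∫ s in a..b, B (polyCurve q c s) (polyCurve q c s) := by
  set k := b - a with hk
  have hk0 : 0 < k := sub_pos.2 hab
  set w := polyCurve q c b with hw
  -- The kernel for degree at most `q`: evaluation at the right end becomes an integral against `K`,
  -- with `∫ K² = (q + 1)²`.
  obtain ⟨K, -, hKK, hK⟩ := exists_kernel_of_eval_sq legendre_eval_one_sq (q + 1)
  set Y : ℝ → E := fun r => polyCurve q c (k * r + a) with hY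
  have hcY : Continuous fun r => B (Y r) (Y r) :=
    (continuous_form_polyCurve B q c c).comp (by fun_prop)
  have hYw : ∀ r, B (Y r) w = ∑ j ∈ Finset.range (q + 1), (k * r + a) ^ j * B (c j) w := fun r => by
    simp only [hY, polyCurve, map_sum, LinearMap.sum_apply, map_smul, LinearMap.smul_apply,
      smul_eq_mul]
  have hcw : Continuous fun r => B (Y r) w := by simp only [hYw]; fun_prop
  set g : Polynomial ℝ := ∑ j ∈ Finset.range (q + 1),
    (Polynomial.C k * Polynomial.X + Polynomial.C a) ^ j * Polynomial.C (B (c j) w) with hg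
  have hgev : ∀ r, g.eval r = B (Y r) w := fun r => by
    rw [hYw]; simp [hg, Polynomial.eval_finsetSum]
  have hgdeg : g.degree < (q + 1 : ℕ) := by
    rw [Polynomial.degree_lt_iff_coeff_zero]
    intro m hm
    refine Polynomial.coeff_eq_zero_of_natDegree_lt (lt_of_le_of_lt ?_ hm)
    refine Polynomial.natDegree_sum_le_of_forall_le _ _ fun j hj => ?_
    refine (Polynomial.natDegree_mul_C_le _ _).trans (Polynomial.natDegree_pow_le.trans ?_)
    have h1 : (Polynomial.C k * Polynomial.X + Polynomial.C a).natDegree ≤ 1 :=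
      Polynomial.natDegree_linear_le
    have := Finset.mem_range.1 hj
    nlinarith
  have hrep : ∫ r in (0 : ℝ)..1, B (Y r) w * K.eval r = B w w := by
    have := hK g hgdeg
    rw [unitIntegral_apply, hgev] at this
    simp only [Polynomial.eval_mul, hgev] at this
    rw [this, hY]
    simp [hk, hw]
  have hKint : ∫ r in (0 : ℝ)..1, K.eval r ^ 2 = ((q : ℝ) + 1) ^ 2 := by
    rw [unitIntegral_apply] at hKK
    simpa [pow_two] using hKK
  set μ : ℝ := (((q : ℝ) + 1) ^ 2)⁻¹ with hμ
  -- This is Cauchy–Schwarz without division, valid for a semi-definite form. The value `μ = (q +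
  -- 1)⁻²` optimizes the integrated inequality.
  have hpt : ∀ r, 0 ≤ B (Y r) (Y r) - 2 * μ * (B (Y r) w * K.eval r) +
      μ ^ 2 * B w w * K.eval r ^ 2 := fun r => by
    have := hB0 (Y r - (K.eval r * μ) • w)
    simp only [map_sub, LinearMap.sub_apply, map_smul, LinearMap.smul_apply, smul_eq_mul,
      hB w (Y r)] at this
    nlinarith
  have hint := intervalIntegral.integral_nonneg_of_forall (μ := volume) zero_le_one hpt
  rw [intervalIntegral.integral_add, intervalIntegral.integral_sub,
    intervalIntegral.integral_const_mul, intervalIntegral.integral_const_mul, hrep, hKint] at hint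
  rotate_left
  · exact hcY.intervalIntegrable _ _
  · exact (continuous_const.mul (hcw.mul K.continuous)).intervalIntegrable _ _
  · exact (hcY.sub (continuous_const.mul (hcw.mul K.continuous))).intervalIntegrable _ _
  · exact (continuous_const.mul (K.continuous.pow 2)).intervalIntegrable _ _
  have hsub : k * ∫ r in (0 : ℝ)..1, B (Y r) (Y r) =
      ∫ s in a..b, B (polyCurve q c s) (polyCurve q c s) := by
    rw [hY, ← smul_eq_mul, intervalIntegral.smul_integral_comp_mul_add
      (fun s => B (polyCurve q c s) (polyCurve q c s))]
    simp [hk]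
  rw [← hsub, div_eq_mul_inv, mul_assoc, ← hμ]
  refine mul_le_mul_of_nonneg_left ?_ hk0.le
  have : μ * ((q : ℝ) + 1) ^ 2 = 1 := inv_mul_cancel₀ (by positivity)
  have h3 : μ ^ 2 * B w w * ((q : ℝ) + 1) ^ 2 = μ * B w w := by
    calc _ = μ * B w w * (μ * ((q : ℝ) + 1) ^ 2) := by ring
      _ = _ := by rw [this, mul_one]
  rw [h3] at hint
  linarith

/-- Decay over one time step of the discontinuous Galerkin method. -/
lemma form_step_le (hB : ∀ v w, B v w = B w v) (hB0 : ∀ v, 0 ≤ B v v) (q : ℕ) (c : ℕ → E)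
    {a b κ : ℝ} (hab : a < b) (hκ : 0 ≤ κ) (w : E) {G : ℝ → ℝ} (hG : Continuous G)
    (hcoer : ∀ s, κ / 4 * B (polyCurve q c s) (polyCurve q c s) ≤ G s)
    (heq : (∫ s in a..b, (B (polyCurve q (derivCoeff q c) s) (polyCurve q c s) + G s)) +
      B (polyCurve q c a - w) (polyCurve q c a) = 0) :
    (1 + κ * (b - a) / (2 * ((q : ℝ) + 1) ^ 2)) * B (polyCurve q c b) (polyCurve q c b) ≤
      B w w := by
  have hc1 := continuous_form_polyCurve B q (derivCoeff q c) c
  have hc2 := continuous_form_polyCurve B q c c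
  rw [intervalIntegral.integral_add (hc1.intervalIntegrable _ _) (hG.intervalIntegrable _ _)] at heq
  have hft := intervalIntegral.integral_eq_sub_of_hasDerivAt
    (fun s _ => hasDerivAt_form_polyCurve B hB q c s)
    ((continuous_const.mul hc1).intervalIntegrable a b)
  rw [intervalIntegral.integral_const_mul] at hft
  have hend := form_endpoint_le B hB hB0 q c hab
  have hmono : κ / 4 * ∫ s in a..b, B (polyCurve q c s) (polyCurve q c s) ≤ ∫ s in a..b, G s := by
    rw [← intervalIntegral.integral_const_mul]
    exact intervalIntegral.integral_mono hab.le
      ((continuous_const.mul hc2).intervalIntegrable _ _) (hG.intervalIntegrable _ _) hcoer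
  -- The jump term obeys `2 B(Y - w, Y) = B(Y, Y) + B(Y - w, Y - w) - B(w, w)`, so it pays for the
  -- initial energy of the interval up to `B(w, w)`.
  have hyoung := hB0 (polyCurve q c a - w)
  simp only [map_sub, LinearMap.sub_apply, hB w (polyCurve q c a)] at hyoung heq
  have h4 := mul_le_mul_of_nonneg_left hend (by positivity : 0 ≤ κ / 4)
  have h5 : κ / 4 * ((b - a) / ((q : ℝ) + 1) ^ 2 * B (polyCurve q c b) (polyCurve q c b)) =
      κ * (b - a) / (2 * ((q : ℝ) + 1) ^ 2) * B (polyCurve q c b) (polyCurve q c b) / 2 := by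
    field_simp; ring
  rw [add_mul, one_mul]
  linarith

end curves

end

/-! ### Decay of the discontinuous Galerkin solution -/

section

variable {Ω : Set Plane} {𝒯 : Finset (Affine.Triangle ℝ Plane)} {p q N : ℕ} {C C' κ tf : ℝ}
  {t : ℕ → ℝ} {U₀ : Plane → ℝ} {U W : ℝ → Plane → ℝ}

@[simp] lemma dx_zero : dx 0 = 0 := by funext z; simp [dx, fderiv_zero]

@[simp] lemma dy_zero : dy 0 = 0 := by funext z; simp [dy, fderiv_zero]

@[simp] lemma xdy_zero : xdy 0 = 0 := by funext z; simp [xdy]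

@[simp] lemma innerA_zero_right (v : Plane → ℝ) : innerA Ω 𝒯 p C v 0 = 0 := by
  simp [innerA, ip, ipA]

@[simp] lemma formA_zero_right (u ut : Plane → ℝ) : formA Ω 𝒯 p C C' u ut 0 0 = 0 := by
  simp [formA, formSUPG, ip, ipA]

lemma coe_polyCurve (c : ℕ → femSpace Ω 𝒯 p) (s : ℝ) :
    (polyCurve q c s).1 = ∑ j ∈ Finset.range (q + 1), s ^ j • (c j : Plane → ℝ) := by
  simp [polyCurve]

lemma continuous_coe_polyCurve (c : ℕ → femSpace Ω 𝒯 p) :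
    Continuous fun s => (polyCurve q c s).1 := by
  simp only [coe_polyCurve]
  fun_prop

section interval

variable {a b : ℝ} {c : ℕ → femSpace Ω 𝒯 p}

lemma rightTrace_eq (hab : a < b) (h : ∀ s ∈ Set.Ioc a b, W s = (polyCurve q c s).1) :
    rightTrace W a = (polyCurve q c a).1 := by
  refine Tendsto.limUnder_eq ?_
  refine (((continuous_coe_polyCurve c).tendsto a).mono_left nhdsWithin_le_nhds).congr' ?_
  filter_upwards [Ioc_mem_nhdsGT hab] with s hs using (h s hs).symm

/-- The time intervals contain their right endpoints, so the value there agrees with the limit from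
the left. -/
lemma leftTrace_eq (hab : a < b) (h : ∀ s ∈ Set.Ioc a b, W s = (polyCurve q c s).1) :
    leftTrace W b = W b := by
  rw [h b ⟨hab, le_rfl⟩]
  refine Tendsto.limUnder_eq ?_
  refine (((continuous_coe_polyCurve c).tendsto b).mono_left nhdsWithin_le_nhds).congr' ?_
  filter_upwards [Ioo_mem_nhdsLT hab] with s hs using (h s ⟨hs.1, hs.2.le⟩).symm

lemma dt_eq (h : ∀ s ∈ Set.Ioc a b, W s = (polyCurve q c s).1) {s : ℝ} (hs : s ∈ Set.Ioo a b) :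
    dt W s = (polyCurve q (derivCoeff q c) s).1 := by
  funext z
  have h1 : (fun r => W r z) =ᶠ[𝓝 s]
      fun r => ∑ j ∈ Finset.range (q + 1), r ^ j * (c j : Plane → ℝ) z := by
    filter_upwards [Ioo_mem_nhds hs.1 hs.2] with r hr
    rw [h r ⟨hr.1, hr.2.le⟩, coe_polyCurve]
    simp
  have h2 : HasDerivAt (fun r => ∑ j ∈ Finset.range (q + 1), r ^ j * (c j : Plane → ℝ) z)
      (∑ j ∈ Finset.range (q + 1), (j : ℝ) * s ^ (j - 1) * (c j : Plane → ℝ) z) s :=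
    HasDerivAt.fun_sum fun j _ => (hasDerivAt_pow j s).mul_const _
  rw [dt, h1.deriv_eq, h2.deriv, polyCurve_derivCoeff]
  simp

end interval

lemma exists_polyCurve (hU : U ∈ spaceTime Ω 𝒯 p q N t) {m : ℕ} (hm : m < N) :
    ∃ c : ℕ → femSpace Ω 𝒯 p, ∀ s ∈ Set.Ioc (t m) (t (m + 1)), U s = (polyCurve q c s).1 := by
  obtain ⟨c, hc, h⟩ := hU m hm
  exact ⟨fun j => ⟨c j, hc j⟩, fun s hs => by rw [h s hs, coe_polyCurve]⟩

lemma IsPartition.le (ht : IsPartition tf N t) {i j : ℕ} (hij : i ≤ j) (hj : j ≤ N) :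
    t i ≤ t j := by
  induction j, hij using Nat.le_induction with
  | base => exact le_rfl
  | succ j hij ih => exact (ih (by omega)).trans (ht.2.2 j (by omega)).le

/-- The subintervals of a partition are disjoint. -/
lemma IsPartition.notMem (ht : IsPartition tf N t) {m n : ℕ} (hm : m < N) (hn : n < N)
    (hmn : n ≠ m) {s : ℝ} (hs : s ∈ Set.Ioc (t n) (t (n + 1))) :
    s ∉ Set.Ioc (t m) (t (m + 1)) := by
  rintro ⟨h1, h2⟩
  rcases hmn.lt_or_gt with h | h
  · exact absurd (ht.le h hm.le) (not_le.2 (h1.trans_le hs.2))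
  · exact absurd (ht.le h hn.le) (not_le.2 (hs.1.trans_le h2))

/-- The restriction of `U` to the `m`-th time interval, extended by zero. -/
def localize (t : ℕ → ℝ) (m : ℕ) (U : ℝ → Plane → ℝ) : ℝ → Plane → ℝ :=
  (Set.Ioc (t m) (t (m + 1))).indicator U

lemma localize_eq_zero (ht : IsPartition tf N t) {m n : ℕ} (hm : m < N) (hn : n < N)
    (hmn : n ≠ m) : ∀ s ∈ Set.Ioc (t n) (t (n + 1)),
      localize t m U s = (polyCurve q (0 : ℕ → femSpace Ω 𝒯 p) s).1 := fun s hs => by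
  rw [localize, Set.indicator_of_notMem (ht.notMem hm hn hmn hs), coe_polyCurve]
  simp

lemma localize_eq {m : ℕ} {c : ℕ → femSpace Ω 𝒯 p}
    (h : ∀ s ∈ Set.Ioc (t m) (t (m + 1)), U s = (polyCurve q c s).1) :
    ∀ s ∈ Set.Ioc (t m) (t (m + 1)), localize t m U s = (polyCurve q c s).1 := fun s hs => by
  rw [localize, Set.indicator_of_mem hs, h s hs]

lemma localize_mem (ht : IsPartition tf N t) (hU : U ∈ spaceTime Ω 𝒯 p q N t) {m : ℕ}
    (hm : m < N) : localize t m U ∈ spaceTime Ω 𝒯 p q N t := by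
  intro n hn
  by_cases hmn : n = m
  · subst hmn
    obtain ⟨c, hc⟩ := exists_polyCurve hU hn
    exact ⟨fun j => c j, fun j => (c j).2, fun s hs => by rw [localize_eq hc s hs, coe_polyCurve]⟩
  · refine ⟨fun _ => 0, fun _ => zero_mem _, fun s hs => ?_⟩
    rw [localize_eq_zero (Ω := Ω) (𝒯 := 𝒯) (p := p) (q := q) ht hm hn hmn s hs, coe_polyCurve]
    simp

@[simp] lemma polyCurve_zero {E : Type*} [AddCommGroup E] [Module ℝ E] (s : ℝ) :
    polyCurve q (0 : ℕ → E) s = 0 := by simp [polyCurve]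

@[simp] lemma derivCoeff_zero {E : Type*} [AddCommGroup E] [Module ℝ E] :
    derivCoeff q (0 : ℕ → E) = 0 := by funext j; simp [derivCoeff]

/-- The left limit at `t n`: the initial datum for `n = 0`. -/
def previous (t : ℕ → ℝ) (U₀ : Plane → ℝ) (U : ℝ → Plane → ℝ) : ℕ → Plane → ℝ
  | 0 => U₀
  | n + 1 => U (t (n + 1))

lemma previous_mem (ht : IsPartition tf N t) (hU₀ : U₀ ∈ femSpace Ω 𝒯 p)
    (hU : U ∈ spaceTime Ω 𝒯 p q N t) : ∀ n ≤ N, previous t U₀ U n ∈ femSpace Ω 𝒯 p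
  | 0, _ => hU₀
  | n + 1, hn => by
    obtain ⟨c, hc⟩ := exists_polyCurve hU (Nat.lt_of_succ_le hn)
    rw [previous, hc _ ⟨ht.2.2 n hn, le_rfl⟩]
    exact (polyCurve q c _).2

/-- The discontinuous Galerkin method on a single time interval. -/
lemma IsDGSolution.local_eq (ht : IsPartition tf N t) (h𝒯 : IsTriangulation Ω 𝒯)
    (hU₀ : U₀ ∈ femSpace Ω 𝒯 p)
    (hU : IsDGSolution Ω 𝒯 p q C C' N t U₀ U) {m : ℕ} (hm : m < N) {c : ℕ → femSpace Ω 𝒯 p}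
    (hc : ∀ s ∈ Set.Ioc (t m) (t (m + 1)), U s = (polyCurve q c s).1) :
    (∫ s in (t m)..(t (m + 1)),
      (innerForm C h𝒯 (polyCurve q (derivCoeff q c) s) (polyCurve q c s) +
        coerciveForm C C' h𝒯 (polyCurve q (fun j => (c j, derivCoeff q c j)) s)
          (polyCurve q (fun j => (c j, derivCoeff q c j)) s))) +
      innerForm C h𝒯 (polyCurve q c (t m) -
        ⟨previous t U₀ U m, previous_mem ht hU₀ hU.1 m hm.le⟩) (polyCurve q c (t m)) = 0 := by
  -- Testing with `U` cut off to one interval isolates the contributions of that interval and of the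
  -- jump at its left end.
  have heq := hU.2 _ (localize_mem ht hU.1 hm)
  set V := localize t m U with hV
  have hVm : ∀ s ∈ Set.Ioc (t m) (t (m + 1)), V s = (polyCurve q c s).1 := localize_eq hc
  have hVn : ∀ n < N, n ≠ m → ∀ s ∈ Set.Ioc (t n) (t (n + 1)),
      V s = (polyCurve q (0 : ℕ → femSpace Ω 𝒯 p) s).1 := fun n hn hmn =>
    localize_eq_zero ht hm hn hmn
  have htr : ∀ n < N, n ≠ m → rightTrace V (t n) = 0 := fun n hn hmn => by
    rw [rightTrace_eq (ht.2.2 n hn) (hVn n hn hmn)]; simp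
  have htrm : rightTrace V (t m) = (polyCurve q c (t m)).1 := rightTrace_eq (ht.2.2 m hm) hVm
  have hint : ∀ n < N, n ≠ m → ∫ s in (t n)..(t (n + 1)),
      (innerA Ω 𝒯 p C (dt U s) (V s) + formA Ω 𝒯 p C C' (U s) (dt U s) (V s) (dt V s)) = 0 := by
    intro n hn hmn
    -- At the right endpoint the cut-off function may jump, so the derivative formula is used on the
    -- open interval only.
    rw [intervalIntegral.integral_of_le (ht.2.2 n hn).le, integral_Ioc_eq_integral_Ioo]
    refine setIntegral_eq_zero_of_forall_eq_zero fun s hs => ?_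
    rw [dt_eq (hVn n hn hmn) hs, hVn n hn hmn s ⟨hs.1, hs.2.le⟩]
    simp
  have hintm : ∫ s in (t m)..(t (m + 1)),
      (innerA Ω 𝒯 p C (dt U s) (V s) + formA Ω 𝒯 p C C' (U s) (dt U s) (V s) (dt V s)) =
      ∫ s in (t m)..(t (m + 1)),
      (innerForm C h𝒯 (polyCurve q (derivCoeff q c) s) (polyCurve q c s) +
        coerciveForm C C' h𝒯 (polyCurve q (fun j => (c j, derivCoeff q c j)) s)
          (polyCurve q (fun j => (c j, derivCoeff q c j)) s)) := by
    rw [intervalIntegral.integral_of_le (ht.2.2 m hm).le, integral_Ioc_eq_integral_Ioo,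
      intervalIntegral.integral_of_le (ht.2.2 m hm).le, integral_Ioc_eq_integral_Ioo]
    refine setIntegral_congr_fun measurableSet_Ioo fun s hs => ?_
    have hs' : s ∈ Set.Ioc (t m) (t (m + 1)) := ⟨hs.1, hs.2.le⟩
    simp only [polyCurve_prod, innerForm_apply, coerciveForm_apply]
    rw [dt_eq hVm hs, dt_eq hc hs, hVm s hs', hc s hs']
  rw [formB, Finset.sum_eq_single_of_mem m (Finset.mem_range.2 hm)
    fun n hn hmn => hint n (Finset.mem_range.1 hn) hmn, hintm] at heq
  have hsub : ∀ w : femSpace Ω 𝒯 p, innerForm C h𝒯 (polyCurve q c (t m) - w) (polyCurve q c (t m)) =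
      innerA Ω 𝒯 p C ((polyCurve q c (t m)).1 - w.1) (polyCurve q c (t m)).1 := fun w => rfl
  -- For the first interval the datum `U₀`, on the right-hand side of the method, plays the role of
  -- the left trace.
  rcases m with _ | m
  · rw [Finset.sum_eq_zero, htrm, rightTrace_eq (ht.2.2 0 hm) hc] at heq
    · rw [map_sub, LinearMap.sub_apply, innerForm_apply, innerForm_apply]
      simp only [previous]
      linarith
    · intro n hn
      have := Finset.mem_Ico.1 hn
      rw [htr n this.2 (by omega), innerA_zero_right]
  · obtain ⟨d, hd⟩ := exists_polyCurve hU.1 (m := m) (by omega)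
    rw [Finset.sum_eq_single_of_mem (m + 1) (Finset.mem_Ico.2 ⟨by omega, hm⟩), htrm,
      rightTrace_eq (ht.2.2 _ hm) hc, leftTrace_eq (ht.2.2 m (by omega)) hd,
      htr 0 (by omega) (by omega), innerA_zero_right, innerA_zero_right, add_zero] at heq
    · rw [hsub]
      exact heq
    · intro n hn hmn
      rw [htr n (Finset.mem_Ico.1 hn).2 hmn, innerA_zero_right]

lemma normA_sq (h𝒯 : IsTriangulation Ω 𝒯) (hδ : ∀ T ∈ 𝒯, 0 < delta C p T) {v : Plane → ℝ}
    (hv : v ∈ femSpace Ω 𝒯 p) : normA Ω 𝒯 p C v ^ 2 = innerA Ω 𝒯 p C v v :=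
  Real.sq_sqrt (innerForm_nonneg h𝒯 hδ ⟨v, hv⟩)

/-- Decay of the discontinuous Galerkin solution. -/
theorem IsDGSolution.normA_sq_le (ht : IsPartition tf N t) (h𝒯 : IsTriangulation Ω 𝒯)
    (hδ : ∀ T ∈ 𝒯, 0 < delta C p T) (hκ : 0 ≤ κ)
    (hcoer : ∀ u ∈ femSpace Ω 𝒯 p, ∀ ut ∈ femSpace Ω 𝒯 p,
      κ / 4 * innerA Ω 𝒯 p C u u ≤ formA Ω 𝒯 p C C' u ut u ut)
    (hU₀ : U₀ ∈ femSpace Ω 𝒯 p) (hU : IsDGSolution Ω 𝒯 p q C C' N t U₀ U) (htf : 0 < tf) :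
    normA Ω 𝒯 p C (U tf) ^ 2 ≤
      (∏ n ∈ Finset.range N, (1 + κ * (t (n + 1) - t n) / (2 * (q + 1) ^ 2))⁻¹) *
        normA Ω 𝒯 p C U₀ ^ 2 := by
  have hmem := previous_mem ht hU₀ hU.1
  have hpos : ∀ n < N, 0 < 1 + κ * (t (n + 1) - t n) / (2 * ((q : ℝ) + 1) ^ 2) := fun n hn => by
    have := sub_pos.2 (ht.2.2 n hn)
    positivity
  have hstep : ∀ n < N, (1 + κ * (t (n + 1) - t n) / (2 * ((q : ℝ) + 1) ^ 2)) *
      normA Ω 𝒯 p C (previous t U₀ U (n + 1)) ^ 2 ≤ normA Ω 𝒯 p C (previous t U₀ U n) ^ 2 := by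
    intro n hn
    rw [normA_sq h𝒯 hδ (hmem _ hn), normA_sq h𝒯 hδ (hmem _ hn.le)]
    obtain ⟨c, hc⟩ := exists_polyCurve hU.1 hn
    have := form_step_le (innerForm C h𝒯) (innerForm_symm h𝒯) (innerForm_nonneg h𝒯 hδ) q c
      (ht.2.2 n hn) hκ _ (continuous_form_polyCurve (coerciveForm C C' h𝒯) q _ _)
      (fun s => ?_) (hU.local_eq ht h𝒯 hU₀ hn hc)
    · rw [previous, hc _ ⟨ht.2.2 n hn, le_rfl⟩]
      exact this
    · rw [polyCurve_prod]
      exact hcoer _ (polyCurve q c s).2 _ (polyCurve q (derivCoeff q c) s).2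
  have hprod : ∀ n ≤ N, normA Ω 𝒯 p C (previous t U₀ U n) ^ 2 ≤
      (∏ i ∈ Finset.range n, (1 + κ * (t (i + 1) - t i) / (2 * ((q : ℝ) + 1) ^ 2))⁻¹) *
        normA Ω 𝒯 p C U₀ ^ 2 := by
    intro n
    induction n with
    | zero => intro _; simp [previous]
    | succ n ih =>
      intro hn
      rw [Finset.prod_range_succ, mul_comm (∏ i ∈ _, _), mul_assoc, ← div_eq_inv_mul,
        le_div_iff₀' (hpos n hn)]
      exact (hstep n hn).trans (ih (by omega))
  -- Only for `N ≥ 1` is `previous t U₀ U N` the value of `U` at `tf`; `N = 0` would force `tf = 0`.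
  have hN : N ≠ 0 := by
    rintro rfl
    exact htf.ne (ht.1.symm.trans ht.2.1)
  obtain ⟨N, rfl⟩ := Nat.exists_eq_succ_of_ne_zero hN
  have := hprod _ le_rfl
  rwa [previous, ht.2.1] at this

lemma IsPartition.eq_mul (ht : IsPartition tf N t) {k : ℝ} (hk : ∀ n < N, t (n + 1) - t n = k) :
    tf = N * k := by
  have : ∀ n ≤ N, t n = n * k := by
    intro n
    induction n with
    | zero => intro _; simp [ht.1]
    | succ n ih =>
      intro hn
      have := hk n hn
      rw [ih (by omega)] at this
      push_cast
      linarith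
  rw [← ht.2.1, this N le_rfl]

/-- Decay of the discontinuous Galerkin solution, for uniform time steps. -/
theorem IsDGSolution.normA_le (ht : IsPartition tf N t) (h𝒯 : IsTriangulation Ω 𝒯)
    (hδ : ∀ T ∈ 𝒯, 0 < delta C p T) (hκ : 0 ≤ κ)
    (hcoer : ∀ u ∈ femSpace Ω 𝒯 p, ∀ ut ∈ femSpace Ω 𝒯 p,
      κ / 4 * innerA Ω 𝒯 p C u u ≤ formA Ω 𝒯 p C C' u ut u ut)
    (hU₀ : U₀ ∈ femSpace Ω 𝒯 p) (hU : IsDGSolution Ω 𝒯 p q C C' N t U₀ U) (htf : 0 < tf) {k : ℝ}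
    (hk : ∀ n < N, t (n + 1) - t n = k) :
    normA Ω 𝒯 p C (U tf) ≤
      (1 + κ * k / (2 * (q + 1) ^ 2)) ^ (-(tf / (2 * k))) * normA Ω 𝒯 p C U₀ := by
  have h := hU.normA_sq_le ht h𝒯 hδ hκ hcoer hU₀ htf
  have htfk := ht.eq_mul hk
  have hk0 : 0 < k := by
    by_contra! hk0
    have : (N : ℝ) * k ≤ 0 := mul_nonpos_of_nonneg_of_nonpos (Nat.cast_nonneg _) hk0
    linarith
  rw [Finset.prod_congr rfl fun n hn => by rw [hk n (Finset.mem_range.1 hn)], Finset.prod_const,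
    Finset.card_range] at h
  set x := 1 + κ * k / (2 * ((q : ℝ) + 1) ^ 2) with hx
  have hx0 : 0 < x := by positivity
  refine le_of_sq_le_sq (h.trans_eq ?_) (mul_nonneg (by positivity) (Real.sqrt_nonneg _))
  rw [mul_pow, ← Real.rpow_mul_natCast hx0.le, inv_pow, ← Real.rpow_natCast, ← Real.rpow_neg hx0.le]
  congr 2
  rw [htfk]
  field_simp
  norm_num

/-- The logarithm of the power is `-(s/2)` times the difference quotient at zero of `k ↦ log (1 + c
k)`, whose derivative there is `c`. -/
lemma tendsto_one_add_mul_rpow (c s : ℝ) :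
    Tendsto (fun k : ℝ => (1 + c * k) ^ (-(s / (2 * k)))) (𝓝[>] 0) (𝓝 (Real.exp (-(c / 2) * s))) := by
  have hd : HasDerivAt (fun k : ℝ => Real.log (1 + c * k)) c 0 := by
    have h1 : HasDerivAt (fun k : ℝ => 1 + c * k) c 0 := by
      simpa using ((hasDerivAt_id (0 : ℝ)).const_mul c).const_add 1
    simpa using h1.log (by simp)
  have ht := hd.tendsto_slope_zero_right
  simp only [zero_add, mul_zero, add_zero, Real.log_one, sub_zero, smul_eq_mul] at ht
  have h2 : Tendsto (fun k : ℝ => Real.exp (-(s / 2) * (k⁻¹ * Real.log (1 + c * k)))) (𝓝[>] 0)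
      (𝓝 (Real.exp (-(s / 2) * c))) :=
    (Real.continuous_exp.tendsto _).comp (ht.const_mul _)
  rw [show -(c / 2) * s = -(s / 2) * c by ring]
  refine h2.congr' ?_
  have h3 : ∀ᶠ k in 𝓝 (0 : ℝ), 0 < 1 + c * k :=
    (by fun_prop : Continuous fun k : ℝ => 1 + c * k).continuousAt.eventually_const_lt (by simp)
  filter_upwards [h3.filter_mono nhdsWithin_le_nhds, self_mem_nhdsWithin] with k hk hk0
  have hk0' : k ≠ 0 := (Set.mem_Ioi.1 hk0).ne'
  rw [Real.rpow_def_of_pos hk]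
  congr 1
  field_simp

end

section

open MvPolynomial

/-! ### Bilinear forms along curves in finite dimensional spaces -/

section

variable {E : Type*} [AddCommGroup E] [Module ℝ E] [FiniteDimensional ℝ E]

lemma form_eq_sum_repr (B : E →ₗ[ℝ] E →ₗ[ℝ] ℝ) (v w : E) :
    B v w = ∑ i, ∑ j, (Module.finBasis ℝ E).repr v i * (Module.finBasis ℝ E).repr w j *
      B (Module.finBasis ℝ E i) (Module.finBasis ℝ E j) := by
  conv_lhs => rw [← (Module.finBasis ℝ E).sum_repr v, ← (Module.finBasis ℝ E).sum_repr w]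
  simp only [map_sum, LinearMap.sum_apply, map_smul, LinearMap.smul_apply, smul_eq_mul,
    Finset.mul_sum]
  rw [Finset.sum_comm]
  exact Finset.sum_congr rfl fun i _ => Finset.sum_congr rfl fun j _ => by ring

variable [TopologicalSpace E] [IsTopologicalAddGroup E] [ContinuousSMul ℝ E] [T2Space E]

lemma continuous_repr (i) : Continuous fun v : E => (Module.finBasis ℝ E).repr v i :=
  ((Module.finBasis ℝ E).coord i).continuous_of_finiteDimensional

lemma continuous_form (B : E →ₗ[ℝ] E →ₗ[ℝ] ℝ) : Continuous fun v : E => B v v := by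
  have := continuous_repr (E := E)
  rw [funext fun v => form_eq_sum_repr B v v]
  fun_prop

/-- The finite element space carries the topology of pointwise convergence and no chosen norm. The
derivative of `u` is therefore given as a limit of difference quotients and passed to the continuous
coordinates. -/
lemma hasDerivAt_form (B : E →ₗ[ℝ] E →ₗ[ℝ] ℝ) {u : ℝ → E} {u' : E} {s : ℝ}
    (h : Tendsto (fun r => r⁻¹ • (u (s + r) - u s)) (𝓝[≠] 0) (𝓝 u')) :
    HasDerivAt (fun s => B (u s) (u s)) (B u' (u s) + B (u s) u') s := by
  have h1 : ∀ i, HasDerivAt (fun s => (Module.finBasis ℝ E).repr (u s) i)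
      ((Module.finBasis ℝ E).repr u' i) s := fun i => by
    rw [hasDerivAt_iff_tendsto_slope_zero]
    refine (((continuous_repr i).tendsto u').comp h).congr fun r => ?_
    simp
  have h2 := HasDerivAt.fun_sum (u := Finset.univ) fun i _ =>
    HasDerivAt.fun_sum (u := Finset.univ) fun j _ => ((h1 i).mul (h1 j)).mul_const
      (B (Module.finBasis ℝ E i) (Module.finBasis ℝ E j))
  simp only [form_eq_sum_repr B (u _)]
  refine h2.congr_deriv ?_
  rw [form_eq_sum_repr B u']
  simp only [add_mul, Finset.sum_add_distrib]

end

variable {Ω : Set Plane} {𝒯 : Finset (Affine.Triangle ℝ Plane)} {p : ℕ} {C C' κ tf : ℝ}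

/-! ### The finite element space is finite dimensional -/

/-- Discontinuous piecewise polynomials. -/
def brokenMap (𝒯 : Finset (Affine.Triangle ℝ Plane)) (p : ℕ) :
    (𝒯 → restrictTotalDegree (Fin 2) ℝ p) →ₗ[ℝ] (Plane → ℝ) where
  toFun P := ∑ T : 𝒯, (tri T).indicator (polyFun (P T))
  map_add' P Q := by
    rw [← Finset.sum_add_distrib]
    refine Finset.sum_congr rfl fun T _ => ?_
    rw [← Set.indicator_add']
    congr 1
    funext z
    simp
  map_smul' c P := by
    rw [Finset.smul_sum]
    refine Finset.sum_congr rfl fun T _ => ?_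
    funext z
    by_cases hz : z ∈ tri T <;> simp [hz]

/-- Restriction to the union of the elements. -/
def restrictMap (Ω : Set Plane) (𝒯 : Finset (Affine.Triangle ℝ Plane)) (p : ℕ) :
    femSpace Ω 𝒯 p →ₗ[ℝ] (Plane → ℝ) where
  toFun v := (⋃ T ∈ 𝒯, tri T).indicator v
  map_add' v w := by simp [Set.indicator_add']
  map_smul' c v := by
    funext z
    by_cases hz : z ∈ ⋃ T ∈ 𝒯, tri T <;> simp [Set.indicator, hz]

lemma restrictMap_mem_range (h𝒯 : IsTriangulation Ω 𝒯) (v : femSpace Ω 𝒯 p) :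
    restrictMap Ω 𝒯 p v ∈ LinearMap.range (brokenMap 𝒯 p) := by
  obtain ⟨P, hPd, hP⟩ := exists_isRep v.2
  refine ⟨fun T => ⟨P T, (mem_restrictTotalDegree _ _ _).2 (hPd T T.2)⟩, ?_⟩
  funext z
  simp only [brokenMap, restrictMap, LinearMap.coe_mk, AddHom.coe_mk, Finset.sum_apply]
  by_cases hz : z ∈ ⋃ T ∈ 𝒯, tri T
  · rw [Set.indicator_of_mem hz]
    simp only [Set.mem_iUnion] at hz
    obtain ⟨T, hT, hzT⟩ := hz
    rw [Finset.sum_eq_single_of_mem ⟨T, hT⟩ (Finset.mem_univ _), Set.indicator_of_mem hzT,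
      hP T hT hzT]
    intro T' _ hne
    refine Set.indicator_of_notMem (fun hz' => ?_) _
    exact Set.disjoint_left.1 (h𝒯.disjoint T'.2 hT fun h => hne (Subtype.ext h)) hz' hzT
  · rw [Set.indicator_of_notMem hz]
    refine Finset.sum_eq_zero fun T _ => Set.indicator_of_notMem (fun hzT => hz ?_) _
    exact Set.mem_biUnion T.2 hzT

/-- By continuity, zero values on the open elements force zero values on their closures, which cover
the closed domain. -/
lemma restrictMap_injective (h𝒯 : IsTriangulation Ω 𝒯) :
    Function.Injective (restrictMap Ω 𝒯 p) := by
  rw [← LinearMap.ker_eq_bot, LinearMap.ker_eq_bot']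
  intro v hv
  have h0 : ∀ T ∈ 𝒯, Set.EqOn v.1 0 (tri T) := fun T hT z hz => by
    have := congrFun hv z
    simp only [restrictMap, LinearMap.coe_mk, AddHom.coe_mk] at this
    have hz' : z ∈ ⋃ T ∈ 𝒯, tri T := Set.mem_biUnion (t := tri) hT hz
    rwa [Set.indicator_of_mem hz'] at this
  refine Subtype.ext (funext fun z => ?_)
  by_cases hz : z ∈ closure Ω
  · rw [← h𝒯.cover] at hz
    simp only [Set.mem_iUnion] at hz
    obtain ⟨T, hT, hzT⟩ := hz
    have hcont : ContinuousOn v.1 (closure (tri T)) :=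
      v.2.1.mono (closure_mono (h𝒯.subset T hT))
    exact (h0 T hT).of_subset_closure hcont continuousOn_const subset_closure le_rfl hzT
  · exact v.2.2.1 z hz

lemma finiteDimensional_femSpace (h𝒯 : IsTriangulation Ω 𝒯) :
    FiniteDimensional ℝ (femSpace Ω 𝒯 p) :=
  FiniteDimensional.of_injective
    ((restrictMap Ω 𝒯 p).codRestrict _ fun v => restrictMap_mem_range h𝒯 v)
    ((LinearMap.injective_codRestrict_iff _).2 (restrictMap_injective h𝒯))

/-! ### The semi-discrete method -/

/-- Decay of the semi-discrete solution. -/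
theorem IsSemidiscreteSolution.normA_le (h𝒯 : IsTriangulation Ω 𝒯)
    (hcoer : ∀ u ∈ femSpace Ω 𝒯 p, ∀ ut ∈ femSpace Ω 𝒯 p,
      κ / 4 * innerA Ω 𝒯 p C u u ≤ formA Ω 𝒯 p C C' u ut u ut)
    {𝒱 : Submodule ℝ (ℝ → Plane → ℝ)} {U : ℝ → Plane → ℝ}
    (hU : IsSemidiscreteSolution Ω 𝒯 p C C' tf 𝒱 U) (htf : 0 < tf) :
    normA Ω 𝒯 p C (U tf) ≤ Real.exp (-κ * tf / 4) * normA Ω 𝒯 p C (U 0) := by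
  classical
  have hfin := finiteDimensional_femSpace (p := p) h𝒯
  obtain ⟨hcurve, hUV, heq⟩ := hU
  obtain ⟨hmem, hcont, hdiff⟩ := hcurve U hUV
  -- The value `0` outside the time interval is a dummy that makes `u` a total function into the
  -- space.
  set u : ℝ → femSpace Ω 𝒯 p := fun s =>
    if h : s ∈ Set.Icc 0 tf then ⟨U s, hmem s h⟩ else 0 with hu
  have huU : ∀ s ∈ Set.Icc 0 tf, (u s).1 = U s := fun s hs => by simp [hu, hs.1, hs.2]
  have hucont : ContinuousOn u (Set.Icc 0 tf) :=
    Topology.IsInducing.subtypeVal.continuousOn_iff.2 (hcont.congr huU)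
  have hder : ∀ s ∈ Set.Ioo 0 tf, ∃ u' : femSpace Ω 𝒯 p, u'.1 = dt U s ∧
      Tendsto (fun r => r⁻¹ • (u (s + r) - u s)) (𝓝[≠] 0) (𝓝 u') := by
    intro s hs
    have hIcc : ∀ᶠ r in 𝓝[≠] (0 : ℝ), s + r ∈ Set.Icc 0 tf := by
      refine Filter.Eventually.filter_mono nhdsWithin_le_nhds ?_
      have : Tendsto (fun r => s + r) (𝓝 0) (𝓝 s) := by
        simpa using (continuous_const_add s).tendsto 0
      exact this.eventually (Icc_mem_nhds hs.1 hs.2)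
    have hlim : Tendsto (fun r => (r⁻¹ • (u (s + r) - u s)).1) (𝓝[≠] 0) (𝓝 (dt U s)) := by
      rw [tendsto_pi_nhds]
      intro z
      have h1 := (hdiff s hs z).hasDerivAt
      rw [hasDerivAt_iff_tendsto_slope_zero] at h1
      refine h1.congr' ?_
      filter_upwards [hIcc] with r hr
      simp [huU _ hr, huU s ⟨hs.1.le, hs.2.le⟩]
    -- Coercivity requires `U_t` in the finite element space: it is a limit of difference quotients,
    -- and a finite dimensional subspace is closed.
    have hdt : dt U s ∈ femSpace Ω 𝒯 p :=
      (Submodule.closed_of_finiteDimensional (femSpace Ω 𝒯 p)).mem_of_tendsto hlim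
        (Eventually.of_forall fun r => (r⁻¹ • (u (s + r) - u s)).2)
    exact ⟨⟨dt U s, hdt⟩, rfl, Topology.IsInducing.subtypeVal.tendsto_nhds_iff.2 hlim⟩
  set B := innerForm (p := p) C h𝒯
  -- Testing with `U` makes the derivative of `‖U‖_A²` equal to `-2 a_h`, at most `-(κ/2) ‖U‖_A²`;
  -- the exponential is the integrating factor.
  set F : ℝ → ℝ := fun s => Real.exp (κ / 2 * s) * B (u s) (u s) with hF
  have hFc : ContinuousOn F (Set.Icc 0 tf) :=
    (by fun_prop : Continuous fun s => Real.exp (κ / 2 * s)).continuousOn.mul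
      ((continuous_form B).comp_continuousOn hucont)
  have hFd : ∀ s ∈ Set.Ioo 0 tf, ∃ F', HasDerivAt F F' s ∧ F' ≤ 0 := by
    intro s hs
    obtain ⟨u', hu', hlim⟩ := hder s hs
    have hs' : s ∈ Set.Icc 0 tf := ⟨hs.1.le, hs.2.le⟩
    have h1 := hasDerivAt_form B hlim
    have h2 : HasDerivAt (fun s => Real.exp (κ / 2 * s)) (Real.exp (κ / 2 * s) * (κ / 2)) s := by
      simpa using ((hasDerivAt_id s).const_mul (κ / 2)).exp
    refine ⟨_, h2.mul h1, ?_⟩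
    have h3 := heq U hUV s hs
    have h4 := hcoer _ (hmem s hs') _ (hu' ▸ u'.2 : dt U s ∈ femSpace Ω 𝒯 p)
    have h5 : B u' (u s) = innerA Ω 𝒯 p C (dt U s) (U s) := by
      rw [← hu', ← huU s hs']; rfl
    have h6 : B (u s) (u s) = innerA Ω 𝒯 p C (U s) (U s) := by rw [← huU s hs']; rfl
    have h7 : B (u s) u' = B u' (u s) := innerForm_symm h𝒯 _ _
    rw [h7, h5, h6]
    have h8 := Real.exp_pos (κ / 2 * s)
    nlinarith
  have hanti : AntitoneOn F (Set.Icc 0 tf) := by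
    refine antitoneOn_of_deriv_nonpos (convex_Icc 0 tf) hFc ?_ ?_
    · intro s hs
      rw [interior_Icc] at hs
      obtain ⟨F', hF', -⟩ := hFd s hs
      exact hF'.differentiableAt.differentiableWithinAt
    · intro s hs
      rw [interior_Icc] at hs
      obtain ⟨F', hF', hle⟩ := hFd s hs
      rwa [hF'.deriv]
  have h0 : (0 : ℝ) ∈ Set.Icc 0 tf := ⟨le_rfl, htf.le⟩
  have h1 : tf ∈ Set.Icc 0 tf := ⟨htf.le, le_rfl⟩
  have hle := hanti h0 h1 htf.le
  simp only [hF, mul_zero, Real.exp_zero, one_mul] at hle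
  have e0 : B (u 0) (u 0) = innerA Ω 𝒯 p C (U 0) (U 0) := by rw [← huU 0 h0]; rfl
  have e1 : B (u tf) (u tf) = innerA Ω 𝒯 p C (U tf) (U tf) := by rw [← huU tf h1]; rfl
  rw [e0, e1] at hle
  have hexp : Real.exp (-κ * tf / 4) = √(Real.exp (-(κ / 2 * tf))) := by
    rw [← Real.exp_half]; congr 1; ring
  rw [normA, normA, hexp, ← Real.sqrt_mul (Real.exp_nonneg _)]
  refine Real.sqrt_le_sqrt ?_
  rw [Real.exp_neg, ← div_eq_inv_mul, le_div_iff₀' (Real.exp_pos _)]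
  exact hle

end

end Kolmogorov

end

/-! ### The theorem -/

open Kolmogorov in
theorem mainTheorem5 (Ω : Set Plane) (hΩ : IsPolygonalDomain Ω)
    (hinflow : 0 < μH[1] (inflowBoundary Ω))
    (hbdry : ∀ z n, IsOutwardNormal Ω z n → n 0 ≠ 0 → 0 ≤ z 0 * n 1)
    (σ : ℝ) (hσ : 0 < σ) :
    (∃ Cinv > 0, ∃ CINV > 0, ∀ T : Affine.Triangle ℝ Plane, ShapeRegular σ T → ∀ p ≥ 1,
      TraceInverse Cinv p T ∧ GradInverse CINV p T) ∧
    ∀ Cinv > 0, ∃ chc : ℝ, 0 < chc ∧ chc < 1 ∧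
      ∀ CINV > 0, ∀ (𝒯 : Finset (Affine.Triangle ℝ Plane)) (p : ℕ) (κ tf : ℝ),
        IsTriangulation Ω 𝒯 → (∀ T ∈ 𝒯, ShapeRegular σ T) → (∀ T ∈ 𝒯, hT T < 1) → 1 ≤ p →
        (∀ T ∈ 𝒯, TraceInverse Cinv p T ∧ GradInverse CINV p T) →
        κ = chc * hmin 𝒯 ^ 4 / p ^ 8 → 0 < tf →
        -- the fully discrete method, arbitrary timesteps
        (∀ (q N : ℕ) (t : ℕ → ℝ) (U₀ : Plane → ℝ) (U : ℝ → Plane → ℝ),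
          IsPartition tf N t → U₀ ∈ femSpace Ω 𝒯 p → IsDGSolution Ω 𝒯 p q Cinv CINV N t U₀ U →
          normA Ω 𝒯 p Cinv (U tf) ^ 2 ≤
            (∏ n ∈ Finset.range N, (1 + κ * (t (n + 1) - t n) / (2 * (q + 1) ^ 2))⁻¹) *
              normA Ω 𝒯 p Cinv U₀ ^ 2) ∧
        -- the fully discrete method, uniform timesteps
        (∀ (q N : ℕ) (k : ℝ) (t : ℕ → ℝ) (U₀ : Plane → ℝ) (U : ℝ → Plane → ℝ),
          IsPartition tf N t → (∀ n < N, t (n + 1) - t n = k) → U₀ ∈ femSpace Ω 𝒯 p →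
          IsDGSolution Ω 𝒯 p q Cinv CINV N t U₀ U →
          normA Ω 𝒯 p Cinv (U tf) ≤
            (1 + κ * k / (2 * (q + 1) ^ 2)) ^ (-(tf / (2 * k))) * normA Ω 𝒯 p Cinv U₀) ∧
        -- the limit of the last bound as the timestep tends to zero
        (∀ (q : ℕ), ∀ U₀ ∈ femSpace Ω 𝒯 p,
          Tendsto
            (fun k : ℝ =>
              (1 + κ * k / (2 * (q + 1) ^ 2)) ^ (-(tf / (2 * k))) * normA Ω 𝒯 p Cinv U₀)
            (𝓝[>] 0) (𝓝 (Real.exp (-(κ / (4 * (q + 1) ^ 2)) * tf) * normA Ω 𝒯 p Cinv U₀))) ∧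
        -- the semi-discrete method
        (∀ (𝒱 : Submodule ℝ (ℝ → Plane → ℝ)) (U : ℝ → Plane → ℝ),
          IsSemidiscreteSolution Ω 𝒯 p Cinv CINV tf 𝒱 U →
          normA Ω 𝒯 p Cinv (U tf) ≤ Real.exp (-κ * tf / 4) * normA Ω 𝒯 p Cinv (U 0)) := by
  refine ⟨exists_inverse_constants hσ, fun Cinv hC => ?_⟩
  -- Positive length serves to provide one inflow point, around which a whole half disc starts the
  -- Friedrichs inequality.
  have hin : (inflowBoundary Ω).Nonempty := by
    rw [Set.nonempty_iff_ne_empty]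
    intro h
    simp [h] at hinflow
  obtain ⟨chc, h0, h1, hcoer⟩ := exists_hypocoercivity_constant hΩ hin hbdry hσ hC
  refine ⟨chc, h0, h1, fun CINV hC' 𝒯 p κ tf h𝒯 hsr hh hp hinv hκ htf => ?_⟩
  have hmin0 := hmin_pos (h𝒯.nonempty hΩ.isConnected.nonempty)
  have hp' : (1 : ℝ) ≤ p := by exact_mod_cast hp
  have hκ0 : 0 ≤ κ := by rw [hκ]; positivity
  have hδ : ∀ T ∈ 𝒯, 0 < delta Cinv p T := fun T hT =>
    lt_of_lt_of_le (by positivity) (le_delta hσ (hsr T hT) (hh T hT) hp)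
  have hco := hcoer CINV hC' 𝒯 p h𝒯 hsr hh hp hinv
  rw [← hκ] at hco
  refine ⟨fun q N t U₀ U ht hU₀ hU => hU.normA_sq_le ht h𝒯 hδ hκ0 hco hU₀ htf,
    fun q N k t U₀ U ht hk hU₀ hU => hU.normA_le ht h𝒯 hδ hκ0 hco hU₀ htf hk,
    fun q U₀ _ => ?_, fun 𝒱 U hU => hU.normA_le h𝒯 hco htf⟩
  have hlim := (tendsto_one_add_mul_rpow (κ / (2 * ((q : ℝ) + 1) ^ 2)) tf).mul_const
    (normA Ω 𝒯 p Cinv U₀)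
  have e1 : κ / (2 * ((q : ℝ) + 1) ^ 2) / 2 = κ / (4 * ((q : ℝ) + 1) ^ 2) := by
    rw [div_div]; congr 1; ring
  rw [e1] at hlim
  simpa only [div_mul_eq_mul_div] using hlim
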